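/- Fix $b_1,b_2\in(0,1)$ and let $\mathcal S=\{0,1\}^{\mathbb Z}$ with the product $\sigma$-algebra; $\eta(x)=1$ means that the site $x$ is occupied by a particle. **The S6V model.** Let $\{\chi_t(x),j_t(x):x\in\mathbb Z,\ t\in\mathbb Z_{\ge 0}\}$ be independent with $\mathbb P(\chi_t(x)=1)=b_1=1-\mathbb P(\chi_t(x)=0)$ and $\mathbb P(j_t(x)=n)=(1-b_2)b_2^{n-1}$ for $n\ge 1$. Given $\eta_t\in\mathcal S$ (with finitely or infinitely many particles), the particles are updated from left to right: the particle at an occupied site $x$ moves if $\chi_t(x)=0$ or if the new position of the next particle to its left is $x$, and otherwise it stays at $x$. If it moves, its new position is $\min(x+j_t(x),x')$, where $x'$ is the next occupied site of $\eta_t$ to the right of $x$ ($x'=+\infty$ if there is none). (If there are infinitely many particles to the left, then almost surely infinitely many of them have $\chi_t=0$, so that the update is well defined.) The configuration $\eta_{t+1}$ is the indicator of the set of new positions. The shifted S6V model, i.e. the model in a frame moving to the right at speed $1$, is $\eta'_t=\tau_t(\eta_t)$, where $\tau_n(\eta)(i)=\eta(i+n)$. Let $\mathfrak I$ be the set of its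 stationary distributions, that is, of the probability measures $\mu$ on $\mathcal S$ such that $\eta'_t\sim\mu$ for all $t\ge 0$ if $\eta_0\sim\mu$ is independent of all $\chi_t(x),j_t(x)$. Let $\mathfrak I_e$ be the set of those $\nu\in\mathfrak I$ for which there are no $\nu_1\ne\nu_2$ in $\mathfrak I$ and $\alpha\in(0,1)$ with $\nu=\alpha\nu_1+(1-\alpha)\nu_2$. **The measures.** For $\rho\in[0,1]$ let $\mu_\rho=\bigotimes_{k\in\mathbb Z}\mathrm{Ber}(\rho)$. Let $q=b_1/b_2$ and $$\mu_*=\bigotimes_{k\in\mathbb Z}\mathrm{Ber}\Big(\frac{q^{-k}}{1+q^{-k}}\Big).$$ For $n\in\mathbb Z$ let $$A_n=\Big\{\eta:\ \sum_{i\le 0}(1-\eta(i))+n=\sum_{i\ge 1}\eta(i)<\infty\Big\}\ \text{ if } q>1,\qquad A_n=\Big\{\eta:\ \sum_{i\le 0}\eta(i)+n=\sum_{i\ge 1}(1-\eta(i))<\infty\Big\}\ \text{ if } q<1,$$ and let $\mu_{(n)}=\mu_*(\,\cdot\,\cap A_n)/\mu_*(A_n)$. **Theorem.** If $q\ne 1$,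 then $$\mathfrak I_e=\{\mu_\rho\}_{\rho\in[0,1]}\cup\{\mu_{(n)}\}_{n\in\mathbb Z}.$$ -/

import Mathlib

open MeasureTheory ProbabilityTheory unitInterval

noncomputable section

namespace S6V

/-- The state space `{0, 1}^ℤ`: `η x = true` means that the site `x` is occupied. It carries the
product σ-algebra. -/
abbrev Config : Type := ℤ → Bool

/-- The randomness of one update: `w x = (χ x, j x)`. -/
abbrev StepNoise : Type := ℤ → Bool × ℕ

/-- The target of a moving particle that starts at the occupied site `x`:
`min (x + j x, next occupied site to the right of x)`, for `j x ≥ 1`. -/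
def landing (η : Config) (w : StepNoise) (x : ℤ) : ℤ :=
  x + (sInf {n : ℕ | 0 < n ∧ (n = (w x).2 ∨ η (x + n) = true)} : ℕ)

/-- `Moves η w x`: the particle at the occupied site `x` moves during the update. Either it wakes up
by itself (`χ x = 0`), or the particle to its left moves and lands on `x`. The updates run from left
to right, hence an inductive predicate; it makes sense for finitely and for infinitely many
particles. -/
inductive Moves (η : Config) (w : StepNoise) : ℤ → Prop
  | wake (x : ℤ) : η x = true → (w x).1 = false → Moves η w x
  | push (y x : ℤ) : Moves η w y → η x = true → landing η w y = x → y < x → Moves η w x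

open Classical in
/-- The position after the update of the particle which is at the occupied site `x`. -/
def newPos (η : Config) (w : StepNoise) (x : ℤ) : ℤ :=
  if Moves η w x then landing η w x else x

open Classical in
/-- One update of the stochastic six vertex model: a site is occupied afterwards iff it is the new
position of some particle. -/
def step (η : Config) (w : StepNoise) : Config :=
  fun z => decide (∃ x, η x = true ∧ newPos η w x = z)

lemma measurable_occupied {X : Type*} [MeasurableSpace X] {f : X → Config} (hf : Measurable f)
    (z : ℤ) (b : Bool) : MeasurableSet {p | f p z = b} :=
  ((measurable_pi_apply z).comp hf) (measurableSet_singleton b)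

lemma measurable_landing (x : ℤ) :
    Measurable fun p : Config × StepNoise => landing p.1 p.2 x := by
  have hP : ∀ n : ℕ, MeasurableSet
      {p : Config × StepNoise | 0 < n ∧ (n = (p.2 x).2 ∨ p.1 (x + n) = true)} := by
    intro n
    refine MeasurableSet.inter (MeasurableSet.const _) (MeasurableSet.union ?_ ?_)
    · have h : Measurable fun p : Config × StepNoise => (p.2 x).2 := by fun_prop
      have h2 := h (measurableSet_singleton n)
      have h3 : {p : Config × StepNoise | n = (p.2 x).2} =
          (fun p : Config × StepNoise => (p.2 x).2) ⁻¹' {n} := by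
        ext p; simp [eq_comm]
      change MeasurableSet {p : Config × StepNoise | n = (p.2 x).2}
      rw [h3]
      exact h2
    · exact measurable_occupied measurable_fst _ _
  have hs : Measurable fun p : Config × StepNoise =>
      sInf {n : ℕ | 0 < n ∧ (n = (p.2 x).2 ∨ p.1 (x + n) = true)} := by
    refine measurable_of_Iio fun k => ?_
    have : (fun p : Config × StepNoise =>
        sInf {n : ℕ | 0 < n ∧ (n = (p.2 x).2 ∨ p.1 (x + n) = true)}) ⁻¹' Set.Iio k =
        {p | (∃ n < k, 0 < n ∧ (n = (p.2 x).2 ∨ p.1 (x + n) = true)) ∨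
          (0 < k ∧ ∀ n : ℕ, ¬ (0 < n ∧ (n = (p.2 x).2 ∨ p.1 (x + n) = true)))} := by
      ext p
      simp only [Set.mem_preimage, Set.mem_Iio, Set.mem_ofPred_eq]
      constructor
      · intro h
        by_cases hne : {n : ℕ | 0 < n ∧ (n = (p.2 x).2 ∨ p.1 (x + n) = true)}.Nonempty
        · exact Or.inl ⟨_, h, Nat.sInf_mem hne⟩
        · exact Or.inr ⟨by omega, fun n hn => hne ⟨n, hn⟩⟩
      · rintro (⟨n, hn, h⟩ | ⟨hk, h⟩)
        · exact lt_of_le_of_lt (Nat.sInf_le h) hn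
        · rw [show {n : ℕ | 0 < n ∧ (n = (p.2 x).2 ∨ p.1 (x + n) = true)} = ∅ from
            Set.eq_empty_of_forall_notMem h]
          simpa using hk
    rw [this]
    refine MeasurableSet.union ?_ (MeasurableSet.inter (MeasurableSet.const _) ?_)
    · have : {p : Config × StepNoise |
          ∃ n < k, 0 < n ∧ (n = (p.2 x).2 ∨ p.1 (x + n) = true)} =
          ⋃ n ∈ Set.Iio k, {p | 0 < n ∧ (n = (p.2 x).2 ∨ p.1 (x + n) = true)} := by
        ext p
        simp only [Set.mem_iUnion, Set.mem_Iio, Set.mem_ofPred_eq, exists_prop]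
      change MeasurableSet {p : Config × StepNoise |
          ∃ n < k, 0 < n ∧ (n = (p.2 x).2 ∨ p.1 (x + n) = true)}
      rw [this]
      exact MeasurableSet.biUnion (Set.to_countable _) fun n _ => hP n
    · have : {p : Config × StepNoise |
          ∀ n : ℕ, ¬ (0 < n ∧ (n = (p.2 x).2 ∨ p.1 (x + n) = true))} =
          ⋂ n : ℕ, {p | 0 < n ∧ (n = (p.2 x).2 ∨ p.1 (x + n) = true)}ᶜ := by
        ext p; simp
      change MeasurableSet {p : Config × StepNoise |
          ∀ n : ℕ, ¬ (0 < n ∧ (n = (p.2 x).2 ∨ p.1 (x + n) = true))}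
      rw [this]
      exact MeasurableSet.iInter fun n => (hP n).compl
  unfold landing
  exact (measurable_of_countable (fun n : ℕ => x + (n : ℤ))).comp hs

/-- The particles that move because of a chain of at most `m` pushes. -/
def MovesIn (η : Config) (w : StepNoise) : ℕ → ℤ → Prop
  | 0, x => η x = true ∧ (w x).1 = false
  | m + 1, x => ∃ y, MovesIn η w m y ∧ η x = true ∧ landing η w y = x ∧ y < x

lemma moves_iff (η : Config) (w : StepNoise) (x : ℤ) :
    Moves η w x ↔ ∃ m, MovesIn η w m x := by
  constructor
  · intro h
    induction h with
    | wake x h1 h2 => exact ⟨0, h1, h2⟩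
    | push y x _ h1 h2 h3 ih =>
      obtain ⟨m, hm⟩ := ih
      exact ⟨m + 1, y, hm, h1, h2, h3⟩
  · rintro ⟨m, hm⟩
    induction m generalizing x with
    | zero => exact .wake x hm.1 hm.2
    | succ m ih =>
      obtain ⟨y, hy, h1, h2, h3⟩ := hm
      exact .push y x (ih y hy) h1 h2 h3

lemma measurableSet_moves (x : ℤ) :
    MeasurableSet {p : Config × StepNoise | Moves p.1 p.2 x} := by
  have key : ∀ m x, MeasurableSet {p : Config × StepNoise | MovesIn p.1 p.2 m x} := by
    intro m
    induction m with
    | zero =>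
      intro x
      refine MeasurableSet.inter (measurable_occupied measurable_fst _ _) ?_
      have h : Measurable fun p : Config × StepNoise => (p.2 x).1 := by fun_prop
      exact h (measurableSet_singleton false)
    | succ m ih =>
      intro x
      have : {p : Config × StepNoise | MovesIn p.1 p.2 (m + 1) x} =
          ⋃ y, ({p | MovesIn p.1 p.2 m y} ∩ ({p | p.1 x = true} ∩
            ({p | landing p.1 p.2 y = x} ∩ {_p | y < x}))) := by
        ext p; simp [MovesIn]
      rw [this]
      exact MeasurableSet.iUnion fun y => (ih y).inter
        ((measurable_occupied measurable_fst _ _).inter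
          ((measurable_landing y (measurableSet_singleton x)).inter (MeasurableSet.const _)))
  have : {p : Config × StepNoise | Moves p.1 p.2 x} =
      ⋃ m, {p | MovesIn p.1 p.2 m x} := by
    ext p; simp [moves_iff]
  rw [this]
  exact MeasurableSet.iUnion fun m => key m x

lemma measurable_step : Measurable fun p : Config × StepNoise => step p.1 p.2 := by
  refine measurable_pi_lambda _ fun z => ?_
  refine measurable_to_bool ?_
  have : (fun p : Config × StepNoise => step p.1 p.2 z) ⁻¹' {true} =
      ⋃ x, ({p | p.1 x = true} ∩ {p | newPos p.1 p.2 x = z}) := by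
    ext p; simp [step]
  rw [this]
  refine MeasurableSet.iUnion fun x => (measurable_occupied measurable_fst _ _).inter ?_
  have h : Measurable fun p : Config × StepNoise => newPos p.1 p.2 x :=
    Measurable.ite (measurableSet_moves x) (measurable_landing x) measurable_const
  exact h (measurableSet_singleton z)

/-- The stochastic six vertex model occupation process `η_t`, with initial configuration `η₀` and
with the noise `ω t` in the update from time `t` to time `t + 1`. -/
def process (η₀ : Config) (ω : ℕ → StepNoise) : ℕ → Config
  | 0 => η₀
  | t + 1 => step (process η₀ ω t) (ω t)

/-- The shift `τ_n`, `(τ_n η) i = η (i + n)`. -/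
def shift (n : ℤ) (η : Config) : Config := fun i => η (i + n)

/-- The model in a frame that moves to the right at speed `1`: `η'_t = τ_t η_t`. -/
def shiftedProcess (η₀ : Config) (ω : ℕ → StepNoise) (t : ℕ) : Config :=
  shift t (process η₀ ω t)

/-- The maps `(η_0, ω) ↦ η'_t` are measurable, so that their laws are meaningful. -/
lemma measurable_shiftedProcess (t : ℕ) :
    Measurable fun p : Config × (ℕ → StepNoise) => shiftedProcess p.1 p.2 t := by
  have h : ∀ t, Measurable fun p : Config × (ℕ → StepNoise) => process p.1 p.2 t := by
    intro t
    induction t with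
    | zero => exact measurable_fst
    | succ t ih =>
      exact measurable_step.comp (ih.prodMk ((measurable_pi_apply t).comp measurable_snd))
  exact measurable_pi_lambda _ fun i => (measurable_pi_apply (i + (t : ℤ))).comp (h t)

/-- The law of `j` : `P (j = n) = (1 - b₂) * b₂ ^ (n - 1)` for `n ≥ 1`. -/
def jumpLaw (b₂ : I) : Measure ℕ := (geometricMeasure (σ b₂)).map (fun n => n + 1)

instance (b₂ : I) : IsProbabilityMeasure (jumpLaw b₂) :=
  Measure.isProbabilityMeasure_map (by fun_prop)

/-- The noise of one update: all `χ x` and `j x` are independent, `χ x` is `Ber(b₁)`-distributed and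
`j x` is distributed according to `jumpLaw b₂`. -/
def stepNoiseLaw (b₁ b₂ : I) : Measure StepNoise :=
  Measure.infinitePi fun _ : ℤ => (bernoulliMeasure true false b₁).prod (jumpLaw b₂)

instance (b₁ b₂ : I) : IsProbabilityMeasure (stepNoiseLaw b₁ b₂) := by
  unfold stepNoiseLaw; infer_instance

/-- The noise at all times: independent copies of the noise of one update. -/
def noiseLaw (b₁ b₂ : I) : Measure (ℕ → StepNoise) :=
  Measure.infinitePi fun _ : ℕ => stepNoiseLaw b₁ b₂

instance (b₁ b₂ : I) : IsProbabilityMeasure (noiseLaw b₁ b₂) := by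
  unfold noiseLaw; infer_instance

/-- The law of `η'_t` when `η_0` has law `μ` and is independent of the noise. -/
def shiftedLaw (b₁ b₂ : I) (μ : Measure Config) (t : ℕ) : Measure Config :=
  (μ.prod (noiseLaw b₁ b₂)).map fun p => shiftedProcess p.1 p.2 t

/-- The set of stationary distributions of the shifted model. -/
def stationary (b₁ b₂ : I) : Set (Measure Config) :=
  {μ | IsProbabilityMeasure μ ∧ ∀ t, shiftedLaw b₁ b₂ μ t = μ}

/-- The extremal elements of a set of measures: those which are not a proper convex combination of
two different elements of the set. -/
def extremal (K : Set (Measure Config)) : Set (Measure Config) :=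
  {ν | ν ∈ K ∧ ¬ ∃ ν₁ ∈ K, ∃ ν₂ ∈ K, ν₁ ≠ ν₂ ∧ ∃ α : ℝ, 0 < α ∧ α < 1 ∧
    ν = ENNReal.ofReal α • ν₁ + ENNReal.ofReal (1 - α) • ν₂}

/-- The product Bernoulli measure `μ_ρ` with density `ρ`. -/
def bernoulliProduct (ρ : I) : Measure Config :=
  Measure.infinitePi fun _ : ℤ => bernoulliMeasure true false ρ

/-- The parameter `q = b₁ / b₂`. -/
def ratio (b₁ b₂ : I) : ℝ := (b₁ : ℝ) / (b₂ : ℝ)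

lemma ratio_nonneg (b₁ b₂ : I) : 0 ≤ ratio b₁ b₂ := div_nonneg b₁.2.1 b₂.2.1

/-- The density `q ^ (-k) / (1 + q ^ (-k))` at the site `k`. -/
def blockingDensity (b₁ b₂ : I) (k : ℤ) : I :=
  ⟨ratio b₁ b₂ ^ (-k) / (1 + ratio b₁ b₂ ^ (-k)), by
    have h : 0 ≤ ratio b₁ b₂ ^ (-k) := zpow_nonneg (ratio_nonneg b₁ b₂) _
    exact ⟨by positivity, div_le_one_of_le₀ (by linarith) (by linarith)⟩⟩

/-- The inhomogeneous product measure `μ_*`. -/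
def blockingProduct (b₁ b₂ : I) : Measure Config :=
  Measure.infinitePi fun k : ℤ => bernoulliMeasure true false (blockingDensity b₁ b₂ k)

/-- The configurations with `∑_{i ≤ 0} (1 - η i) + n = ∑_{i ≥ 1} η i < ∞`. -/
def leftPackedClass (n : ℤ) : Set Config :=
  {η | {i : ℤ | i ≤ 0 ∧ η i = false}.Finite ∧ {i : ℤ | 1 ≤ i ∧ η i = true}.Finite ∧
    ({i : ℤ | i ≤ 0 ∧ η i = false}.ncard : ℤ) + n = {i : ℤ | 1 ≤ i ∧ η i = true}.ncard}

/-- The configurations with `∑_{i ≤ 0} η i + n = ∑_{i ≥ 1} (1 - η i) < ∞`, the previous class with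
particles and holes exchanged. -/
def rightPackedClass (n : ℤ) : Set Config :=
  {η | {i : ℤ | i ≤ 0 ∧ η i = true}.Finite ∧ {i : ℤ | 1 ≤ i ∧ η i = false}.Finite ∧
    ({i : ℤ | i ≤ 0 ∧ η i = true}.ncard : ℤ) + n = {i : ℤ | 1 ≤ i ∧ η i = false}.ncard}

open Classical in
/-- The classes `A_n`. For `q > 1` the measure `μ_*` has density tending to `1` at `-∞`, for `q < 1`
it has density tending to `1` at `+∞`. -/
def blockingClass (b₁ b₂ : I) (n : ℤ) : Set Config :=
  if 1 < ratio b₁ b₂ then leftPackedClass n else rightPackedClass n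

/-- The blocking measure `μ_(n)`: the measure `μ_*` restricted to `A_n` and normalized. -/
def blockingMeasure (b₁ b₂ : I) (n : ℤ) : Measure Config :=
  ProbabilityTheory.cond (blockingProduct b₁ b₂) (blockingClass b₁ b₂ n)

end S6V

end

open MeasureTheory ProbabilityTheory unitInterval Filter Topology
open scoped ENNReal

set_option linter.unusedSectionVars false

/-! The proof is the coupling method for attractive particle systems. The update is first rewritten
as a six vertex model with coins attached to the sites, `siteStep`. For every fixed configuration it
has the same law as the shifted particle update (`map_shift_step`), so the stationary laws are the
fixed points of `siteEvolve` (`stationary_eq`). In this form the update is monotone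
(`siteStep_mono`), and it is almost surely continuous, because reset sites cut off the influence of
the far left. Hence limits of time averages along an ultrafilter are stationary.

Let two configurations use the same coins. Discrepancies of opposite sign can only annihilate each
other, and any two of them would meet with positive probability. So a stationary coupling without
annihilation is ordered (`ae_ordered`). Annihilation disappears in the limit in three situations:
for translation invariant couplings, where it is exactly the loss of density
(`timeLimit_invariant`); for couplings whose positive discrepancies become sparse at some time
(`exists_ordered_of_count_le`); and for two step-like laws, whose fluxes cancel at both ends
(`exists_ordered_of_isStep`).

Let `ν` be extremal. It has an ordered coupling with its translate (`exists_ordered_shift`), which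
extremality allows to condition on one of the two orders and on the diagonal. Either `ν` is
translation invariant, or the order is strict. In the second case the density differences, whose sum
telescopes, add up to at least one in absolute value, so the density runs between `0` and `1`
(`invariant_or_isStep`). A translation invariant `ν` is comparable with every `μ_ρ`, hence is one of
them (`mem_range_bernoulliProduct`). A step is squeezed between two blocking measures, hence lives
on the classes `A_n`; each class carries at most one stationary law (`eq_of_ae_mem_packed`), which
identifies `ν` (`exists_eq_of_isStep`).

Conversely, stationarity of the product measures is a local balance at a single vertex
(`IsBalanced.productLaw_mem`). The measures `μ_(n)` are extremal by uniqueness on the classes. The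
measures `μ_ρ` are extremal because a stationary law below a multiple of `μ_ρ` is ordered with
respect to all other `μ_r` (`exists_le_coupling`). -/

noncomputable section

namespace S6V

/-! ### Evolution of laws under random maps. -/

section RandomMap

variable {X Y U V : Type*} [MeasurableSpace X] [MeasurableSpace Y] [MeasurableSpace U]
  [MeasurableSpace V]

/-- The law of `Φ x u` when `x` has law `μ` and `u` is independent with law `N`. -/
def evolve (N : Measure U) (Φ : X → U → X) (μ : Measure X) : Measure X :=
  (μ.prod N).map fun p => Φ p.1 p.2

variable {N : Measure U} [IsProbabilityMeasure N] {Φ : X → U → X}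

lemma isProbabilityMeasure_evolve (hΦ : Measurable fun p : X × U => Φ p.1 p.2) (μ : Measure X)
    [IsProbabilityMeasure μ] : IsProbabilityMeasure (evolve N Φ μ) :=
  Measure.isProbabilityMeasure_map hΦ.aemeasurable

lemma isProbabilityMeasure_evolve_iterate (hΦ : Measurable fun p : X × U => Φ p.1 p.2)
    (μ : Measure X) [IsProbabilityMeasure μ] (t : ℕ) :
    IsProbabilityMeasure ((evolve N Φ)^[t] μ) := by
  induction t with
  | zero => simpa
  | succ t ih =>
    rw [Function.iterate_succ_apply']
    exact isProbabilityMeasure_evolve hΦ _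

lemma integral_evolve (hΦ : Measurable fun p : X × U => Φ p.1 p.2) (μ : Measure X) {f : X → ℝ}
    (hf : Measurable f) : ∫ x, f x ∂(evolve N Φ μ) = ∫ p, f (Φ p.1 p.2) ∂(μ.prod N) :=
  integral_map hΦ.aemeasurable hf.aestronglyMeasurable

lemma evolve_add (hΦ : Measurable fun p : X × U => Φ p.1 p.2) (μ ν : Measure X) [SFinite μ]
    [SFinite ν] : evolve N Φ (μ + ν) = evolve N Φ μ + evolve N Φ ν := by
  rw [evolve, Measure.add_prod, Measure.map_add _ _ hΦ]; rfl

lemma evolve_smul (c : ℝ≥0∞) (μ : Measure X) :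
    evolve N Φ (c • μ) = c • evolve N Φ μ := by
  rw [evolve, Measure.prod_smul_left, Measure.map_smul]; rfl

lemma evolve_map (hΦ : Measurable fun p : X × U => Φ p.1 p.2) {N' : Measure V}
    [IsProbabilityMeasure N'] {Ψ : Y → V → Y} (hΨ : Measurable fun p : Y × V => Ψ p.1 p.2)
    {g : X → Y} (hg : Measurable g) {k : U → V} (hk : MeasurePreserving k N N')
    (h : ∀ x u, g (Φ x u) = Ψ (g x) (k u)) (μ : Measure X) [SFinite μ] :
    evolve N' Ψ (μ.map g) = (evolve N Φ μ).map g := by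
  rw [evolve, evolve, ← hk.map_eq, Measure.map_prod_map _ _ hg hk.measurable, Measure.map_map hΨ
    (hg.prodMap hk.measurable), Measure.map_map hg hΦ]
  congr 1
  ext p
  simp [h]

lemma evolve_iterate_map (hΦ : Measurable fun p : X × U => Φ p.1 p.2) {N' : Measure V}
    [IsProbabilityMeasure N'] {Ψ : Y → V → Y} (hΨ : Measurable fun p : Y × V => Ψ p.1 p.2)
    {g : X → Y} (hg : Measurable g) {k : U → V} (hk : MeasurePreserving k N N')
    (h : ∀ x u, g (Φ x u) = Ψ (g x) (k u)) (μ : Measure X) [IsProbabilityMeasure μ] (t : ℕ) :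
    (evolve N' Ψ)^[t] (μ.map g) = ((evolve N Φ)^[t] μ).map g := by
  induction t with
  | zero => rfl
  | succ t ih =>
    have := isProbabilityMeasure_evolve_iterate (N := N) hΦ μ t
    rw [Function.iterate_succ_apply', Function.iterate_succ_apply', ih,
      evolve_map hΦ hΨ hg hk h]

/-- The restriction of a stationary measure to an absorbing set is stationary. -/
lemma evolve_restrict_of_absorbing (hΦ : Measurable fun p : X × U => Φ p.1 p.2) {μ : Measure X}
    [IsFiniteMeasure μ] (hμ : evolve N Φ μ = μ) {A : Set X} (hA : MeasurableSet A)
    (habs : ∀ x ∈ A, ∀ᵐ u ∂N, Φ x u ∈ A) : evolve N Φ (μ.restrict A) = μ.restrict A := by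
  -- Invariance of `μ` bounds the image of the restriction by `μ`, and absorption puts this image on
  -- `A`. The total masses agree, so the resulting domination is an equality.
  have hle : evolve N Φ (μ.restrict A) ≤ μ := by
    conv_rhs => rw [← hμ, ← Measure.restrict_add_restrict_compl hA (μ := μ), evolve_add hΦ]
    exact Measure.le_add_right le_rfl
  have hnull : evolve N Φ (μ.restrict A) Aᶜ = 0 := by
    rw [evolve, Measure.map_apply hΦ hA.compl, Measure.prod_apply (hΦ hA.compl),
      lintegral_eq_zero_iff (measurable_measure_prodMk_left (hΦ hA.compl))]
    filter_upwards [ae_restrict_mem hA] with x hx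
    exact habs x hx
  have hle' : evolve N Φ (μ.restrict A) ≤ μ.restrict A := by
    refine Measure.le_iff.2 fun s hs => ?_
    rw [Measure.restrict_apply hs]
    calc evolve N Φ (μ.restrict A) s
        ≤ evolve N Φ (μ.restrict A) (s ∩ A) + evolve N Φ (μ.restrict A) Aᶜ := by
          refine (measure_mono fun x hx => ?_).trans (measure_union_le _ _)
          by_cases hxA : x ∈ A
          · exact Or.inl ⟨hx, hxA⟩
          · exact Or.inr hxA
      _ ≤ μ (s ∩ A) := by rw [hnull, add_zero]; exact hle _
  have : IsFiniteMeasure (evolve N Φ (μ.restrict A)) := by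
    unfold evolve; infer_instance
  refine Measure.eq_of_le_of_measure_univ_eq hle' ?_
  rw [evolve, Measure.map_apply hΦ .univ, Set.preimage_univ, ← Set.univ_prod_univ,
    Measure.prod_prod]
  simp

end RandomMap

/-! ### Weak limits and Feller operators on a compact space. -/

section WeakLimits

variable {X : Type*} [MeasurableSpace X] [TopologicalSpace X]

/-- Weak convergence, tested against continuous functions. -/
def WeakLim {ι : Type*} (F : Filter ι) (μs : ι → Measure X) (μ : Measure X) : Prop :=
  ∀ f : X → ℝ, Continuous f → Tendsto (fun i => ∫ x, f x ∂(μs i)) F (𝓝 (∫ x, f x ∂μ))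

variable [CompactSpace X] [TopologicalSpace.MetrizableSpace X] [BorelSpace X]

lemma integrable_of_continuous {f : X → ℝ} (hf : Continuous f) (μ : Measure X)
    [IsFiniteMeasure μ] : Integrable f μ :=
  hf.integrable_of_hasCompactSupport (HasCompactSupport.of_compactSpace f)

lemma exists_abs_le_of_continuous {f : X → ℝ} (hf : Continuous f) : ∃ C, 0 ≤ C ∧ ∀ x, |f x| ≤ C := by
  obtain ⟨C, hC⟩ := isCompact_univ.exists_bound_of_continuousOn hf.continuousOn
  exact ⟨max C 0, le_max_right _ _, fun x => (hC x trivial).trans (le_max_left _ _)⟩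

/-- The space of probability measures is compact. Along an ultrafilter one limit serves all test
functions, and no subsequence has to be extracted. -/
lemma exists_weakLim {ι : Type*} (F : Ultrafilter ι) (μs : ι → Measure X)
    (h : ∀ i, IsProbabilityMeasure (μs i)) :
    ∃ μ, IsProbabilityMeasure μ ∧ WeakLim (F : Filter ι) μs μ := by
  let m : ι → ProbabilityMeasure X := fun i => ⟨μs i, h i⟩
  have h1 := (F.map m).le_nhds_lim
  refine ⟨(F.map m).lim, inferInstance, fun f hf => ?_⟩
  have h2 : Tendsto m F (𝓝 (F.map m).lim) := h1
  exact (ProbabilityMeasure.tendsto_iff_forall_integral_tendsto.1 h2)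
    (BoundedContinuousFunction.mkOfCompact ⟨f, hf⟩)

lemma ext_of_integral_continuous {μ ν : Measure X} [IsFiniteMeasure μ] [IsFiniteMeasure ν]
    (h : ∀ f : X → ℝ, Continuous f → ∫ x, f x ∂μ = ∫ x, f x ∂ν) : μ = ν :=
  ext_of_forall_integral_eq_of_IsFiniteMeasure fun f => h f f.continuous

/-- The uniform mixture of finitely many measures. -/
def avgMeasure {ι : Type*} (s : Finset ι) (μ : ι → Measure X) : Measure X :=
  (s.card : ℝ≥0∞)⁻¹ • ∑ i ∈ s, μ i

lemma isProbabilityMeasure_avgMeasure {ι : Type*} {s : Finset ι} (hs : s.Nonempty)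
    {μ : ι → Measure X} (h : ∀ i, IsProbabilityMeasure (μ i)) :
    IsProbabilityMeasure (avgMeasure s μ) := by
  constructor
  have : (s.card : ℝ≥0∞) ≠ 0 := by exact_mod_cast hs.card_pos.ne'
  simp [avgMeasure, ENNReal.inv_mul_cancel this (ENNReal.natCast_ne_top _)]

lemma integral_avgMeasure {ι : Type*} (s : Finset ι) {μ : ι → Measure X} {f : X → ℝ}
    (hf : ∀ i ∈ s, Integrable f (μ i)) :
    ∫ x, f x ∂(avgMeasure s μ) = (s.card : ℝ)⁻¹ * ∑ i ∈ s, ∫ x, f x ∂(μ i) := by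
  rw [avgMeasure, integral_smul_measure, integral_finsetSum_measure hf]
  simp

/-- An operation on measures which is dual to an operator on continuous functions. -/
structure IsFeller (A : Measure X → Measure X) : Prop where
  isProb : ∀ ν, IsProbabilityMeasure ν → IsProbabilityMeasure (A ν)
  dual : ∀ f : X → ℝ, Continuous f → ∃ g : X → ℝ, Continuous g ∧
    ∀ ν, IsProbabilityMeasure ν → ∫ x, f x ∂(A ν) = ∫ x, g x ∂ν

lemma IsFeller.iterate {A : Measure X → Measure X} (hA : IsFeller A) (t : ℕ) :
    IsFeller A^[t] := by
  induction t with
  | zero => exact ⟨fun ν h => h, fun f hf => ⟨f, hf, fun ν _ => rfl⟩⟩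
  | succ t ih =>
    refine ⟨fun ν h => ?_, fun f hf => ?_⟩
    · rw [Function.iterate_succ_apply']; exact hA.isProb _ (ih.isProb _ h)
    · obtain ⟨g, hg, hg'⟩ := hA.dual f hf
      obtain ⟨k, hk, hk'⟩ := ih.dual g hg
      refine ⟨k, hk, fun ν hν => ?_⟩
      rw [Function.iterate_succ_apply', hg' _ (ih.isProb _ hν), hk' _ hν]

lemma IsFeller.weakLim {A : Measure X → Measure X} (hA : IsFeller A) {ι : Type*} {F : Filter ι}
    {μs : ι → Measure X} {μ : Measure X} (hs : ∀ i, IsProbabilityMeasure (μs i))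
    (hμ : IsProbabilityMeasure μ) (h : WeakLim F μs μ) :
    WeakLim F (fun i => A (μs i)) (A μ) := by
  intro f hf
  obtain ⟨g, hg, hg'⟩ := hA.dual f hf
  simp only [hg' μ hμ, fun i => hg' (μs i) (hs i)]
  exact h g hg

/-- A weak limit of asymptotically invariant measures is invariant. -/
lemma IsFeller.fixed_of_weakLim {A : Measure X → Measure X} (hA : IsFeller A) {ι : Type*}
    {F : Filter ι} [F.NeBot] {μs : ι → Measure X} {μ : Measure X}
    (hs : ∀ i, IsProbabilityMeasure (μs i)) (hμ : IsProbabilityMeasure μ) (h : WeakLim F μs μ)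
    (hinv : ∀ f : X → ℝ, Continuous f →
      Tendsto (fun i => ∫ x, f x ∂(A (μs i)) - ∫ x, f x ∂(μs i)) F (𝓝 0)) : A μ = μ := by
  have := hA.isProb μ hμ
  refine ext_of_integral_continuous fun f hf => ?_
  have h1 := (hA.weakLim hs hμ h f hf).sub (h f hf)
  exact sub_eq_zero.1 (tendsto_nhds_unique h1 (hinv f hf))

lemma IsFeller.integral_avgMeasure {A : Measure X → Measure X} (hA : IsFeller A) {ι : Type*}
    {s : Finset ι} (hs : s.Nonempty) {μ : ι → Measure X} (h : ∀ i, IsProbabilityMeasure (μ i))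
    {f : X → ℝ} (hf : Continuous f) :
    ∫ x, f x ∂(A (avgMeasure s μ)) = (s.card : ℝ)⁻¹ * ∑ i ∈ s, ∫ x, f x ∂(A (μ i)) := by
  obtain ⟨g, hg, hg'⟩ := hA.dual f hf
  rw [hg' _ (isProbabilityMeasure_avgMeasure hs h), S6V.integral_avgMeasure]
  · simp only [fun i => hg' (μ i) (h i)]
  · exact fun i _ => integrable_of_continuous hg _

end WeakLimits

/-! ### Random continuous maps are Feller. -/

section Feller

variable {X U : Type*} [MeasurableSpace X] [TopologicalSpace X] [CompactSpace X]
  [TopologicalSpace.MetrizableSpace X] [BorelSpace X] [MeasurableSpace U] {N : Measure U}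
  [IsProbabilityMeasure N] {Φ : X → U → X}

lemma continuous_integral_noise {g : X → U → ℝ} (hg : Measurable fun p : X × U => g p.1 p.2)
    {C : ℝ} (hC : ∀ x u, |g x u| ≤ C) (hc : ∀ᵐ u ∂N, Continuous fun x => g x u) :
    Continuous fun x => ∫ u, g x u ∂N :=
  continuous_of_dominated (bound := fun _ => C)
    (fun _ => (hg.comp measurable_prodMk_left).aestronglyMeasurable)
    (fun _ => ae_of_all _ fun _ => hC _ _) (integrable_const _) hc

lemma integral_prod_noise {g : X → U → ℝ} (hg : Measurable fun p : X × U => g p.1 p.2)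
    {C : ℝ} (hC : ∀ x u, |g x u| ≤ C) (μ : Measure X) [IsFiniteMeasure μ] :
    ∫ p, g p.1 p.2 ∂(μ.prod N) = ∫ x, ∫ u, g x u ∂N ∂μ :=
  integral_prod (fun p : X × U => g p.1 p.2)
    (Integrable.of_bound hg.aestronglyMeasurable C (ae_of_all _ fun p => hC p.1 p.2))

/-- The dual operator averages `f ∘ Φ` over the noise; dominated convergence makes the average
continuous even if `Φ` is continuous for almost every `u` only. -/
lemma isFeller_evolve (hΦ : Measurable fun p : X × U => Φ p.1 p.2)
    (hc : ∀ᵐ u ∂N, Continuous fun x => Φ x u) : IsFeller (evolve N Φ) := by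
  refine ⟨fun ν h => isProbabilityMeasure_evolve hΦ ν, fun f hf => ?_⟩
  obtain ⟨C, -, hC⟩ := exists_abs_le_of_continuous hf
  refine ⟨fun x => ∫ u, f (Φ x u) ∂N, continuous_integral_noise
    (hf.measurable.comp hΦ) (fun x u => hC _) ?_, fun ν hν => ?_⟩
  · filter_upwards [hc] with u hu using hf.comp hu
  · rw [integral_evolve hΦ _ hf.measurable]
    exact integral_prod_noise (g := fun x u => f (Φ x u)) (hf.measurable.comp hΦ) (fun x u => hC _) ν

lemma isFeller_map {g : X → X} (hg : Continuous g) : IsFeller (Measure.map g : Measure X → _) := by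
  refine ⟨fun ν h => Measure.isProbabilityMeasure_map hg.measurable.aemeasurable,
    fun f hf => ⟨f ∘ g, hf.comp hg, fun ν _ => ?_⟩⟩
  exact integral_map hg.measurable.aemeasurable hf.measurable.aestronglyMeasurable

end Feller

/-! ### The six vertex dynamics with coins at the sites. -/

section SiteDynamics

/-- Site noise: `u (x, false)` says whether a lone particle at `x` wakes up, and `u (x, true)` whether
a particle which arrives at the empty site `x` continues. -/
abbrev SiteNoise : Type := ℤ × Bool → Bool

open Classical in
/-- The horizontal arrow from `x` to `x + 1`: whether a particle jumps over the edge. -/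
def hor (η : Config) (u : SiteNoise) (x : ℤ) : Bool :=
  decide (∃ y ≤ x, η y = true ∧ u (y, false) = true ∧
    ∀ z, y < z → z ≤ x → η z = true ∨ u (z, true) = true)

lemma hor_eq_true {η : Config} {u : SiteNoise} {x : ℤ} : hor η u x = true ↔
    ∃ y ≤ x, η y = true ∧ u (y, false) = true ∧
      ∀ z, y < z → z ≤ x → η z = true ∨ u (z, true) = true := by
  simp [hor]

/-- The vertex rule. An occupied site emits an arrow if one arrives or if its particle wakes up; an
empty site passes on an arriving arrow if the coin says so. The recursion has no starting point at
`-∞`, which is why `hor` is defined through the source `y` of the path. -/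
lemma hor_rec (η : Config) (u : SiteNoise) (x : ℤ) :
    hor η u x = bif η x then hor η u (x - 1) || u (x, false) else hor η u (x - 1) && u (x, true) := by
  rw [Bool.eq_iff_iff]
  have key : hor η u x = true ↔ (η x = true ∧ u (x, false) = true) ∨
      (hor η u (x - 1) = true ∧ (η x = true ∨ u (x, true) = true)) := by
    rw [hor_eq_true, hor_eq_true]
    constructor
    · rintro ⟨y, hy, h1, h2, h3⟩
      rcases hy.eq_or_lt with rfl | hlt
      · exact Or.inl ⟨h1, h2⟩
      · exact Or.inr ⟨⟨y, by omega, h1, h2, fun z hz hz' => h3 z hz (by omega)⟩, h3 x hlt le_rfl⟩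
    · rintro (⟨h1, h2⟩ | ⟨⟨y, hy, h1, h2, h3⟩, h4⟩)
      · exact ⟨x, le_rfl, h1, h2, fun z hz hz' => by omega⟩
      · refine ⟨y, by omega, h1, h2, fun z hz hz' => ?_⟩
        rcases hz'.eq_or_lt with rfl | hlt
        · exact h4
        · exact h3 z hz (by omega)
  rw [key]
  cases η x <;> cases hor η u (x - 1) <;> simp

/-- At a reset site the outgoing arrow does not depend on the incoming one. -/
def IsReset (u : SiteNoise) (x : ℤ) : Prop := u (x, false) = true ∧ u (x, true) = false

lemma hor_of_isReset {η : Config} {u : SiteNoise} {x : ℤ} (h : IsReset u x) : hor η u x = η x := by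
  rw [hor_rec, h.1, h.2]
  cases η x <;> simp

/-- The configuration after the update, before the shift of the frame. -/
def out (η : Config) (u : SiteNoise) (x : ℤ) : Bool := (η x ^^ hor η u (x - 1)) ^^ hor η u x

/-- One update of the shifted model, in terms of site noise. -/
def siteStep (η : Config) (u : SiteNoise) : Config := fun x => out η u (x + 1)

lemma hor_mono {η ξ : Config} (h : η ≤ ξ) (u : SiteNoise) (x : ℤ) : hor η u x ≤ hor ξ u x := by
  have h' : ∀ z, η z = true → ξ z = true := fun z hz => by
    have := h z
    rw [hz] at this
    exact top_le_iff.1 this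
  rw [Bool.le_iff_imp, hor_eq_true, hor_eq_true]
  rintro ⟨y, hy, h1, h2, h3⟩
  exact ⟨y, hy, h' y h1, h2, fun z hz hz' => (h3 z hz hz').imp_left (h' z)⟩

/-- Attractiveness. As `hor_mono` orders the incoming arrows, only one vertex with ordered inputs
and common coins remains to be examined, and this is a finite check. -/
lemma siteStep_mono {η ξ : Config} (h : η ≤ ξ) (u : SiteNoise) : siteStep η u ≤ siteStep ξ u := by
  intro x
  have h1 := hor_mono h u (x + 1 - 1)
  have h2 : η (x + 1) ≤ ξ (x + 1) := h (x + 1)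
  change out η u (x + 1) ≤ out ξ u (x + 1)
  simp only [out]
  rw [hor_rec η u (x + 1), hor_rec ξ u (x + 1)]
  revert h1 h2
  generalize hor η u (x + 1 - 1) = a
  generalize hor ξ u (x + 1 - 1) = b
  generalize η (x + 1) = c
  generalize ξ (x + 1) = d
  generalize u (x + 1, false) = e
  generalize u (x + 1, true) = f
  clear h
  decide +revert

/-- The shift of the site noise. -/
def shiftNoise (n : ℤ) (u : SiteNoise) : SiteNoise := fun p => u (p.1 + n, p.2)

lemma hor_shift (n : ℤ) (η : Config) (u : SiteNoise) (x : ℤ) :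
    hor (shift n η) (shiftNoise n u) x = hor η u (x + n) := by
  rw [Bool.eq_iff_iff, hor_eq_true, hor_eq_true]
  constructor
  · rintro ⟨y, hy, h1, h2, h3⟩
    refine ⟨y + n, by omega, h1, h2, fun z hz hz' => ?_⟩
    have := h3 (z - n) (by omega) (by omega)
    simpa [shift, shiftNoise] using this
  · rintro ⟨y, hy, h1, h2, h3⟩
    refine ⟨y - n, by omega, by simpa [shift] using h1, by simpa [shiftNoise] using h2,
      fun z hz hz' => ?_⟩
    exact h3 (z + n) (by omega) (by omega)

lemma out_shift (n : ℤ) (η : Config) (u : SiteNoise) (x : ℤ) :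
    out (shift n η) (shiftNoise n u) x = out η u (x + n) := by
  simp only [out, hor_shift]
  rw [show x - 1 + n = x + n - 1 by ring]
  rfl

lemma siteStep_shift (n : ℤ) (η : Config) (u : SiteNoise) :
    siteStep (shift n η) (shiftNoise n u) = shift n (siteStep η u) := by
  ext x
  simp only [siteStep, out_shift, shift]
  rw [add_right_comm]

lemma measurableSet_apply_eq {X : Type*} [MeasurableSpace X] {f : X → Bool} (hf : Measurable f)
    (b : Bool) : MeasurableSet {x | f x = b} := hf (measurableSet_singleton b)

lemma measurable_hor (x : ℤ) : Measurable fun p : Config × SiteNoise => hor p.1 p.2 x := by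
  refine measurable_to_bool ?_
  have : (fun p : Config × SiteNoise => hor p.1 p.2 x) ⁻¹' {true} =
      {p | ∃ y ≤ x, p.1 y = true ∧ p.2 (y, false) = true ∧
        ∀ z, y < z → z ≤ x → p.1 z = true ∨ p.2 (z, true) = true} := by
    ext p; simp [hor_eq_true]
  rw [this]
  have h1 : ∀ y, Measurable fun p : Config × SiteNoise => (p.1 y = true) := fun y =>
    measurableSet_setOfPred.1 (measurable_occupied measurable_fst y true)
  have h2 : ∀ q, Measurable fun p : Config × SiteNoise => (p.2 q = true) := fun q =>
    measurableSet_setOfPred.1 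
      (measurableSet_apply_eq ((measurable_pi_apply q).comp measurable_snd) true)
  refine measurableSet_setOfPred.2 ?_
  refine Measurable.exists fun y => measurable_const.and ((h1 y).and ((h2 _).and ?_))
  exact Measurable.forall fun z => measurable_const.imp (measurable_const.imp ((h1 z).or (h2 _)))

lemma measurable_out (x : ℤ) : Measurable fun p : Config × SiteNoise => out p.1 p.2 x := by
  have h : Measurable fun b : (Bool × Bool) × Bool => ((b.1.1 ^^ b.1.2) ^^ b.2) :=
    measurable_of_countable _
  exact h.comp ((measurable_fst.eval.prodMk (measurable_hor (x - 1))).prodMk (measurable_hor x))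

lemma measurable_siteStep : Measurable fun p : Config × SiteNoise => siteStep p.1 p.2 :=
  measurable_pi_lambda _ fun x => measurable_out (x + 1)

/-- Reset sites occur arbitrarily far to the left and to the right. -/
def ManyResets (u : SiteNoise) : Prop :=
  ∀ x, (∃ y ≤ x, IsReset u y) ∧ ∃ y ≥ x, IsReset u y

/-- To the right of a reset site `y ≤ x` the arrow at `x` depends on the coordinates in `[y, x]`
only. -/
lemma continuous_hor {u : SiteNoise} (hu : ManyResets u) (x : ℤ) :
    Continuous fun η : Config => hor η u x := by
  obtain ⟨y, hy, hr⟩ := (hu x).1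
  induction x, hy using Int.leInduction with
  | base => simpa only [hor_of_isReset hr] using continuous_apply y
  | succ n hn ih =>
    have h : Continuous fun b : Bool × Bool =>
        (bif b.1 then b.2 || u (n + 1, false) else b.2 && u (n + 1, true)) :=
      continuous_of_discreteTopology
    have h2 := h.comp ((continuous_apply (A := fun _ : ℤ => Bool) (n + 1)).prodMk ih)
    refine h2.congr fun η => ?_
    rw [hor_rec η u (n + 1)]
    simp

lemma continuous_out {u : SiteNoise} (hu : ManyResets u) (x : ℤ) :
    Continuous fun η : Config => out η u x := by
  have h : Continuous fun b : (Bool × Bool) × Bool => ((b.1.1 ^^ b.1.2) ^^ b.2) :=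
    continuous_of_discreteTopology
  exact h.comp (((continuous_apply x).prodMk (continuous_hor hu (x - 1))).prodMk
    (continuous_hor hu x))

lemma continuous_siteStep {u : SiteNoise} (hu : ManyResets u) :
    Continuous fun η : Config => siteStep η u :=
  continuous_pi fun x => continuous_out hu (x + 1)

lemma measurable_shiftNoise (n : ℤ) : Measurable (shiftNoise n) :=
  measurable_pi_lambda _ fun _ => measurable_pi_apply _

lemma continuous_shift (n : ℤ) : Continuous (shift n) :=
  continuous_pi fun _ => continuous_apply _

lemma measurable_shift (n : ℤ) : Measurable (shift n) := (continuous_shift n).measurable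

section Noise

variable {ι : Type*} [DecidableEq ι] {Ω : ι → Type*} [∀ i, MeasurableSpace (Ω i)]

/-- Resampling one coordinate does not change a product measure. -/
lemma infinitePi_map_update (μ : (i : ι) → Measure (Ω i)) [∀ i, IsProbabilityMeasure (μ i)]
    (i : ι) : ((Measure.infinitePi μ).prod (μ i)).map (fun p => Function.update p.1 i p.2) =
      Measure.infinitePi μ := by
  have hm : Measurable fun p : (∀ i, Ω i) × Ω i => Function.update p.1 i p.2 := by
    refine measurable_pi_lambda _ fun j => ?_
    by_cases h : j = i
    · subst h; simpa using measurable_snd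
    · simpa [Function.update_of_ne h] using measurable_fst.eval
  refine Measure.eq_infinitePi _ fun s t ht => ?_
  rw [Measure.map_apply hm (.pi s.countable_toSet fun _ _ => ht _)]
  have : (fun p : (∀ i, Ω i) × Ω i => Function.update p.1 i p.2) ⁻¹' (Set.pi s t) =
      (Set.pi (s.erase i : Finset ι) t) ×ˢ (if i ∈ s then t i else Set.univ) := by
    ext p
    simp only [Set.mem_preimage, Set.mem_pi, Set.mem_prod, Finset.mem_coe, Finset.mem_erase]
    constructor
    · intro h
      refine ⟨fun j hj => by simpa [Function.update_of_ne hj.1] using h j hj.2, ?_⟩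
      split_ifs with hi
      · simpa using h i hi
      · trivial
    · rintro ⟨h1, h2⟩ j hj
      by_cases hji : j = i
      · subst hji; simpa [hj] using h2
      · simpa [Function.update_of_ne hji] using h1 j ⟨hji, hj⟩
  rw [this, Measure.prod_prod, Measure.infinitePi_pi _ (fun _ _ => ht _)]
  split_ifs with hi
  · exact Finset.prod_erase_mul _ _ hi
  · rw [Finset.erase_eq_of_notMem hi, measure_univ, mul_one]

end Noise

/-- The law of the site noise. -/
def siteNoiseLaw (b₁ b₂ : I) : Measure SiteNoise :=
  Measure.infinitePi fun p : ℤ × Bool => bernoulliMeasure true false (bif p.2 then b₂ else σ b₁)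

instance (b₁ b₂ : I) : IsProbabilityMeasure (siteNoiseLaw b₁ b₂) := by
  unfold siteNoiseLaw; infer_instance

lemma measurePreserving_shiftNoise (b₁ b₂ : I) (n : ℤ) :
    MeasurePreserving (shiftNoise n) (siteNoiseLaw b₁ b₂) (siteNoiseLaw b₁ b₂) := by
  refine ⟨measurable_shiftNoise n, ?_⟩
  have hinj : Function.Injective fun p : ℤ × Bool => (p.1 + n, p.2) := by
    rintro ⟨a, b⟩ ⟨c, d⟩ h
    simp only [Prod.mk.injEq, add_left_inj] at h
    simp [h]
  exact Measure.map_infinitePi_infinitePi_of_inj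
    (P := fun p : ℤ × Bool => bernoulliMeasure true false (bif p.2 then b₂ else σ b₁)) hinj

lemma iIndepFun_site (b₁ b₂ : I) :
    iIndepFun (fun (x : ℤ) (u : SiteNoise) (i : Bool) => u (x, i)) (siteNoiseLaw b₁ b₂) := by
  rw [iIndepFun_iff_map_fun_eq_infinitePi_map (by fun_prop)]
  have h := Measure.infinitePi_map_curry (X := Bool) (ι := ℤ) (κ := Bool)
    (fun _ i => bernoulliMeasure true false (bif i then b₂ else σ b₁))
  have h' : (siteNoiseLaw b₁ b₂).map (fun u x i => u (x, i)) = Measure.infinitePi fun _ : ℤ =>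
    Measure.infinitePi fun i : Bool => bernoulliMeasure true false (bif i then b₂ else σ b₁) := h
  rw [h']
  congr 1
  ext1 x
  have : (fun (u : SiteNoise) (i : Bool) => u (x, i)) =
      (fun v : ℤ → Bool → Bool => v x) ∘ fun u x i => u (x, i) := rfl
  rw [this, ← Measure.map_map (by fun_prop) (by fun_prop), h', Measure.infinitePi_map_eval]

lemma measurableSet_isReset (x : ℤ) : MeasurableSet {u | IsReset u x} := by
  have h : ∀ (p : ℤ × Bool) (b : Bool), MeasurableSet {u : SiteNoise | u p = b} := fun p b =>
    measurableSet_apply_eq (measurable_pi_apply p) b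
  exact (h _ _).inter (h _ _)

/-- Boxes for the site noise. -/
lemma siteNoiseLaw_box (b₁ b₂ : I) (s : Finset (ℤ × Bool)) (v : ℤ × Bool → Bool) :
    siteNoiseLaw b₁ b₂ {u | ∀ p ∈ s, u p = v p} =
      ∏ p ∈ s, bernoulliMeasure true false (bif p.2 then b₂ else σ b₁) {v p} := by
  have h := Measure.infinitePi_pi (s := s) (t := fun p => {v p})
    (fun p : ℤ × Bool => bernoulliMeasure true false (bif p.2 then b₂ else σ b₁))
    (fun _ _ => measurableSet_singleton _)
  rw [← h]
  rfl

lemma bernoulliMeasure_singleton_true (p : I) :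
    bernoulliMeasure true false p {true} = ENNReal.ofReal p := by
  rw [bernoulliMeasure_apply_of_mem_of_notMem p (measurableSet_singleton _) (by simp) (by simp)]
  exact ENNReal.ofReal_eq_coe_nnreal p.2.1 ▸ rfl

lemma bernoulliMeasure_singleton_false (p : I) :
    bernoulliMeasure true false p {false} = ENNReal.ofReal (1 - p) := by
  rw [bernoulliMeasure_apply_of_notMem_of_mem p (measurableSet_singleton _) (by simp) (by simp)]
  exact ENNReal.ofReal_eq_coe_nnreal (σ p).2.1 ▸ rfl

lemma bernoulliMeasure_singleton_pos {p : I} (h0 : 0 < p) (h1 : p < 1) (b : Bool) :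
    bernoulliMeasure true false p {b} ≠ 0 := by
  have h0' : (0 : ℝ) < p := h0
  have h1' : (p : ℝ) < 1 := h1
  cases b
  · rw [bernoulliMeasure_singleton_false]; simpa using h1'
  · rw [bernoulliMeasure_singleton_true]; simpa using h0'

/-- The probability of a reset. -/
def resetProb (b₁ b₂ : I) : ℝ := (1 - b₁) * (1 - b₂)

lemma resetProb_pos {b₁ b₂ : I} (h₁ : b₁ < 1) (h₂ : b₂ < 1) : 0 < resetProb b₁ b₂ := by
  have h1' : (b₁ : ℝ) < 1 := h₁
  have h2' : (b₂ : ℝ) < 1 := h₂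
  exact mul_pos (by linarith) (by linarith)

lemma siteNoiseLaw_isReset (b₁ b₂ : I) (x : ℤ) :
    siteNoiseLaw b₁ b₂ {u | IsReset u x} = ENNReal.ofReal (resetProb b₁ b₂) := by
  have h := siteNoiseLaw_box b₁ b₂ {(x, false), (x, true)} (fun p => !p.2)
  have h2 : {u : SiteNoise | IsReset u x} =
      {u | ∀ p ∈ ({(x, false), (x, true)} : Finset (ℤ × Bool)), u p = !p.2} := by
    ext u; simp [IsReset]
  rw [h2, h, Finset.prod_pair (by simp)]
  simp only [cond_false, cond_true, Bool.not_false, Bool.not_true]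
  rw [bernoulliMeasure_singleton_true, bernoulliMeasure_singleton_false,
    ← ENNReal.ofReal_mul (σ b₁).2.1]
  rfl

/-- This is the second Borel–Cantelli lemma: resets at different sites are independent and have the
same positive probability. -/
lemma ae_frequently_isReset {b₁ b₂ : I} (h₁ : b₁ < 1) (h₂ : b₂ < 1) {g : ℕ → ℤ}
    (hg : Function.Injective g) :
    ∀ᵐ u ∂siteNoiseLaw b₁ b₂, ∃ᶠ n in atTop, IsReset u (g n) := by
  have hm : ∀ n, MeasurableSet {u | IsReset u (g n)} := fun n => measurableSet_isReset _
  have hind : iIndepSet (fun n => {u | IsReset u (g n)}) (siteNoiseLaw b₁ b₂) := by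
    have h1 := (iIndepFun_site b₁ b₂).precomp hg
    have hS : MeasurableSet {v : Bool → Bool | v false = true ∧ v true = false} :=
      (Set.toFinite _).measurableSet
    rw [iIndepSet_iff_meas_biInter hm]
    intro s
    have := h1.measure_inter_preimage_eq_mul s
      (sets := fun _ => {v : Bool → Bool | v false = true ∧ v true = false}) (fun _ _ => hS)
    exact this
  have h := measure_limsup_eq_one hm hind (by
    simp only [siteNoiseLaw_isReset]
    exact ENNReal.tsum_const_eq_top_of_ne_zero (by simpa using resetProb_pos h₁ h₂))
  have h2 := (prob_compl_eq_zero_iff (MeasurableSet.measurableSet_limsup hm)).2 h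
  have h3 : ∀ᵐ u ∂siteNoiseLaw b₁ b₂, u ∈ limsup (fun n => {u | IsReset u (g n)}) atTop := h2
  filter_upwards [h3] with u hu
  exact Filter.mem_limsup_iff_frequently_mem.1 hu

lemma ae_manyResets {b₁ b₂ : I} (h₁ : b₁ < 1) (h₂ : b₂ < 1) :
    ∀ᵐ u ∂siteNoiseLaw b₁ b₂, ManyResets u := by
  have hl := ae_frequently_isReset h₁ h₂ (g := fun n => -(n : ℤ)) (fun a b h => by simpa using h)
  have hr := ae_frequently_isReset h₁ h₂ (g := fun n => (n : ℤ)) (fun a b h => by simpa using h)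
  filter_upwards [hl, hr] with u hul hur x
  obtain ⟨n, hn, h⟩ := frequently_atTop.1 hul x.natAbs
  obtain ⟨m, hm, h'⟩ := frequently_atTop.1 hur x.natAbs
  exact ⟨⟨_, by omega, h⟩, ⟨_, by omega, h'⟩⟩

lemma isFeller_siteStep {b₁ b₂ : I} (h₁ : b₁ < 1) (h₂ : b₂ < 1) :
    IsFeller (evolve (siteNoiseLaw b₁ b₂) siteStep) := by
  refine isFeller_evolve measurable_siteStep ?_
  filter_upwards [ae_manyResets h₁ h₂] with u hu using continuous_siteStep hu

end SiteDynamics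

/-! ### Discrepancies of two configurations driven by the same coins. -/

section Discrepancies

/-- The indicator of a Boolean. -/
def ind (b : Bool) : ℝ := bif b then 1 else 0

@[simp] lemma ind_true : ind true = 1 := rfl

@[simp] lemma ind_false : ind false = 0 := rfl

lemma ind_nonneg (b : Bool) : 0 ≤ ind b := by cases b <;> simp

lemma ind_le_one (b : Bool) : ind b ≤ 1 := by cases b <;> simp

lemma abs_ind_le (b : Bool) : |ind b| ≤ 1 := by cases b <;> simp

lemma continuous_ind : Continuous ind := continuous_of_discreteTopology

lemma measurable_ind : Measurable ind := continuous_ind.measurable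

/-- Both marginals of a coupling are updated with the same noise. -/
def pairStep (p : Config × Config) (u : SiteNoise) : Config × Config :=
  (siteStep p.1 u, siteStep p.2 u)

/-- A discrepancy of positive sign at `x`. -/
def plus (p : Config × Config) (x : ℤ) : Bool := p.1 x && !p.2 x

/-- A discrepancy of positive sign on the edge from `x` to `x + 1`. -/
def horPlus (p : Config × Config) (u : SiteNoise) (x : ℤ) : Bool := hor p.1 u x && !hor p.2 u x

/-- The number of positive discrepancies which are annihilated at `x`. -/
def ann (p : Config × Config) (u : SiteNoise) (x : ℤ) : ℝ :=
  ind (plus p x) + ind (horPlus p u (x - 1)) - ind (plus (pairStep p u) (x - 1)) -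
    ind (horPlus p u x)

lemma siteStep_sub_one (η : Config) (u : SiteNoise) (x : ℤ) :
    siteStep η u (x - 1) = ((η x ^^ hor η u (x - 1)) ^^ hor η u x) := by
  simp [siteStep, out]

/-- A vertex preserves the difference between the numbers of positive and negative discrepancies
and, being monotone, creates none; this leaves finitely many local cases. -/
lemma ann_nonneg (p : Config × Config) (u : SiteNoise) (x : ℤ) : 0 ≤ ann p u x := by
  simp only [ann, plus, horPlus, pairStep, siteStep_sub_one]
  rw [hor_rec p.1 u x, hor_rec p.2 u x]
  cases hor p.1 u (x - 1) <;> cases hor p.2 u (x - 1) <;> cases p.1 x <;> cases p.2 x <;>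
    cases u (x, false) <;> cases u (x, true) <;> simp

lemma abs_ann_le (p : Config × Config) (u : SiteNoise) (x : ℤ) : |ann p u x| ≤ 2 := by
  rw [abs_of_nonneg (ann_nonneg p u x), ann]
  have h1 := ind_nonneg (plus (pairStep p u) (x - 1))
  have h2 := ind_nonneg (horPlus p u x)
  have h3 := ind_le_one (plus p x)
  have h4 := ind_le_one (horPlus p u (x - 1))
  linarith

/-- Each annihilation removes one discrepancy of either sign, since every vertex conserves
particles. -/
lemma ann_swap (p : Config × Config) (u : SiteNoise) (x : ℤ) : ann p.swap u x = ann p u x := by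
  simp only [ann, plus, horPlus, pairStep, siteStep_sub_one, Prod.fst_swap, Prod.snd_swap]
  rw [hor_rec p.1 u x, hor_rec p.2 u x]
  cases hor p.1 u (x - 1) <;> cases hor p.2 u (x - 1) <;> cases p.1 x <;> cases p.2 x <;>
    cases u (x, false) <;> cases u (x, true) <;> simp

lemma measurable_pairStep :
    Measurable fun q : (Config × Config) × SiteNoise => pairStep q.1 q.2 :=
  (measurable_siteStep.comp ((measurable_fst.comp measurable_fst).prodMk measurable_snd)).prodMk
    (measurable_siteStep.comp ((measurable_snd.comp measurable_fst).prodMk measurable_snd))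

lemma measurable_and_not : Measurable fun b : Bool × Bool => b.1 && !b.2 :=
  measurable_of_countable _

lemma continuous_plus (x : ℤ) : Continuous fun p : Config × Config => plus p x := by
  have h : Continuous fun b : Bool × Bool => b.1 && !b.2 := continuous_of_discreteTopology
  have hx : Continuous fun η : Config => η x := continuous_apply x
  exact h.comp ((hx.comp continuous_fst).prodMk (hx.comp continuous_snd))

lemma measurable_horPlus (x : ℤ) :
    Measurable fun q : (Config × Config) × SiteNoise => horPlus q.1 q.2 x :=
  measurable_and_not.comp (((measurable_hor x).comp
    ((measurable_fst.comp measurable_fst).prodMk measurable_snd)).prodMk ((measurable_hor x).comp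
    ((measurable_snd.comp measurable_fst).prodMk measurable_snd)))

lemma continuous_horPlus {u : SiteNoise} (hu : ManyResets u) (x : ℤ) :
    Continuous fun p : Config × Config => horPlus p u x := by
  have h : Continuous fun b : Bool × Bool => b.1 && !b.2 := continuous_of_discreteTopology
  exact h.comp (((continuous_hor hu x).comp continuous_fst).prodMk
    ((continuous_hor hu x).comp continuous_snd))

lemma continuous_pairStep {u : SiteNoise} (hu : ManyResets u) :
    Continuous fun p : Config × Config => pairStep p u :=
  ((continuous_siteStep hu).comp continuous_fst).prodMk
    ((continuous_siteStep hu).comp continuous_snd)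

lemma measurable_plus (x : ℤ) : Measurable fun p : Config × Config => plus p x :=
  (continuous_plus x).measurable

lemma measurable_ann (x : ℤ) :
    Measurable fun q : (Config × Config) × SiteNoise => ann q.1 q.2 x :=
  (((measurable_ind.comp ((measurable_plus x).comp measurable_fst)).add
    (measurable_ind.comp (measurable_horPlus (x - 1)))).sub
    (measurable_ind.comp ((measurable_plus (x - 1)).comp measurable_pairStep))).sub
    (measurable_ind.comp (measurable_horPlus x))

lemma continuous_ann {u : SiteNoise} (hu : ManyResets u) (x : ℤ) :
    Continuous fun p : Config × Config => ann p u x :=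
  (((continuous_ind.comp (continuous_plus x)).add
    (continuous_ind.comp (continuous_horPlus hu (x - 1)))).sub
    (continuous_ind.comp ((continuous_plus (x - 1)).comp (continuous_pairStep hu)))).sub
    (continuous_ind.comp (continuous_horPlus hu x))

variable (b₁ b₂ : I)

/-- The evolution of couplings. -/
def pairEvolve : Measure (Config × Config) → Measure (Config × Config) :=
  evolve (siteNoiseLaw b₁ b₂) pairStep

/-- The evolution of laws of configurations. -/
def siteEvolve : Measure Config → Measure Config := evolve (siteNoiseLaw b₁ b₂) siteStep

/-- The density of positive discrepancies at `x`. -/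
def dens (l : Measure (Config × Config)) (x : ℤ) : ℝ := ∫ p, ind (plus p x) ∂l

/-- The density of positive discrepancies on the edge from `x` to `x + 1`. -/
def horDens (l : Measure (Config × Config)) (x : ℤ) : ℝ :=
  ∫ q, ind (horPlus q.1 q.2 x) ∂(l.prod (siteNoiseLaw b₁ b₂))

/-- The rate of annihilation at `x`. -/
def annRate (l : Measure (Config × Config)) (x : ℤ) : ℝ :=
  ∫ q, ann q.1 q.2 x ∂(l.prod (siteNoiseLaw b₁ b₂))

lemma integrable_ind {X : Type*} [MeasurableSpace X] {f : X → Bool} (hf : Measurable f)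
    (l : Measure X) [IsFiniteMeasure l] : Integrable (fun q => ind (f q)) l :=
  Integrable.of_bound (measurable_ind.comp hf).aestronglyMeasurable 1
    (ae_of_all _ fun _ => abs_ind_le _)

lemma integral_ind_nonneg {X : Type*} [MeasurableSpace X] (f : X → Bool) (l : Measure X) :
    0 ≤ ∫ q, ind (f q) ∂l := integral_nonneg fun _ => ind_nonneg _

lemma integral_ind_le_one {X : Type*} [MeasurableSpace X] {f : X → Bool} (hf : Measurable f)
    (l : Measure X) [IsProbabilityMeasure l] : ∫ q, ind (f q) ∂l ≤ 1 := by
  have h := integral_mono (integrable_ind hf l) (integrable_const (μ := l) (1 : ℝ))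
    (fun q => ind_le_one (f q))
  simpa using h

variable (l : Measure (Config × Config)) [IsProbabilityMeasure l]

lemma annRate_nonneg (x : ℤ) : 0 ≤ annRate b₁ b₂ l x := integral_nonneg fun _ => ann_nonneg _ _ _

/-- The balance equation at the vertex `x`. Its outgoing vertical arrow sits at `x - 1`, because the
frame moves at speed one. -/
lemma annRate_eq (x : ℤ) : annRate b₁ b₂ l x =
    dens l x + horDens b₁ b₂ l (x - 1) - dens (pairEvolve b₁ b₂ l) (x - 1) -
      horDens b₁ b₂ l x := by
  have hp : Integrable (fun q : (Config × Config) × SiteNoise => ind (plus q.1 x))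
      (l.prod (siteNoiseLaw b₁ b₂)) := integrable_ind ((measurable_plus x).comp measurable_fst) _
  have hh : ∀ y, Integrable (fun q : (Config × Config) × SiteNoise => ind (horPlus q.1 q.2 y))
      (l.prod (siteNoiseLaw b₁ b₂)) := fun y => integrable_ind (measurable_horPlus y) _
  have ho : Integrable (fun q : (Config × Config) × SiteNoise =>
      ind (plus (pairStep q.1 q.2) (x - 1))) (l.prod (siteNoiseLaw b₁ b₂)) :=
    integrable_ind ((measurable_plus (x - 1)).comp measurable_pairStep) _
  have e1 : dens l x = ∫ q, ind (plus q.1 x) ∂(l.prod (siteNoiseLaw b₁ b₂)) := by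
    rw [integral_fun_fst (fun p : Config × Config => ind (plus p x))]
    simp [dens]
  have e2 : dens (pairEvolve b₁ b₂ l) (x - 1) =
      ∫ q, ind (plus (pairStep q.1 q.2) (x - 1)) ∂(l.prod (siteNoiseLaw b₁ b₂)) :=
    integral_evolve measurable_pairStep l (measurable_ind.comp (measurable_plus (x - 1)))
  rw [e1, e2, annRate, horDens, horDens]
  have i1 : Integrable (fun q : (Config × Config) × SiteNoise => ind (plus q.1 x) +
      ind (horPlus q.1 q.2 (x - 1))) (l.prod (siteNoiseLaw b₁ b₂)) := hp.add (hh _)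
  have i2 : Integrable (fun q : (Config × Config) × SiteNoise => ind (plus q.1 x) +
      ind (horPlus q.1 q.2 (x - 1)) - ind (plus (pairStep q.1 q.2) (x - 1)))
      (l.prod (siteNoiseLaw b₁ b₂)) := i1.sub ho
  simp only [ann]
  rw [integral_sub i2 (hh _), integral_sub i1 ho, integral_add hp (hh _)]

section Coordinate

variable {ι : Type*} [DecidableEq ι] {Ω : ι → Type*} [∀ i, MeasurableSpace (Ω i)]

/-- A function of one coordinate is independent of a function which does not depend on it. -/
lemma integral_infinitePi_mul_coord (μ : (i : ι) → Measure (Ω i)) [∀ i, IsProbabilityMeasure (μ i)]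
    {i : ι} {f : (∀ i, Ω i) → ℝ} (hf : Measurable f) (hfi : ∀ ω v, f (Function.update ω i v) = f ω)
    {k : Ω i → ℝ} (hk : Measurable k) :
    ∫ ω, f ω * k (ω i) ∂(Measure.infinitePi μ) =
      (∫ ω, f ω ∂(Measure.infinitePi μ)) * ∫ v, k v ∂(μ i) := by
  have hm : Measurable fun p : (∀ i, Ω i) × Ω i => Function.update p.1 i p.2 := by
    refine measurable_pi_lambda _ fun j => ?_
    by_cases h : j = i
    · subst h; simpa using measurable_snd
    · simpa [Function.update_of_ne h] using measurable_fst.eval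
  conv_lhs => rw [← infinitePi_map_update μ i]
  have hfk : Measurable fun ω : ∀ i, Ω i => f ω * k (ω i) :=
    hf.mul (hk.comp (measurable_pi_apply i))
  rw [integral_map hm.aemeasurable hfk.aestronglyMeasurable]
  simp only [hfi, Function.update_self]
  exact integral_prod_mul f k

end Coordinate

lemma integral_bernoulliMeasure_bool (p : I) (k : Bool → ℝ) :
    ∫ v, k v ∂(bernoulliMeasure true false p) = p * k true + (1 - p) * k false := by
  rw [integral_fintype Integrable.of_finite, Fintype.sum_bool]
  simp only [measureReal_def, bernoulliMeasure_singleton_true, bernoulliMeasure_singleton_false,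
    smul_eq_mul, ENNReal.toReal_ofReal p.2.1]
  rw [ENNReal.toReal_ofReal (by linarith [p.2.2])]

lemma hor_update (η : Config) (u : SiteNoise) {x y : ℤ} (h : y < x) (i : Bool) (v : Bool) :
    hor η (Function.update u (x, i) v) y = hor η u y := by
  have : ∀ z ≤ y, ∀ j, Function.update u (x, i) v (z, j) = u (z, j) := fun z hz j => by
    rw [Function.update_of_ne]
    simp only [ne_eq, Prod.mk.injEq, not_and]
    omega
  rw [Bool.eq_iff_iff, hor_eq_true, hor_eq_true]
  constructor <;> rintro ⟨z, hz, h1, h2, h3⟩ <;> refine ⟨z, hz, h1, ?_, fun a ha ha' => ?_⟩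
  · rwa [this z hz] at h2
  · simpa only [this a ha'] using h3 a ha ha'
  · rwa [this z hz]
  · simpa only [this a ha'] using h3 a ha ha'

lemma integral_mul_ind_reset {f : SiteNoise → ℝ} (hf : Measurable f) {x : ℤ}
    (hfx : ∀ u i v, f (Function.update u (x, i) v) = f u) :
    ∫ u, f u * (ind (u (x, false)) * ind (!u (x, true))) ∂(siteNoiseLaw b₁ b₂) =
      resetProb b₁ b₂ * ∫ u, f u ∂(siteNoiseLaw b₁ b₂) := by
  have h1 := integral_infinitePi_mul_coord
    (fun p : ℤ × Bool => bernoulliMeasure true false (bif p.2 then b₂ else σ b₁)) (i := (x, true))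
    (f := fun u => f u * ind (u (x, false))) (k := fun v => ind (!v))
    (hf.mul (measurable_ind.comp (measurable_pi_apply _)))
    (fun u v => by rw [hfx, Function.update_of_ne (by simp)]) (measurable_of_countable _)
  have h2 := integral_infinitePi_mul_coord
    (fun p : ℤ × Bool => bernoulliMeasure true false (bif p.2 then b₂ else σ b₁)) (i := (x, false))
    (f := f) (k := ind) hf (fun u v => hfx u _ v) measurable_ind
  rw [h2] at h1
  simp only [cond_true, cond_false, integral_bernoulliMeasure_bool, ind_true, ind_false, mul_one,
    mul_zero, add_zero, Bool.not_true, Bool.not_false, zero_add, unitInterval.coe_symm_eq,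
    mul_assoc] at h1
  unfold siteNoiseLaw resetProb
  rw [h1]
  ring

/-- A discrepancy can leave `x` horizontally only if `x` itself carries one, or if one arrives and
`x` is not a reset. The reset at `x` is independent of the arriving arrow, which uses coins to the
left of `x` only. -/
lemma horDens_le (x : ℤ) : horDens b₁ b₂ l x ≤
    dens l x + (1 - resetProb b₁ b₂) * horDens b₁ b₂ l (x - 1) := by
  have hm := measurable_horPlus (x - 1)
  have hmr : Measurable fun q : (Config × Config) × SiteNoise =>
      ind (q.2 (x, false)) * ind (!q.2 (x, true)) := by
    have h : Measurable fun b : Bool × Bool => ind b.1 * ind (!b.2) := measurable_of_countable _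
    have hx : ∀ i : ℤ × Bool, Measurable fun u : SiteNoise => u i := measurable_pi_apply
    exact h.comp (((hx (x, false)).comp measurable_snd).prodMk ((hx (x, true)).comp measurable_snd))
  have hb : ∀ (p : Config × Config) (u : SiteNoise),
      |ind (horPlus p u (x - 1)) * (ind (u (x, false)) * ind (!u (x, true)))| ≤ 1 := by
    intro p u
    cases horPlus p u (x - 1) <;> cases u (x, false) <;> cases u (x, true) <;> simp
  have hi : Integrable (fun q : (Config × Config) × SiteNoise =>
      ind (horPlus q.1 q.2 (x - 1)) * (ind (q.2 (x, false)) * ind (!q.2 (x, true))))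
      (l.prod (siteNoiseLaw b₁ b₂)) :=
    Integrable.of_bound ((measurable_ind.comp hm).mul hmr).aestronglyMeasurable 1
      (ae_of_all _ fun q => hb _ _)
  have key : ∫ q, ind (horPlus q.1 q.2 (x - 1)) * (ind (q.2 (x, false)) * ind (!q.2 (x, true)))
      ∂(l.prod (siteNoiseLaw b₁ b₂)) = resetProb b₁ b₂ * horDens b₁ b₂ l (x - 1) := by
    rw [integral_prod_noise (g := fun p u => ind (horPlus p u (x - 1)) *
      (ind (u (x, false)) * ind (!u (x, true)))) ((measurable_ind.comp hm).mul hmr) hb, horDens,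
      integral_prod_noise (g := fun p u => ind (horPlus p u (x - 1))) (measurable_ind.comp hm)
        (fun p u => abs_ind_le _), ← integral_const_mul]
    refine integral_congr_ae (ae_of_all _ fun p => ?_)
    refine integral_mul_ind_reset b₁ b₂ (f := fun u => ind (horPlus p u (x - 1)))
      (measurable_ind.comp (hm.comp measurable_prodMk_left)) fun u i v => ?_
    simp only [horPlus, hor_update _ _ (show x - 1 < x by omega)]
  have e1 : dens l x = ∫ q, ind (plus q.1 x) ∂(l.prod (siteNoiseLaw b₁ b₂)) := by
    rw [integral_fun_fst (fun p : Config × Config => ind (plus p x))]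
    simp [dens]
  have hp : Integrable (fun q : (Config × Config) × SiteNoise => ind (plus q.1 x))
      (l.prod (siteNoiseLaw b₁ b₂)) := integrable_ind ((measurable_plus x).comp measurable_fst) _
  have i1 : Integrable (fun q : (Config × Config) × SiteNoise => ind (horPlus q.1 q.2 (x - 1)) -
      ind (horPlus q.1 q.2 (x - 1)) * (ind (q.2 (x, false)) * ind (!q.2 (x, true))))
      (l.prod (siteNoiseLaw b₁ b₂)) := (integrable_ind hm _).sub hi
  rw [one_sub_mul, ← key, e1, horDens, horDens, ← integral_sub (integrable_ind hm _) hi,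
    ← integral_add hp i1]
  refine integral_mono (integrable_ind (measurable_horPlus x) _) (hp.add i1) fun q => ?_
  simp only [plus, horPlus]
  rw [hor_rec q.1.1 q.2 x, hor_rec q.1.2 q.2 x]
  cases hor q.1.1 q.2 (x - 1) <;> cases hor q.1.2 q.2 (x - 1) <;> cases q.1.1 x <;>
    cases q.1.2 x <;> cases q.2 (x, false) <;> cases q.2 (x, true) <;> simp

end Discrepancies

/-! ### Stationary couplings without annihilation are ordered. -/

section NoAnnihilation

lemma hor_eq_hor {p : Config × Config} {u : SiteNoise} {x : ℤ} (hr : IsReset u x) {n : ℕ}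
    (h : ∀ z, x ≤ z → z ≤ x + n → p.1 z = p.2 z) : hor p.1 u (x + n) = hor p.2 u (x + n) := by
  induction n with
  | zero => simpa [hor_of_isReset hr] using h x le_rfl (by simp)
  | succ n ih =>
    have ih := ih fun z hz hz' => h z hz (by push_cast; omega)
    rw [hor_rec p.1, hor_rec p.2, h _ (by push_cast; omega) le_rfl]
    have : x + ((n + 1 : ℕ) : ℤ) - 1 = x + n := by push_cast; ring
    rw [this, ih]

/-- Opposite discrepancies at neighbouring sites can annihilate. -/
lemma ann_of_adjacent {p : Config × Config} {u : SiteNoise} {x : ℤ} (h1 : plus p x = true)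
    (h2 : plus p.swap (x + 1) = true) (hr : IsReset u x) (ha : u (x + 1, false) = false)
    (hc : u (x + 1, true) = false) : ann p u (x + 1) = 1 := by
  simp only [plus, Bool.and_eq_true, Bool.not_eq_true', Prod.fst_swap, Prod.snd_swap] at h1 h2
  simp only [ann, plus, horPlus, pairStep, siteStep_sub_one]
  rw [hor_rec p.1 u (x + 1), hor_rec p.2 u (x + 1), add_sub_cancel_right, hor_of_isReset hr,
    hor_of_isReset hr, h1.1, h1.2, h2.1, h2.2, ha, hc]
  simp

/-- Opposite discrepancies can approach each other by one step. -/
lemma approach {p : Config × Config} {u : SiteNoise} {x : ℤ} {k : ℕ} (h1 : plus p x = true)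
    (h2 : plus p.swap (x + (k + 2 : ℕ)) = true)
    (h : ∀ z, x < z → z < x + (k + 2 : ℕ) → p.1 z = p.2 z)
    (hr : IsReset u x) (hr' : IsReset u (x + 1)) (ha : u (x + (k + 2 : ℕ), false) = false)
    (hc : u (x + (k + 2 : ℕ), true) = true) :
    plus (pairStep p u) x = true ∧ plus (pairStep p u).swap (x + (k + 1 : ℕ)) = true := by
  simp only [plus, Bool.and_eq_true, Bool.not_eq_true', Prod.fst_swap, Prod.snd_swap] at h1 h2 ⊢
  have e2 : x + ((k + 1 : ℕ) : ℤ) = x + ((k + 2 : ℕ) : ℤ) - 1 := by push_cast; ring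
  have hh : hor p.1 u (x + (k + 1 : ℕ)) = hor p.2 u (x + (k + 1 : ℕ)) := by
    have := hor_eq_hor (p := p) hr' (n := k) (fun z hz hz' => h z (by omega) (by push_cast; omega))
    have e3 : x + ((k + 1 : ℕ) : ℤ) = x + 1 + k := by push_cast; ring
    rwa [e3]
  constructor
  -- The two resets move the content of `x` to `x + 1`, that is, they keep it at `x` in the moving
  -- frame.
  · have h3 := siteStep_sub_one p.1 u (x + 1)
    have h4 := siteStep_sub_one p.2 u (x + 1)
    simp only [add_sub_cancel_right, hor_of_isReset hr, hor_of_isReset hr', h1.1, h1.2] at h3 h4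
    simp only [pairStep, h3, h4]
    simp
  -- At the right site the coins let every incoming arrow pass unchanged. The discrepancy stays in
  -- place, which is one step to the left in the moving frame.
  · rw [e2]
    simp only [pairStep, siteStep_sub_one]
    rw [hor_rec p.1 u (x + (k + 2 : ℕ)), hor_rec p.2 u (x + (k + 2 : ℕ)), ← e2, hh, h2.1, h2.2, ha,
      hc]
    cases hor p.2 u (x + (k + 1 : ℕ)) <;> simp

variable {b₁ b₂ : I}

lemma siteNoiseLaw_box_ne_zero (hb₁ : 0 < b₁) (hb₁' : b₁ < 1) (hb₂ : 0 < b₂) (hb₂' : b₂ < 1)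
    (s : Finset (ℤ × Bool)) (v : ℤ × Bool → Bool) :
    siteNoiseLaw b₁ b₂ {u | ∀ p ∈ s, u p = v p} ≠ 0 := by
  rw [siteNoiseLaw_box, Finset.prod_ne_zero_iff]
  rintro ⟨x, i⟩ -
  cases i
  · refine bernoulliMeasure_singleton_pos ?_ ?_ _
    · exact Subtype.coe_lt_coe.1 (by simpa using hb₁')
    · exact Subtype.coe_lt_coe.1 (by simpa using hb₁)
  · exact bernoulliMeasure_singleton_pos hb₂ hb₂' _

lemma measurableSet_opposite (x y : ℤ) :
    MeasurableSet {p : Config × Config | plus p x = true ∧ plus p.swap y = true} :=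
  (measurableSet_apply_eq (measurable_plus x) true).inter
    (measurableSet_apply_eq ((measurable_plus y).comp measurable_swap) true)

/-- Strong induction on the distance `k + 1`. Adjacent opposite discrepancies annihilate with
positive probability, which a vanishing rate forbids. At a larger distance they come one step closer
with positive probability, and stationarity carries the null event at the shorter distance over to
the longer one. -/
lemma measure_opposite_eq_zero (hb₁ : 0 < b₁) (hb₁' : b₁ < 1) (hb₂ : 0 < b₂) (hb₂' : b₂ < 1)
    {l : Measure (Config × Config)} [IsProbabilityMeasure l] (hl : pairEvolve b₁ b₂ l = l)
    (ha : ∀ x, annRate b₁ b₂ l x = 0) (k : ℕ) :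
    ∀ x : ℤ, l {p | plus p x = true ∧ plus p.swap (x + (k + 1 : ℕ)) = true} = 0 := by
  induction k using Nat.strong_induction_on with
  | _ k ih =>
    intro x
    -- No discrepancy lies between the two sites on `G`. Any discrepancy in between would form an
    -- opposite pair at a smaller distance with one of the two ends.
    set G : Set (Config × Config) := {p | plus p x = true ∧ plus p.swap (x + (k + 1 : ℕ)) = true ∧
      ∀ z, x < z → z < x + (k + 1 : ℕ) → p.1 z = p.2 z} with hG
    suffices hG0 : l G = 0 by
      have hz : l (⋃ z : ℤ, ⋃ _ : x < z ∧ z < x + (k + 1 : ℕ),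
          ({p | plus p x = true ∧ plus p.swap z = true} ∪
          {p | plus p z = true ∧ plus p.swap (x + (k + 1 : ℕ)) = true})) = 0 := by
        refine measure_iUnion_null fun z => measure_iUnion_null fun hz => measure_union_null ?_ ?_
        · have h := ih (z - x - 1).toNat (by omega) x
          have e : x + (((z - x - 1).toNat + 1 : ℕ) : ℤ) = z := by omega
          rwa [e] at h
        · have h := ih (x + k - z).toNat (by omega) z
          have e : z + (((x + k - z).toNat + 1 : ℕ) : ℤ) = x + (k + 1 : ℕ) := by omega
          rwa [e] at h
      refine measure_mono_null ?_ (measure_union_null hG0 hz)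
      rintro p ⟨h1, h2⟩
      by_cases h : ∀ z, x < z → z < x + (k + 1 : ℕ) → p.1 z = p.2 z
      · exact Or.inl ⟨h1, h2, h⟩
      · push Not at h
        obtain ⟨z, hz1, hz2, hz3⟩ := h
        right
        refine Set.mem_iUnion₂.2 ⟨z, ⟨hz1, hz2⟩, ?_⟩
        cases h4 : p.1 z
        · left
          refine ⟨h1, ?_⟩
          cases h5 : p.2 z
          · simp [h4, h5] at hz3
          · simp [plus, h4, h5]
        · right
          refine ⟨?_, h2⟩
          cases h5 : p.2 z
          · simp [plus, h4, h5]
          · simp [h4, h5] at hz3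
    rcases k with _ | k
    -- On this box `x` is a reset, and at `x + 1` nothing wakes up and nothing continues: the two
    -- discrepancies meet at `x + 1`.
    · set s : Finset (ℤ × Bool) := {(x, false), (x, true), (x + 1, false), (x + 1, true)}
      set E : Set SiteNoise := {u | ∀ p ∈ s, u p = decide (p = (x, false))}
      have hE : siteNoiseLaw b₁ b₂ E ≠ 0 := siteNoiseLaw_box_ne_zero hb₁ hb₁' hb₂ hb₂' s _
      have h0 : (l.prod (siteNoiseLaw b₁ b₂)) {q | ann q.1 q.2 (x + 1) ≠ 0} = 0 := by
        have := (integral_eq_zero_iff_of_nonneg (μ := l.prod (siteNoiseLaw b₁ b₂))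
          (fun q => ann_nonneg q.1 q.2 (x + 1)) (Integrable.of_bound
          (measurable_ann (x + 1)).aestronglyMeasurable 2
          (ae_of_all _ fun q => abs_ann_le _ _ _))).1 (ha (x + 1))
        exact this
      have hsub : G ×ˢ E ⊆ {q : (Config × Config) × SiteNoise | ann q.1 q.2 (x + 1) ≠ 0} := by
        rintro ⟨p, u⟩ ⟨⟨h1, h2, -⟩, hu⟩
        have hu1 := hu (x, false) (by simp [s])
        have hu2 := hu (x, true) (by simp [s])
        have hu3 := hu (x + 1, false) (by simp [s])
        have hu4 := hu (x + 1, true) (by simp [s])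
        simp only [Prod.mk.injEq, decide_true, and_true, and_false, decide_false, reduceCtorEq,
          add_eq_left, one_ne_zero] at hu1 hu2 hu3 hu4
        have := ann_of_adjacent (p := p) (u := u) h1 h2 ⟨hu1, hu2⟩ hu3 hu4
        simp only [Set.mem_ofPred_eq]
        rw [this]
        norm_num
      have := measure_mono_null hsub h0
      rw [Measure.prod_prod, mul_eq_zero] at this
      exact this.resolve_right hE
    -- This box consists of the coins required by `approach`: resets at `x` and `x + 1`, and free
    -- passage at the right end.
    · set s : Finset (ℤ × Bool) := {(x, false), (x, true), (x + 1, false), (x + 1, true),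
        (x + (k + 2 : ℕ), false), (x + (k + 2 : ℕ), true)}
      set E : Set SiteNoise := {u | ∀ p ∈ s, u p = decide (p = (x, false) ∨ p = (x + 1, false) ∨
        p = (x + (k + 2 : ℕ), true))}
      have hE : siteNoiseLaw b₁ b₂ E ≠ 0 := siteNoiseLaw_box_ne_zero hb₁ hb₁' hb₂ hb₂' s _
      have hk := ih k (by omega) x
      conv at hk => rw [← hl]
      rw [pairEvolve, evolve, Measure.map_apply measurable_pairStep
        (measurableSet_opposite _ _)] at hk
      have hsub : G ×ˢ E ⊆ (fun q : (Config × Config) × SiteNoise => pairStep q.1 q.2) ⁻¹'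
          {p | plus p x = true ∧ plus p.swap (x + (k + 1 : ℕ)) = true} := by
        rintro ⟨p, u⟩ ⟨⟨h1, h2, h3⟩, hu⟩
        have hu1 := hu (x, false) (by simp [s])
        have hu2 := hu (x, true) (by simp [s])
        have hu3 := hu (x + 1, false) (by simp [s])
        have hu4 := hu (x + 1, true) (by simp [s])
        have hu5 := hu (x + (k + 2 : ℕ), false) (by simp [s])
        have hu6 := hu (x + (k + 2 : ℕ), true) (by simp [s])
        have e1 : ¬ ((k : ℤ) + 2 = 0) := by omega
        have e2 : ¬ ((k : ℤ) + 2 = 1) := by omega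
        have e4 : ¬ (1 = (k : ℤ) + 2) := by omega
        simp [e1, e2, e4] at hu1 hu2 hu3 hu4 hu5 hu6
        exact approach h1 h2 h3 ⟨hu1, hu2⟩ ⟨hu3, hu4⟩ (by simpa using hu5) (by simpa using hu6)
      have := measure_mono_null hsub hk
      rw [Measure.prod_prod, mul_eq_zero] at this
      exact this.resolve_right hE

lemma pairEvolve_swap (l : Measure (Config × Config)) [IsProbabilityMeasure l] :
    pairEvolve b₁ b₂ (l.map Prod.swap) = (pairEvolve b₁ b₂ l).map Prod.swap :=
  evolve_map measurable_pairStep measurable_pairStep measurable_swap (MeasurePreserving.id _)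
    (fun _ _ => rfl) l

lemma annRate_swap (l : Measure (Config × Config)) [IsProbabilityMeasure l] (x : ℤ) :
    annRate b₁ b₂ (l.map Prod.swap) x = annRate b₁ b₂ l x := by
  have h : (l.map Prod.swap).prod (siteNoiseLaw b₁ b₂) =
      (l.prod (siteNoiseLaw b₁ b₂)).map (Prod.map Prod.swap id) := by
    rw [← Measure.map_prod_map _ _ measurable_swap measurable_id, Measure.map_id]
  rw [annRate, h, integral_map (measurable_swap.prodMap measurable_id).aemeasurable
    (measurable_ann x).aestronglyMeasurable]
  exact integral_congr_ae (ae_of_all _ fun q => ann_swap _ _ _)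

/-- A stationary coupling without annihilations is ordered. -/
lemma ae_ordered (hb₁ : 0 < b₁) (hb₁' : b₁ < 1) (hb₂ : 0 < b₂) (hb₂' : b₂ < 1)
    {l : Measure (Config × Config)} [IsProbabilityMeasure l] (hl : pairEvolve b₁ b₂ l = l)
    (ha : ∀ x, annRate b₁ b₂ l x = 0) : ∀ᵐ p ∂l, p.1 ≤ p.2 ∨ p.2 ≤ p.1 := by
  have : IsProbabilityMeasure (l.map Prod.swap) :=
    Measure.isProbabilityMeasure_map measurable_swap.aemeasurable
  have h1 := measure_opposite_eq_zero hb₁ hb₁' hb₂ hb₂' hl ha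
  have h2 := measure_opposite_eq_zero hb₁ hb₁' hb₂ hb₂' (l := l.map Prod.swap)
    (by rw [pairEvolve_swap, hl]) (fun x => by rw [annRate_swap, ha])
  have h3 : ∀ᵐ p ∂l, ∀ (k : ℕ) (x : ℤ),
      ¬ (plus p x = true ∧ plus p.swap (x + (k + 1 : ℕ)) = true) :=
    ae_all_iff.2 fun k => ae_all_iff.2 fun x => by
      rw [ae_iff]; simpa only [not_not] using h1 k x
  have h4 : ∀ᵐ p ∂l, ∀ (k : ℕ) (x : ℤ),
      ¬ (plus p.swap x = true ∧ plus p (x + (k + 1 : ℕ)) = true) :=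
    ae_all_iff.2 fun k => ae_all_iff.2 fun x => by
      have := h2 k x
      rw [Measure.map_apply measurable_swap (measurableSet_opposite _ _)] at this
      rw [ae_iff]; simp only [not_not]; exact this
  filter_upwards [h3, h4] with p hp hp'
  by_contra hne
  push Not at hne
  obtain ⟨hn1, hn2⟩ := hne
  simp only [Pi.le_def, not_forall, not_le] at hn1 hn2
  obtain ⟨x, hx⟩ := hn1
  obtain ⟨y, hy⟩ := hn2
  have hx' : plus p x = true := by
    revert hx; simp only [plus]; cases p.1 x <;> cases p.2 x <;> simp
  have hy' : plus p.swap y = true := by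
    revert hy; simp only [plus, Prod.fst_swap, Prod.snd_swap]
    cases p.1 y <;> cases p.2 y <;> simp
  rcases lt_trichotomy x y with h | h | h
  · refine hp (y - x - 1).toNat x ⟨hx', ?_⟩
    have e : x + (((y - x - 1).toNat + 1 : ℕ) : ℤ) = y := by omega
    rwa [e]
  · subst h
    revert hx' hy'; simp only [plus, Prod.fst_swap, Prod.snd_swap]
    cases p.1 x <;> cases p.2 x <;> simp
  · refine hp' (x - y - 1).toNat y ⟨hy', ?_⟩
    have e : y + (((x - y - 1).toNat + 1 : ℕ) : ℤ) = x := by omega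
    rwa [e]

end NoAnnihilation

/-! ### Bounds on the annihilation rate by tent functions. -/

section AnnihilationRate

lemma sum_Icc_shift (F : ℤ → ℝ) (a b : ℤ) :
    ∑ x ∈ Finset.Icc a b, F (x - 1) = ∑ x ∈ Finset.Icc (a - 1) (b - 1), F x := by
  refine Finset.sum_nbij' (fun x => x - 1) (fun x => x + 1) ?_ ?_ ?_ ?_ ?_ <;>
    simp

variable (b₁ b₂ : I) (l : Measure (Config × Config)) [IsProbabilityMeasure l]

lemma dens_nonneg (x : ℤ) : 0 ≤ dens l x := integral_ind_nonneg _ _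

lemma dens_le_one (x : ℤ) : dens l x ≤ 1 := integral_ind_le_one (measurable_plus x) _

lemma horDens_nonneg (x : ℤ) : 0 ≤ horDens b₁ b₂ l x := integral_ind_nonneg _ _

lemma horDens_le_one (x : ℤ) : horDens b₁ b₂ l x ≤ 1 :=
  integral_ind_le_one (measurable_horPlus x) _

lemma isProbabilityMeasure_pairEvolve : IsProbabilityMeasure (pairEvolve b₁ b₂ l) :=
  isProbabilityMeasure_evolve measurable_pairStep l

lemma isProbabilityMeasure_pairEvolve_iterate (t : ℕ) :
    IsProbabilityMeasure ((pairEvolve b₁ b₂)^[t] l) :=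
  isProbabilityMeasure_evolve_iterate measurable_pairStep l t

lemma resetProb_le_one : resetProb b₁ b₂ ≤ 1 := by
  have h1 := b₁.2.1
  have h2 := b₂.2.1
  have h3 := b₁.2.2
  have h4 := b₂.2.2
  unfold resetProb
  nlinarith

/-- Sum `horDens_le` over the window. The edge entering it costs at most `1`, and the term with the
factor `1 - resetProb b₁ b₂` is absorbed on the left. -/
lemma sum_horDens_le {b₁ b₂ : I} (h₁ : b₁ < 1) (h₂ : b₂ < 1) (m M : ℤ) :
    ∑ x ∈ Finset.Icc m M, horDens b₁ b₂ l x ≤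
      (∑ x ∈ Finset.Icc m M, dens l x + 1) / resetProb b₁ b₂ := by
  have hr := resetProb_pos h₁ h₂
  rw [le_div_iff₀ hr]
  have hD : 0 ≤ ∑ x ∈ Finset.Icc m M, dens l x := Finset.sum_nonneg fun x _ => dens_nonneg l x
  rcases lt_or_ge M m with hlt | hle
  · rw [Finset.Icc_eq_empty (by omega)]; simp
  have h1 : ∑ x ∈ Finset.Icc m M, horDens b₁ b₂ l x ≤ ∑ x ∈ Finset.Icc m M, dens l x +
      (1 - resetProb b₁ b₂) * ∑ x ∈ Finset.Icc m M, horDens b₁ b₂ l (x - 1) := by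
    rw [Finset.mul_sum, ← Finset.sum_add_distrib]
    exact Finset.sum_le_sum fun x _ => horDens_le b₁ b₂ l x
  have h2 : ∑ x ∈ Finset.Icc m M, horDens b₁ b₂ l (x - 1) ≤
      1 + ∑ x ∈ Finset.Icc m M, horDens b₁ b₂ l x := by
    rw [sum_Icc_shift]
    calc ∑ x ∈ Finset.Icc (m - 1) (M - 1), horDens b₁ b₂ l x
        ≤ ∑ x ∈ insert (m - 1) (Finset.Icc m M), horDens b₁ b₂ l x := by
          refine Finset.sum_le_sum_of_subset_of_nonneg (fun x hx => ?_)
            (fun x _ _ => horDens_nonneg b₁ b₂ l x)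
          simp only [Finset.mem_Icc, Finset.mem_insert] at hx ⊢
          omega
      _ ≤ _ := by
          rw [Finset.sum_insert (by simp)]
          gcongr
          exact horDens_le_one b₁ b₂ l _
  have h3 := mul_le_mul_of_nonneg_left h2 (sub_nonneg.2 (resetProb_le_one b₁ b₂))
  nlinarith

/-- The tent function of width `N`. -/
def tent (N : ℕ) (x : ℤ) : ℝ := max 0 (1 - |(x : ℝ)| / N)

lemma tent_nonneg (N : ℕ) (x : ℤ) : 0 ≤ tent N x := le_max_left _ _

lemma tent_le_one (N : ℕ) (x : ℤ) : tent N x ≤ 1 :=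
  max_le zero_le_one (by have : 0 ≤ |(x : ℝ)| / N := by positivity
                         linarith)

lemma tent_eq_zero {N : ℕ} (hN : 0 < N) {x : ℤ} (hx : (N : ℤ) ≤ |x|) : tent N x = 0 := by
  have h : (1 : ℝ) ≤ |(x : ℝ)| / N := by
    rw [le_div_iff₀ (by exact_mod_cast hN), one_mul]
    exact_mod_cast hx
  exact max_eq_left (by linarith)

lemma half_le_tent {N : ℕ} (hN : 0 < N) {x : ℤ} (hx : 2 * |x| ≤ N) : 1 / 2 ≤ tent N x := by
  refine le_max_of_le_right ?_
  have h : |(x : ℝ)| / N ≤ 1 / 2 := by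
    rw [div_le_div_iff₀ (by exact_mod_cast hN) (by norm_num)]
    have : (2 : ℝ) * |(x : ℝ)| ≤ N := by exact_mod_cast hx
    linarith
  linarith

lemma abs_tent_sub_le (N : ℕ) (x : ℤ) : |tent N (x + 1) - tent N x| ≤ 1 / N := by
  have h := abs_max_sub_max_le_abs (1 - |((x + 1 : ℤ) : ℝ)| / N) (1 - |(x : ℝ)| / N) 0
  rw [max_comm _ 0, max_comm _ 0] at h
  refine h.trans ?_
  have h2 : (1 - |((x + 1 : ℤ) : ℝ)| / N) - (1 - |(x : ℝ)| / N) =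
      (|(x : ℝ)| - |((x + 1 : ℤ) : ℝ)|) / N := by ring
  rw [h2, abs_div, Nat.abs_cast]
  gcongr
  refine (abs_abs_sub_abs_le _ _).trans ?_
  push_cast
  simp

/-- The weighted number of positive discrepancies. -/
def mass (N : ℕ) : ℝ := ∑ x ∈ Finset.Icc (-(N + 1 : ℤ)) (N + 1), tent N x * dens l x

/-- The number of positive discrepancies in a window. -/
def count (N : ℕ) : ℝ := ∑ x ∈ Finset.Icc (-(N : ℤ)) N, dens l x

lemma mass_nonneg (N : ℕ) : 0 ≤ mass l N :=
  Finset.sum_nonneg fun x _ => mul_nonneg (tent_nonneg N x) (dens_nonneg l x)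

lemma count_le (N : ℕ) : count l N ≤ 2 * N + 1 := by
  refine (Finset.sum_le_card_nsmul _ _ 1 fun x _ => dens_le_one l x).trans ?_
  rw [Int.card_Icc, nsmul_eq_mul, mul_one]
  have : ((N : ℤ) + 1 - (-(N : ℤ))).toNat = 2 * N + 1 := by omega
  rw [this]
  push_cast
  exact le_rfl

lemma mass_le_count {N : ℕ} (hN : 0 < N) : mass l N ≤ count l N := by
  have hs : Finset.Icc (-(N : ℤ)) N ⊆ Finset.Icc (-(N + 1 : ℤ)) (N + 1) :=
    Finset.Icc_subset_Icc (by omega) (by omega)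
  rw [mass, ← Finset.sum_subset hs]
  · exact Finset.sum_le_sum fun x _ => mul_le_of_le_one_left (dens_nonneg l x) (tent_le_one N x)
  · intro x _ hx
    rw [tent_eq_zero hN, zero_mul]
    simp only [Finset.mem_Icc, not_and_or, not_le] at hx
    rw [le_abs]
    omega

lemma count_mono {M N : ℕ} (h : M ≤ N) : count l M ≤ count l N :=
  Finset.sum_le_sum_of_subset_of_nonneg (Finset.Icc_subset_Icc (by omega) (by omega))
    fun x _ _ => dens_nonneg l x

/-- The tent of width `2 * N + 2` is at least `1 / 2` on `|x| ≤ N + 1`. -/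
lemma count_le_mass (N : ℕ) : count l (N + 1) ≤ 2 * mass l (2 * N + 2) := by
  have hs : Finset.Icc (-((N + 1 : ℕ) : ℤ)) ((N + 1 : ℕ) : ℤ) ⊆
      Finset.Icc (-(((2 * N + 2 : ℕ) : ℤ) + 1)) (((2 * N + 2 : ℕ) : ℤ) + 1) :=
    Finset.Icc_subset_Icc (by push_cast; omega) (by push_cast; omega)
  rw [mass, Finset.mul_sum]
  refine le_trans ?_ (Finset.sum_le_sum_of_subset_of_nonneg hs fun x _ _ =>
    mul_nonneg zero_le_two (mul_nonneg (tent_nonneg _ x) (dens_nonneg l x)))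
  refine Finset.sum_le_sum fun x hx => ?_
  have h : 1 / 2 ≤ tent (2 * N + 2) x := by
    refine half_le_tent (by omega) ?_
    have : |x| ≤ N + 1 := by
      rw [abs_le]; simp only [Finset.mem_Icc] at hx; push_cast at hx; omega
    push_cast; linarith
  nlinarith [dens_nonneg l x]

/-- Summation by parts in the balance equation. The slope `1 / N` of the tent multiplies the numbers
of vertical and horizontal discrepancies; the latter are bounded by `sum_horDens_le`. -/
lemma tent_flux {b₁ b₂ : I} (h₁ : b₁ < 1) (h₂ : b₂ < 1) {N : ℕ} (hN : 0 < N) :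
    ∑ x ∈ Finset.Icc (-(N + 1 : ℤ)) (N + 1), tent N x * annRate b₁ b₂ l x ≤
      mass l N - mass (pairEvolve b₁ b₂ l) N + (1 / N) * (count (pairEvolve b₁ b₂ l) (N + 1) +
        (count l (N + 1) + 1) / resetProb b₁ b₂) := by
  have := isProbabilityMeasure_pairEvolve b₁ b₂ l
  set l' := pairEvolve b₁ b₂ l with hl'
  -- The tent vanishes for `|x| ≥ N`, so shifting the summation in a window of radius `N + 1` leaves
  -- no boundary terms.
  have hshift : ∀ g : ℤ → ℝ, ∑ x ∈ Finset.Icc (-(N + 1 : ℤ)) (N + 1), tent N x * g (x - 1) =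
      ∑ x ∈ Finset.Icc (-(N + 1 : ℤ)) (N + 1), tent N (x + 1) * g x := by
    intro g
    have h := sum_Icc_shift (fun x => tent N (x + 1) * g x) (-(N + 1 : ℤ)) (N + 1)
    simp only [sub_add_cancel] at h
    rw [h]
    have hs1 : Finset.Icc (-(N + 1 : ℤ)) N ⊆ Finset.Icc (-(N + 1 : ℤ) - 1) (N + 1 - 1) :=
      Finset.Icc_subset_Icc (by omega) (by omega)
    have hs2 : Finset.Icc (-(N + 1 : ℤ)) N ⊆ Finset.Icc (-(N + 1 : ℤ)) (N + 1) :=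
      Finset.Icc_subset_Icc (by omega) (by omega)
    rw [← Finset.sum_subset hs1, ← Finset.sum_subset hs2]
    · intro x hx hx'
      simp only [Finset.mem_Icc] at hx hx'
      rw [tent_eq_zero hN (by rw [le_abs]; omega), zero_mul]
    · intro x hx hx'
      simp only [Finset.mem_Icc] at hx hx'
      rw [tent_eq_zero hN (by rw [le_abs]; omega), zero_mul]
  have e : ∑ x ∈ Finset.Icc (-(N + 1 : ℤ)) (N + 1), tent N x * annRate b₁ b₂ l x =
      mass l N - mass l' N +
      ∑ x ∈ Finset.Icc (-(N + 1 : ℤ)) (N + 1), (tent N x - tent N (x + 1)) * dens l' x +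
      ∑ x ∈ Finset.Icc (-(N + 1 : ℤ)) (N + 1),
        (tent N (x + 1) - tent N x) * horDens b₁ b₂ l x := by
    have h1 := hshift (dens l')
    have h2 := hshift (horDens b₁ b₂ l)
    simp only [annRate_eq, mul_sub, mul_add, sub_mul, Finset.sum_sub_distrib,
      Finset.sum_add_distrib, mass]
    rw [h1, h2]
    ring
  have h3 : ∑ x ∈ Finset.Icc (-(N + 1 : ℤ)) (N + 1), (tent N x - tent N (x + 1)) * dens l' x ≤
      (1 / N) * count l' (N + 1) := by
    rw [count, Finset.mul_sum]
    push_cast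
    refine Finset.sum_le_sum fun x _ => mul_le_mul_of_nonneg_right ?_ (dens_nonneg l' x)
    have := abs_le.1 (abs_tent_sub_le N x)
    linarith
  have h4 : ∑ x ∈ Finset.Icc (-(N + 1 : ℤ)) (N + 1),
      (tent N (x + 1) - tent N x) * horDens b₁ b₂ l x ≤
      (1 / N) * ((count l (N + 1) + 1) / resetProb b₁ b₂) := by
    refine le_trans ?_ (mul_le_mul_of_nonneg_left
      (sum_horDens_le l h₁ h₂ (-((N + 1 : ℕ) : ℤ)) ((N + 1 : ℕ) : ℤ)) (by positivity))
    rw [Finset.mul_sum]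
    push_cast
    refine Finset.sum_le_sum fun x _ => mul_le_mul_of_nonneg_right ?_ (horDens_nonneg b₁ b₂ l x)
    exact (abs_le.1 (abs_tent_sub_le N x)).2
  rw [e, mul_add]
  linarith

lemma mass_pairEvolve_le {b₁ b₂ : I} (h₁ : b₁ < 1) (h₂ : b₂ < 1) {N : ℕ} (hN : 0 < N) :
    mass (pairEvolve b₁ b₂ l) N ≤ mass l N + (5 + 6 / resetProb b₁ b₂) := by
  have := isProbabilityMeasure_pairEvolve b₁ b₂ l
  have hr := resetProb_pos h₁ h₂
  have h := tent_flux l h₁ h₂ hN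
  have h0 : 0 ≤ ∑ x ∈ Finset.Icc (-(N + 1 : ℤ)) (N + 1), tent N x * annRate b₁ b₂ l x :=
    Finset.sum_nonneg fun x _ => mul_nonneg (tent_nonneg N x) (annRate_nonneg b₁ b₂ l x)
  have hN' : (1 : ℝ) ≤ N := by exact_mod_cast hN
  have h1 := count_le (pairEvolve b₁ b₂ l) (N + 1)
  have h2 := count_le l (N + 1)
  push_cast at h1 h2
  -- The constants come from `2 * N + 3 ≤ 5 * N` and `2 * N + 4 ≤ 6 * N` for `N ≥ 1`.
  have h3 : (1 / (N : ℝ)) * (count (pairEvolve b₁ b₂ l) (N + 1) +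
      (count l (N + 1) + 1) / resetProb b₁ b₂) ≤
      (1 / N) * (5 * N + 6 * N / resetProb b₁ b₂) := by
    gcongr <;> linarith
  have h4 : (1 / (N : ℝ)) * (5 * N + 6 * N / resetProb b₁ b₂) = 5 + 6 / resetProb b₁ b₂ := by
    field_simp
  linarith

lemma mass_iterate_le {b₁ b₂ : I} (h₁ : b₁ < 1) (h₂ : b₂ < 1) {N : ℕ} (hN : 0 < N) (s : ℕ) :
    mass ((pairEvolve b₁ b₂)^[s] l) N ≤ mass l N + (5 + 6 / resetProb b₁ b₂) * s := by
  induction s with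
  | zero => simp
  | succ s ih =>
    have := isProbabilityMeasure_pairEvolve_iterate b₁ b₂ l s
    rw [Function.iterate_succ_apply']
    have h := mass_pairEvolve_le ((pairEvolve b₁ b₂)^[s] l) h₁ h₂ hN
    push_cast
    linarith

/-- The time average of the annihilation rate is small when the initial density is small. -/
lemma sum_annRate_le {b₁ b₂ : I} (h₁ : b₁ < 1) (h₂ : b₂ < 1) {N : ℕ} (hN : 0 < N) (S : ℕ)
    {x : ℤ} (hx : 2 * |x| ≤ N) :
    ∑ s ∈ Finset.range S, annRate b₁ b₂ ((pairEvolve b₁ b₂)^[s] l) x ≤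
      2 * count l (2 * N + 2) + 2 * S / N * ((2 * count l (2 * N + 2) +
        2 * (5 + 6 / resetProb b₁ b₂) * S + 1) * (1 + 1 / resetProb b₁ b₂)) := by
  have hr := resetProb_pos h₁ h₂
  set r := resetProb b₁ b₂
  set B := count l (2 * N + 2)
  set C := 5 + 6 / r
  have hC : 0 ≤ C := by positivity
  have hP := isProbabilityMeasure_pairEvolve_iterate b₁ b₂ l
  -- The discrepancies in the window at time `s` are bounded by twice the mass for the tent of
  -- double width, and this mass grows by at most `C` per step.
  have hB : ∀ s ≤ S, count ((pairEvolve b₁ b₂)^[s] l) (N + 1) ≤ 2 * B + 2 * C * S := by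
    intro s hs
    have h1 := count_le_mass ((pairEvolve b₁ b₂)^[s] l) N
    have h2 := mass_iterate_le l h₁ h₂ (show 0 < 2 * N + 2 by omega) s
    have h3 := mass_le_count l (show 0 < 2 * N + 2 by omega)
    have h4 : C * s ≤ C * S := by gcongr
    calc _ ≤ _ := h1
      _ ≤ 2 * (B + C * S) := by gcongr; linarith
      _ = _ := by ring
  -- The factor `2` compensates for the weight `tent N x ≥ 1 / 2`. The differences of masses
  -- telescope in the sum over `s`.
  have hstep : ∀ s < S, annRate b₁ b₂ ((pairEvolve b₁ b₂)^[s] l) x ≤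
      2 * (mass ((pairEvolve b₁ b₂)^[s] l) N - mass ((pairEvolve b₁ b₂)^[s + 1] l) N) +
      2 / N * ((2 * B + 2 * C * S + 1) * (1 + 1 / r)) := by
    intro s hs
    have h1 := tent_flux ((pairEvolve b₁ b₂)^[s] l) h₁ h₂ hN
    rw [← Function.iterate_succ_apply' (pairEvolve b₁ b₂)] at h1
    have h2 : tent N x * annRate b₁ b₂ ((pairEvolve b₁ b₂)^[s] l) x ≤
        ∑ y ∈ Finset.Icc (-(N + 1 : ℤ)) (N + 1), tent N y *
          annRate b₁ b₂ ((pairEvolve b₁ b₂)^[s] l) y := by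
      refine Finset.single_le_sum (f := fun y => tent N y *
        annRate b₁ b₂ ((pairEvolve b₁ b₂)^[s] l) y) (fun y _ => mul_nonneg (tent_nonneg N y)
        (annRate_nonneg b₁ b₂ _ y)) ?_
      have := abs_le.1 (show |x| ≤ N by have := abs_nonneg x; omega)
      rw [Finset.mem_Icc]; omega
    have h3 := half_le_tent hN hx
    have h4 := annRate_nonneg b₁ b₂ ((pairEvolve b₁ b₂)^[s] l) x
    have h5 := hB s hs.le
    have h6 := hB (s + 1) hs
    have h7 : (1 / (N : ℝ)) * (count ((pairEvolve b₁ b₂)^[s + 1] l) (N + 1) +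
        (count ((pairEvolve b₁ b₂)^[s] l) (N + 1) + 1) / r) ≤
        (1 / N) * ((2 * B + 2 * C * S + 1) + (2 * B + 2 * C * S + 1) / r) := by
      gcongr; linarith
    have h8 : 2 / N * ((2 * B + 2 * C * S + 1) * (1 + 1 / r)) =
      2 * ((1 / N) * ((2 * B + 2 * C * S + 1) + (2 * B + 2 * C * S + 1) / r)) := by ring
    rw [h8]
    nlinarith
  have hsum := Finset.sum_le_sum fun s hs => hstep s (Finset.mem_range.1 hs)
  refine hsum.trans ?_
  rw [Finset.sum_add_distrib, ← Finset.mul_sum, Finset.sum_range_sub', Finset.sum_const,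
    Finset.card_range, nsmul_eq_mul]
  have h1 := mass_nonneg ((pairEvolve b₁ b₂)^[S] l) N
  have h2 := (mass_le_count l hN).trans (count_mono l (show N ≤ 2 * N + 2 by omega))
  have h3 : (S : ℝ) * (2 / N * ((2 * B + 2 * C * S + 1) * (1 + 1 / r))) =
    2 * S / N * ((2 * B + 2 * C * S + 1) * (1 + 1 / r)) := by ring
  rw [h3]
  have h4 : 2 * (mass ((pairEvolve b₁ b₂)^[0] l) N - mass ((pairEvolve b₁ b₂)^[S] l) N) ≤
      2 * B := by simp only [Function.iterate_zero, id_eq]; linarith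
  linarith

end AnnihilationRate

/-! ### Ordered stationary couplings from sparse discrepancies. -/

section OrderedCouplings

section Generic

variable {X Y : Type*} [MeasurableSpace X] [TopologicalSpace X] [CompactSpace X]
  [TopologicalSpace.MetrizableSpace X] [BorelSpace X] [MeasurableSpace Y] [TopologicalSpace Y]
  [CompactSpace Y] [TopologicalSpace.MetrizableSpace Y] [BorelSpace Y]

/-- Limits of time averages are stationary. -/
lemma IsFeller.fixed_of_timeAverage {A : Measure X → Measure X} (hA : IsFeller A)
    {μs : ℕ → Measure X} (hs : ∀ k, IsProbabilityMeasure (μs k)) {S : ℕ → ℕ} (hS : ∀ k, k < S k)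
    {μ : Measure X} (hμ : IsProbabilityMeasure μ)
    (h : WeakLim (hyperfilter ℕ) (fun k => avgMeasure (Finset.range (S k)) fun s => A^[s] (μs k)) μ) :
    A μ = μ := by
  have hp : ∀ k s, IsProbabilityMeasure (A^[s] (μs k)) := fun k s => (hA.iterate s).isProb _ (hs k)
  have hne : ∀ k, (Finset.range (S k)).Nonempty := fun k =>
    Finset.nonempty_range_iff.2 (by have := hS k; omega)
  refine hA.fixed_of_weakLim (fun k => isProbabilityMeasure_avgMeasure (hne k) (hp k)) hμ h
    fun f hf => ?_
  obtain ⟨C, hC0, hC⟩ := exists_abs_le_of_continuous hf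
  have hint : ∀ k s, |∫ x, f x ∂(A^[s] (μs k))| ≤ C := fun k s => by
    have := hp k s
    have := norm_integral_le_of_norm_le_const (f := f) (μ := A^[s] (μs k)) (ae_of_all _ hC)
    simpa using this
  refine Tendsto.mono_left ?_ Nat.hyperfilter_le_atTop
  refine squeeze_zero_norm (a := fun k : ℕ => 2 * C * (1 / ((k : ℝ) + 1))) (fun k => ?_) (by
    simpa using tendsto_one_div_add_atTop_nhds_zero_nat.const_mul (2 * C))
  rw [hA.integral_avgMeasure (hne k) (hp k) hf, S6V.integral_avgMeasure _
    (fun s _ => have := hp k s; integrable_of_continuous hf _), ← mul_sub,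
    ← Finset.sum_sub_distrib]
  simp only [← Function.iterate_succ_apply' A]
  -- The sum telescopes to two terms of size at most `C`, divided by `S k > k`.
  rw [Finset.sum_range_sub (fun s => ∫ x, f x ∂(A^[s] (μs k))), Finset.card_range, norm_mul,
    norm_inv, mul_comm]
  have hk : (k : ℝ) + 1 ≤ S k := by exact_mod_cast hS k
  have hk0 : (0 : ℝ) ≤ k := Nat.cast_nonneg k
  rw [Real.norm_natCast, one_div]
  gcongr
  refine (norm_sub_le _ _).trans ?_
  have h1 := hint k (S k)
  have h2 := hint k 0
  simp only [Real.norm_eq_abs]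
  linarith

lemma WeakLim.map_eq {g : X → Y} (hg : Continuous g) {ν : Measure Y} [IsFiniteMeasure ν]
    {ι : Type*} {F : Filter ι} [F.NeBot] {μs : ι → Measure X} {μ : Measure X} [IsFiniteMeasure μ]
    (h : WeakLim F μs μ)
    (hm : ∀ i, ∀ f : Y → ℝ, Continuous f → ∫ x, f (g x) ∂(μs i) = ∫ y, f y ∂ν) : μ.map g = ν := by
  refine ext_of_integral_continuous fun f hf => ?_
  rw [integral_map hg.measurable.aemeasurable hf.measurable.aestronglyMeasurable]
  have h1 := h _ (hf.comp hg)
  simp only [Function.comp_def, hm _ f hf] at h1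
  exact tendsto_nhds_unique h1 tendsto_const_nhds

lemma integral_comp_avgMeasure_eq {g : X → Y} (hg : Continuous g) {ν : Measure Y} {ι : Type*}
    {s : Finset ι} (hs : s.Nonempty) {μ : ι → Measure X} (h : ∀ i, IsProbabilityMeasure (μ i))
    (hm : ∀ i, (μ i).map g = ν) {f : Y → ℝ} (hf : Continuous f) :
    ∫ x, f (g x) ∂(avgMeasure s μ) = ∫ y, f y ∂ν := by
  have hc : Continuous fun x => f (g x) := hf.comp hg
  rw [integral_avgMeasure _ (fun i _ => integrable_of_continuous hc _)]
  have : ∀ i, ∫ x, f (g x) ∂(μ i) = ∫ y, f y ∂ν := fun i => by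
    rw [← hm i, integral_map hg.measurable.aemeasurable hf.measurable.aestronglyMeasurable]
  simp only [this, Finset.sum_const, nsmul_eq_mul]
  rw [← mul_assoc, inv_mul_cancel₀, one_mul]
  exact_mod_cast hs.card_pos.ne'

end Generic

variable {b₁ b₂ : I}

lemma isFeller_pairEvolve (h₁ : b₁ < 1) (h₂ : b₂ < 1) : IsFeller (pairEvolve b₁ b₂) := by
  refine isFeller_evolve measurable_pairStep ?_
  filter_upwards [ae_manyResets h₁ h₂] with u hu using continuous_pairStep hu

/-- Averaging over the coins makes the annihilation at `x` a continuous function of the pair, so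
that its rate passes to weak limits. -/
lemma exists_continuous_annRate (h₁ : b₁ < 1) (h₂ : b₂ < 1) (x : ℤ) :
    ∃ G : Config × Config → ℝ, Continuous G ∧ ∀ l, IsProbabilityMeasure l →
      annRate b₁ b₂ l x = ∫ p, G p ∂l := by
  refine ⟨fun p => ∫ u, ann p u x ∂(siteNoiseLaw b₁ b₂),
    continuous_integral_noise (measurable_ann x) (fun p u => abs_ann_le p u x) ?_, fun l hl =>
    integral_prod_noise (g := fun p u => ann p u x) (measurable_ann x)
      (fun p u => abs_ann_le p u x) l⟩
  filter_upwards [ae_manyResets h₁ h₂] with u hu using continuous_ann hu x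

lemma pairEvolve_map_fst (l : Measure (Config × Config)) [IsProbabilityMeasure l] (t : ℕ) :
    ((pairEvolve b₁ b₂)^[t] l).map Prod.fst = (siteEvolve b₁ b₂)^[t] (l.map Prod.fst) :=
  (evolve_iterate_map measurable_pairStep measurable_siteStep measurable_fst
    (MeasurePreserving.id _) (fun _ _ => rfl) l t).symm

lemma pairEvolve_map_snd (l : Measure (Config × Config)) [IsProbabilityMeasure l] (t : ℕ) :
    ((pairEvolve b₁ b₂)^[t] l).map Prod.snd = (siteEvolve b₁ b₂)^[t] (l.map Prod.snd) :=
  (evolve_iterate_map measurable_pairStep measurable_siteStep measurable_snd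
    (MeasurePreserving.id _) (fun _ _ => rfl) l t).symm

/-- `l` is a stationary coupling of `α` and `β`. -/
structure IsStationaryCoupling (b₁ b₂ : I) (α β : Measure Config)
    (l : Measure (Config × Config)) : Prop where
  isProb : IsProbabilityMeasure l
  map_fst : l.map Prod.fst = α
  map_snd : l.map Prod.snd = β
  stationary : pairEvolve b₁ b₂ l = l

/-- Limits of time averages of couplings are stationary couplings. -/
lemma exists_stationaryCoupling (h₁ : b₁ < 1) (h₂ : b₂ < 1) {α β : Measure Config}
    (hα : siteEvolve b₁ b₂ α = α) (hβ : siteEvolve b₁ b₂ β = β)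
    {ls : ℕ → Measure (Config × Config)} (hs : ∀ k, IsProbabilityMeasure (ls k))
    (hsα : ∀ k, (ls k).map Prod.fst = α) (hsβ : ∀ k, (ls k).map Prod.snd = β)
    {S : ℕ → ℕ} (hS : ∀ k, k < S k) :
    ∃ l, IsStationaryCoupling b₁ b₂ α β l ∧ WeakLim (hyperfilter ℕ) (fun k =>
      avgMeasure (Finset.range (S k)) fun s => (pairEvolve b₁ b₂)^[s] (ls k)) l := by
  have hne : ∀ k, (Finset.range (S k)).Nonempty := fun k =>
    Finset.nonempty_range_iff.2 (by have := hS k; omega)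
  have hp : ∀ k s, IsProbabilityMeasure ((pairEvolve b₁ b₂)^[s] (ls k)) := fun k s =>
    isProbabilityMeasure_pairEvolve_iterate b₁ b₂ (ls k) s
  obtain ⟨l, hl, hlim⟩ := exists_weakLim (hyperfilter ℕ) (fun k =>
      avgMeasure (Finset.range (S k)) fun s => (pairEvolve b₁ b₂)^[s] (ls k))
      (fun k => isProbabilityMeasure_avgMeasure (hne k) (hp k))
  have hPα : IsProbabilityMeasure α := by
    rw [← hsα 0]; exact Measure.isProbabilityMeasure_map measurable_fst.aemeasurable
  have hPβ : IsProbabilityMeasure β := by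
    rw [← hsβ 0]; exact Measure.isProbabilityMeasure_map measurable_snd.aemeasurable
  refine ⟨l, ⟨hl, ?_, ?_, ?_⟩, hlim⟩
  · refine hlim.map_eq continuous_fst fun k f hf => ?_
    refine integral_comp_avgMeasure_eq continuous_fst (hne k) (hp k) (fun s => ?_) hf
    rw [pairEvolve_map_fst, hsα]
    exact Function.iterate_fixed hα s
  · refine hlim.map_eq continuous_snd fun k f hf => ?_
    refine integral_comp_avgMeasure_eq continuous_snd (hne k) (hp k) (fun s => ?_) hf
    rw [pairEvolve_map_snd, hsβ]
    exact Function.iterate_fixed hβ s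
  · exact (isFeller_pairEvolve h₁ h₂).fixed_of_timeAverage hs hS hl hlim

lemma tendsto_annRate (h₁ : b₁ < 1) (h₂ : b₂ < 1) {ls : ℕ → Measure (Config × Config)}
    (hs : ∀ k, IsProbabilityMeasure (ls k)) {S : ℕ → ℕ}
    {l : Measure (Config × Config)} (hl : IsProbabilityMeasure l)
    (h : WeakLim (hyperfilter ℕ) (fun k =>
      avgMeasure (Finset.range (S k)) fun s => (pairEvolve b₁ b₂)^[s] (ls k)) l) (x : ℤ) :
    Tendsto (fun k => (S k : ℝ)⁻¹ * ∑ s ∈ Finset.range (S k),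
      annRate b₁ b₂ ((pairEvolve b₁ b₂)^[s] (ls k)) x) (hyperfilter ℕ)
      (𝓝 (annRate b₁ b₂ l x)) := by
  obtain ⟨G, hG, hG'⟩ := exists_continuous_annRate h₁ h₂ x
  have hp : ∀ k s, IsProbabilityMeasure ((pairEvolve b₁ b₂)^[s] (ls k)) := fun k s =>
    isProbabilityMeasure_pairEvolve_iterate b₁ b₂ (ls k) s
  have := h G hG
  rw [hG' l hl]
  refine this.congr fun k => ?_
  rw [integral_avgMeasure _ (fun s _ => have := hp k s; integrable_of_continuous hG _),
    Finset.card_range]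
  simp only [fun s => hG' _ (hp k s)]

/-- Take `S` of order `θ * N`. Divided by `S`, the bound of `sum_annRate_le` is of order `ε / θ + (ε
+ C * θ) * R + 1 / N`. So `θ` is chosen first, then `ε`, and `N` at the end. -/
lemma exists_times_annRate_le (h₁ : b₁ < 1) (h₂ : b₂ < 1) {l₀ : Measure (Config × Config)}
    [IsProbabilityMeasure l₀]
    (h : ∀ ε > 0, ∃ T, ∃ᶠ N : ℕ in atTop, count ((pairEvolve b₁ b₂)^[T] l₀) (2 * N + 2) ≤ ε * N)
    (k : ℕ) : ∃ T S : ℕ, k < S ∧ ∀ x : ℤ, |x| ≤ k →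
      (S : ℝ)⁻¹ * ∑ s ∈ Finset.range S,
        annRate b₁ b₂ ((pairEvolve b₁ b₂)^[s] ((pairEvolve b₁ b₂)^[T] l₀)) x ≤
        1 / ((k : ℝ) + 1) := by
  have hr := resetProb_pos h₁ h₂
  set δ : ℝ := 1 / ((k : ℝ) + 1)
  have hδ : 0 < δ := by positivity
  set R := 1 + 1 / resetProb b₁ b₂
  have hR : 0 < R := by positivity
  set C := 5 + 6 / resetProb b₁ b₂
  have hC : 0 < C := by positivity
  -- The target `δ` is split into four quarters: one for `2 * ε / θ`, one for `4 * C * θ * R`, one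
  -- for `4 * ε * R`, and one for the terms of order `1 / N`.
  set θ := δ / (16 * C * R)
  have hθ : 0 < θ := by positivity
  have hθ' : 4 * C * θ * R = δ / 4 := by simp only [θ]; field_simp; norm_num
  set ε := min (δ * θ / 8) (δ / (16 * R))
  have hε : 0 < ε := by positivity
  have hε1 : 2 * ε ≤ δ / 4 * θ := by
    have := min_le_left (δ * θ / 8) (δ / (16 * R))
    simp only [ε]; linarith
  have hε2 : 4 * ε * R ≤ δ / 4 := by
    have h := min_le_right (δ * θ / 8) (δ / (16 * R))
    rw [le_div_iff₀ (by positivity)] at h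
    simp only [ε]; linarith
  obtain ⟨T, hT⟩ := h ε hε
  -- These conditions put `|x| ≤ k` under the upper half of the tent, ensure `k < S`, and make the
  -- rounding of `θ * N` negligible.
  have hlarge : ∀ᶠ N : ℕ in atTop, 2 * k ≤ N ∧ 1 ≤ N ∧ (k : ℝ) / θ < N ∧
      (4 * C + 2) * R / (δ / 4) ≤ N :=
    (eventually_ge_atTop _).and ((eventually_ge_atTop _).and
      ((tendsto_natCast_atTop_atTop.eventually_gt_atTop _).and
      (tendsto_natCast_atTop_atTop.eventually_ge_atTop _)))
  obtain ⟨N, hN, hN1, hN2, hN3, hN4⟩ := (hT.and_eventually hlarge).exists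
  have hN0 : (0 : ℝ) < N := by exact_mod_cast hN2
  have hNθ : (k : ℝ) < θ * N := by
    rw [div_lt_iff₀ hθ] at hN3; linarith
  have hSk : k < ⌈θ * N⌉₊ := Nat.lt_ceil.2 hNθ
  refine ⟨T, ⌈θ * N⌉₊, hSk, fun x hx => ?_⟩
  set S := ⌈θ * N⌉₊
  have hS1 : θ * N ≤ S := Nat.le_ceil _
  have hS2 : (S : ℝ) ≤ θ * N + 1 := (Nat.ceil_lt_add_one (by positivity)).le
  have hS0 : (0 : ℝ) < S := by exact_mod_cast (Nat.zero_le k).trans_lt hSk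
  have := isProbabilityMeasure_pairEvolve_iterate b₁ b₂ l₀ T
  have hmain := sum_annRate_le ((pairEvolve b₁ b₂)^[T] l₀) h₁ h₂ (N := N) (by omega) S (x := x)
    (by omega)
  set B := count ((pairEvolve b₁ b₂)^[T] l₀) (2 * N + 2)
  rw [inv_mul_le_iff₀ hS0]
  refine hmain.trans ?_
  have hN5 : (4 * C + 2) * R ≤ δ / 4 * N := by
    rw [div_le_iff₀ (by positivity)] at hN4; linarith
  have e1 : 2 * B ≤ S * (δ / 4) := by
    calc 2 * B ≤ 2 * (ε * N) := by linarith
      _ = (2 * ε) * N := by ring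
      _ ≤ (δ / 4 * θ) * N := by gcongr
      _ = (δ / 4) * (θ * N) := by ring
      _ ≤ (δ / 4) * S := by gcongr
      _ = _ := mul_comm _ _
  have e2 : 2 * ((2 * B + 2 * C * S + 1) * R) ≤ δ * (3 / 4) * N := by
    calc 2 * ((2 * B + 2 * C * S + 1) * R)
        ≤ 2 * ((2 * (ε * N) + 2 * C * (θ * N + 1) + 1) * R) := by gcongr
      _ = (4 * ε * R) * N + (4 * C * θ * R) * N + (4 * C + 2) * R := by ring
      _ ≤ (δ / 4) * N + (δ / 4) * N + (δ / 4) * N := by rw [hθ']; gcongr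
      _ = _ := by ring
  have e3 : 2 * S / N * ((2 * B + 2 * C * S + 1) * R) ≤ S * (δ * (3 / 4)) := by
    have : 2 * S / N * ((2 * B + 2 * C * S + 1) * R) =
      S * (2 * ((2 * B + 2 * C * S + 1) * R) / N) := by ring
    rw [this]
    gcongr
    rw [div_le_iff₀ hN0]
    exact e2
  calc _ ≤ S * (δ / 4) + S * (δ * (3 / 4)) := add_le_add e1 e3
    _ = S * δ := by ring

/-- If the density of positive discrepancies eventually becomes small, then there is an ordered
stationary coupling. -/
lemma exists_ordered_of_count_le (hb₁ : 0 < b₁) (h₁ : b₁ < 1) (hb₂ : 0 < b₂) (h₂ : b₂ < 1)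
    {α β : Measure Config} (hα : siteEvolve b₁ b₂ α = α) (hβ : siteEvolve b₁ b₂ β = β)
    {l₀ : Measure (Config × Config)} [IsProbabilityMeasure l₀] (hlα : l₀.map Prod.fst = α)
    (hlβ : l₀.map Prod.snd = β)
    (h : ∀ ε > 0, ∃ T, ∃ᶠ N : ℕ in atTop, count ((pairEvolve b₁ b₂)^[T] l₀) (2 * N + 2) ≤ ε * N) :
    ∃ l, IsStationaryCoupling b₁ b₂ α β l ∧ ∀ᵐ p ∂l, p.1 ≤ p.2 ∨ p.2 ≤ p.1 := by
  choose T S hS hle using exists_times_annRate_le h₁ h₂ h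
  have hp := fun k => isProbabilityMeasure_pairEvolve_iterate b₁ b₂ l₀ (T k)
  obtain ⟨l, hl, hlim⟩ := exists_stationaryCoupling h₁ h₂ hα hβ
    (ls := fun k => (pairEvolve b₁ b₂)^[T k] l₀) hp
    (fun k => by rw [pairEvolve_map_fst, hlα]; exact Function.iterate_fixed hα _)
    (fun k => by rw [pairEvolve_map_snd, hlβ]; exact Function.iterate_fixed hβ _) hS
  have := hl.isProb
  refine ⟨l, hl, ae_ordered hb₁ h₁ hb₂ h₂ hl.stationary fun x => ?_⟩
  refine le_antisymm ?_ (annRate_nonneg b₁ b₂ l x)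
  have h3 := tendsto_annRate h₁ h₂ hp hl.isProb hlim x
  have h4 : Tendsto (fun k : ℕ => 1 / ((k : ℝ) + 1)) (hyperfilter ℕ) (𝓝 0) :=
    tendsto_one_div_add_atTop_nhds_zero_nat.mono_left Nat.hyperfilter_le_atTop
  refine le_of_tendsto_of_tendsto h3 h4 ?_
  filter_upwards [Nat.hyperfilter_le_atTop (eventually_ge_atTop x.natAbs)] with k hk
  refine hle k x ?_
  have : (x.natAbs : ℤ) ≤ k := by exact_mod_cast hk
  rwa [Int.natCast_natAbs] at this

end OrderedCouplings

/-! ### Translation invariant couplings and averages over translates. -/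

section TranslationInvariantCouplings

/-- The shift of both marginals of a coupling. -/
def pairShift (n : ℤ) (p : Config × Config) : Config × Config := (shift n p.1, shift n p.2)

lemma continuous_pairShift (n : ℤ) : Continuous (pairShift n) :=
  ((continuous_shift n).comp continuous_fst).prodMk ((continuous_shift n).comp continuous_snd)

lemma measurable_pairShift (n : ℤ) : Measurable (pairShift n) := (continuous_pairShift n).measurable

lemma shift_shift (m n : ℤ) (η : Config) : shift m (shift n η) = shift (n + m) η := by
  ext x; simp only [shift]; congr 1; ring

lemma pairShift_pairShift (m n : ℤ) (p : Config × Config) :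
    pairShift m (pairShift n p) = pairShift (n + m) p := by
  simp only [pairShift, shift_shift]

variable {b₁ b₂ : I}

lemma isProbabilityMeasure_map_pairShift (l : Measure (Config × Config)) [IsProbabilityMeasure l]
    (n : ℤ) : IsProbabilityMeasure (l.map (pairShift n)) :=
  Measure.isProbabilityMeasure_map (measurable_pairShift n).aemeasurable

lemma pairEvolve_map_pairShift (l : Measure (Config × Config)) [IsProbabilityMeasure l] (n : ℤ)
    (t : ℕ) : (pairEvolve b₁ b₂)^[t] (l.map (pairShift n)) =
      ((pairEvolve b₁ b₂)^[t] l).map (pairShift n) :=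
  evolve_iterate_map measurable_pairStep measurable_pairStep (measurable_pairShift n)
    (measurePreserving_shiftNoise b₁ b₂ n)
    (fun p u => by simp only [pairStep, pairShift, siteStep_shift]) l t

lemma siteEvolve_map_shift (μ : Measure Config) [IsProbabilityMeasure μ] (n : ℤ) :
    siteEvolve b₁ b₂ (μ.map (shift n)) = (siteEvolve b₁ b₂ μ).map (shift n) :=
  evolve_map measurable_siteStep measurable_siteStep (measurable_shift n)
    (measurePreserving_shiftNoise b₁ b₂ n) (fun p u => (siteStep_shift n p u).symm) μ

lemma dens_map_pairShift (l : Measure (Config × Config)) (n x : ℤ) :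
    dens (l.map (pairShift n)) x = dens l (x + n) := by
  have hm : Measurable fun p => ind (plus p x) := measurable_ind.comp (measurable_plus x)
  rw [dens, integral_map (measurable_pairShift n).aemeasurable hm.aestronglyMeasurable]
  rfl

lemma horDens_map_pairShift (l : Measure (Config × Config)) [IsProbabilityMeasure l] (n x : ℤ) :
    horDens b₁ b₂ (l.map (pairShift n)) x = horDens b₁ b₂ l (x + n) := by
  have hk := measurePreserving_shiftNoise b₁ b₂ n
  rw [horDens]
  conv_lhs => rw [← hk.map_eq, Measure.map_prod_map _ _ (measurable_pairShift n) hk.measurable]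
  have hm : Measurable fun q : (Config × Config) × SiteNoise => ind (horPlus q.1 q.2 x) :=
    measurable_ind.comp (measurable_horPlus x)
  rw [integral_map ((measurable_pairShift n).prodMap hk.measurable).aemeasurable
    hm.aestronglyMeasurable]
  simp only [horPlus, Prod.map_fst, Prod.map_snd, pairShift, hor_shift]
  rfl

lemma eq_zero_of_shift_invariant {f : ℤ → ℝ} (h : ∀ x, f (x + 1) = f x) (x : ℤ) : f x = f 0 := by
  induction x using Int.induction_on with
  | zero => rfl
  | succ n ih => rw [h, ih]
  | pred n ih => rw [← ih, ← h (-(n : ℤ) - 1)]; simp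

lemma dens_eq_of_invariant {l : Measure (Config × Config)} (h : l.map (pairShift 1) = l) (x : ℤ) :
    dens l x = dens l 0 :=
  eq_zero_of_shift_invariant (fun x => by
    conv_rhs => rw [← h]
    rw [dens_map_pairShift]) x

lemma horDens_eq_of_invariant {l : Measure (Config × Config)} [IsProbabilityMeasure l]
    (h : l.map (pairShift 1) = l) (x : ℤ) : horDens b₁ b₂ l x = horDens b₁ b₂ l 0 :=
  eq_zero_of_shift_invariant (fun x => by
    conv_rhs => rw [← h]
    rw [horDens_map_pairShift]) x

lemma pairEvolve_invariant {l : Measure (Config × Config)} [IsProbabilityMeasure l]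
    (h : l.map (pairShift 1) = l) (t : ℕ) :
    ((pairEvolve b₁ b₂)^[t] l).map (pairShift 1) = (pairEvolve b₁ b₂)^[t] l := by
  rw [← pairEvolve_map_pairShift, h]

/-- By invariance the horizontal terms of the balance equation cancel. Annihilation is the loss of
density, so its sum over time telescopes and stays at most `1`. -/
lemma annRate_eq_of_invariant {l : Measure (Config × Config)} [IsProbabilityMeasure l]
    (h : l.map (pairShift 1) = l) (x : ℤ) :
    annRate b₁ b₂ l x = dens l 0 - dens (pairEvolve b₁ b₂ l) 0 := by
  have := pairEvolve_invariant (b₁ := b₁) (b₂ := b₂) h 1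
  rw [annRate_eq, horDens_eq_of_invariant h x, horDens_eq_of_invariant h (x - 1),
    dens_eq_of_invariant h x, dens_eq_of_invariant (l := pairEvolve b₁ b₂ l) this]
  ring

/-- Limits of time averages of translation invariant couplings are translation invariant, without
annihilation. -/
lemma timeLimit_invariant (h₁ : b₁ < 1) (h₂ : b₂ < 1) {l₀ l : Measure (Config × Config)}
    [IsProbabilityMeasure l₀] [IsProbabilityMeasure l] (h₀ : l₀.map (pairShift 1) = l₀)
    (h : WeakLim (hyperfilter ℕ) (fun k =>
      avgMeasure (Finset.range (k + 1)) fun s => (pairEvolve b₁ b₂)^[s] l₀) l) :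
    l.map (pairShift 1) = l ∧ ∀ x, annRate b₁ b₂ l x = 0 := by
  have hp := isProbabilityMeasure_pairEvolve_iterate b₁ b₂ l₀
  have hne : ∀ k, (Finset.range (k + 1)).Nonempty := fun k => Finset.nonempty_range_add_one
  have hF := isFeller_map (continuous_pairShift 1)
  constructor
  · refine hF.fixed_of_weakLim (fun k => isProbabilityMeasure_avgMeasure (hne k) hp) inferInstance
      h fun f hf => ?_
    have : ∀ k, ∫ x, f x ∂((avgMeasure (Finset.range (k + 1)) fun s =>
        (pairEvolve b₁ b₂)^[s] l₀).map (pairShift 1)) - ∫ x, f x ∂(avgMeasure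
        (Finset.range (k + 1)) fun s => (pairEvolve b₁ b₂)^[s] l₀) = 0 := fun k => by
      rw [hF.integral_avgMeasure (hne k) hp hf, integral_avgMeasure _
        (fun s _ => have := hp s; integrable_of_continuous hf _)]
      simp only [pairEvolve_invariant h₀, sub_self]
    simp only [this]
    exact tendsto_const_nhds
  · intro x
    refine le_antisymm ?_ (annRate_nonneg b₁ b₂ l x)
    have h3 := tendsto_annRate h₁ h₂ (ls := fun _ => l₀) (fun _ => inferInstance)
      (S := fun k => k + 1) inferInstance h x
    have h4 : Tendsto (fun k : ℕ => 1 / ((k : ℝ) + 1)) (hyperfilter ℕ) (𝓝 0) :=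
      tendsto_one_div_add_atTop_nhds_zero_nat.mono_left Nat.hyperfilter_le_atTop
    refine le_of_tendsto_of_tendsto' h3 h4 fun k => ?_
    have e : ∀ s, annRate b₁ b₂ ((pairEvolve b₁ b₂)^[s] l₀) x =
        dens ((pairEvolve b₁ b₂)^[s] l₀) 0 - dens ((pairEvolve b₁ b₂)^[s + 1] l₀) 0 := fun s => by
      have := hp s
      rw [annRate_eq_of_invariant (pairEvolve_invariant h₀ s), ← Function.iterate_succ_apply' (pairEvolve b₁ b₂)]
    simp only [e, Finset.sum_range_sub']
    have e1 := dens_nonneg ((pairEvolve b₁ b₂)^[k + 1] l₀) 0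
    have e2 := dens_le_one ((pairEvolve b₁ b₂)^[0] l₀) 0
    push_cast
    rw [one_div]
    exact mul_le_of_le_one_right (by positivity) (by linarith)

/-- The density of particles in `[0, M)`. -/
def avgOcc (M : ℕ) (η : Config) : ℝ := (M : ℝ)⁻¹ * ∑ i ∈ Finset.range M, ind (η i)

lemma continuous_avgOcc (M : ℕ) : Continuous (avgOcc M) :=
  continuous_const.mul (continuous_finsetSum _ fun i _ =>
    continuous_ind.comp (continuous_apply (i : ℤ)))

/-- The positive part of the difference of the two densities in `[0, M)`. -/
def excess (M : ℕ) (p : Config × Config) : ℝ := max 0 (avgOcc M p.1 - avgOcc M p.2)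

lemma continuous_excess (M : ℕ) : Continuous (excess M) :=
  continuous_const.max (((continuous_avgOcc M).comp continuous_fst).sub
    ((continuous_avgOcc M).comp continuous_snd))

lemma ind_mono {a b : Bool} (h : a ≤ b) : ind a ≤ ind b := by
  revert h; cases a <;> cases b <;> simp

/-- All discrepancies of an ordered pair have the same sign. Hence the positive part of the
difference of the densities counts the positive ones without cancellation. -/
lemma excess_of_ordered (M : ℕ) {p : Config × Config} (h : p.1 ≤ p.2 ∨ p.2 ≤ p.1) :
    excess M p = (M : ℝ)⁻¹ * ∑ i ∈ Finset.range M, ind (plus p i) := by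
  rcases h with h | h
  · have h1 : avgOcc M p.1 ≤ avgOcc M p.2 :=
      mul_le_mul_of_nonneg_left (Finset.sum_le_sum fun i _ => ind_mono (h i)) (by positivity)
    have h2 : ∀ i : ℕ, ind (plus p i) = 0 := fun i => by
      have h2 := h i
      revert h2
      simp only [plus]
      cases p.1 i <;> cases p.2 i <;> simp
    rw [excess, max_eq_left (by linarith)]
    simp [h2]
  · have h1 : avgOcc M p.2 ≤ avgOcc M p.1 :=
      mul_le_mul_of_nonneg_left (Finset.sum_le_sum fun i _ => ind_mono (h i)) (by positivity)
    rw [excess, max_eq_right (by linarith), avgOcc, avgOcc, ← mul_sub, ← Finset.sum_sub_distrib]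
    congr 1
    refine Finset.sum_congr rfl fun i _ => ?_
    have h2 := h i
    revert h2
    simp only [plus]
    cases p.1 i <;> cases p.2 i <;> simp

lemma integral_excess_of_ordered {l : Measure (Config × Config)} [IsProbabilityMeasure l]
    (hinv : l.map (pairShift 1) = l) (hord : ∀ᵐ p ∂l, p.1 ≤ p.2 ∨ p.2 ≤ p.1) {M : ℕ} (hM : 0 < M) :
    ∫ p, excess M p ∂l = dens l 0 := by
  have e : ∫ p, excess M p ∂l = ∫ p, (M : ℝ)⁻¹ * ∑ i ∈ Finset.range M, ind (plus p i) ∂l :=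
    integral_congr_ae (hord.mono fun p hp => excess_of_ordered M hp)
  have hi : ∀ i ∈ Finset.range M, Integrable (fun p => ind (plus p (i : ℤ))) l := fun i _ =>
    integrable_ind (measurable_plus i) l
  rw [e, integral_const_mul, integral_finsetSum _ hi]
  have h2 : ∀ i : ℕ, ∫ p, ind (plus p i) ∂l = dens l 0 := fun i => dens_eq_of_invariant hinv i
  simp only [h2, Finset.sum_const, Finset.card_range, nsmul_eq_mul]
  rw [← mul_assoc, inv_mul_cancel₀ (by exact_mod_cast hM.ne'), one_mul]

/-- If two translation invariant configurations have ordered densities, at all times, then the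
positive discrepancies disappear. -/
lemma exists_dens_le (hb₁ : 0 < b₁) (h₁ : b₁ < 1) (hb₂ : 0 < b₂) (h₂ : b₂ < 1)
    {l₀ : Measure (Config × Config)} [IsProbabilityMeasure l₀] (h₀ : l₀.map (pairShift 1) = l₀)
    (h : ∀ ε > 0, ∃ M : ℕ, 0 < M ∧ ∀ t, ∫ p, excess M p ∂((pairEvolve b₁ b₂)^[t] l₀) ≤ ε)
    {ε : ℝ} (hε : 0 < ε) : ∃ T, dens ((pairEvolve b₁ b₂)^[T] l₀) 0 ≤ ε := by
  have hp := isProbabilityMeasure_pairEvolve_iterate b₁ b₂ l₀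
  have hne : ∀ k, (Finset.range (k + 1)).Nonempty := fun k => Finset.nonempty_range_add_one
  obtain ⟨l, hl, hlim⟩ := exists_weakLim (hyperfilter ℕ) (fun k =>
      avgMeasure (Finset.range (k + 1)) fun s => (pairEvolve b₁ b₂)^[s] l₀)
      (fun k => isProbabilityMeasure_avgMeasure (hne k) hp)
  have hst : pairEvolve b₁ b₂ l = l := (isFeller_pairEvolve h₁ h₂).fixed_of_timeAverage
    (μs := fun _ => l₀) (fun _ => inferInstance) (S := fun k => k + 1) (fun k => k.lt_succ_self)
    hl hlim
  obtain ⟨hinv, hann⟩ := timeLimit_invariant h₁ h₂ h₀ hlim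
  have hord := ae_ordered hb₁ h₁ hb₂ h₂ hst hann
  have havg : ∀ (f : Config × Config → ℝ), Continuous f → ∀ k : ℕ,
      ∫ p, f p ∂(avgMeasure (Finset.range (k + 1)) fun s => (pairEvolve b₁ b₂)^[s] l₀) =
      ((k : ℝ) + 1)⁻¹ * ∑ s ∈ Finset.range (k + 1), ∫ p, f p ∂((pairEvolve b₁ b₂)^[s] l₀) := by
    intro f hf k
    rw [integral_avgMeasure _ (fun s _ => have := hp s; integrable_of_continuous hf _),
      Finset.card_range]
    push_cast
    rfl
  -- The bound on the excess is uniform in time, hence survives in the limit `l`. There the order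
  -- turns the excess into the density of positive discrepancies.
  have hd0 : dens l 0 ≤ ε / 2 := by
    obtain ⟨M, hM, hle⟩ := h (ε / 2) (by positivity)
    rw [← integral_excess_of_ordered hinv hord hM]
    refine le_of_tendsto' (hlim _ (continuous_excess M)) fun k => ?_
    rw [havg _ (continuous_excess M), inv_mul_le_iff₀ (by positivity)]
    refine (Finset.sum_le_card_nsmul _ _ _ fun s _ => hle s).trans ?_
    rw [Finset.card_range, nsmul_eq_mul]
    push_cast
    exact le_rfl
  -- If the density exceeded `ε` at all times, its time averages would force `ε ≤ dens l 0`.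
  by_contra hcon
  push Not at hcon
  have hc : Continuous fun p : Config × Config => ind (plus p 0) :=
    continuous_ind.comp (continuous_plus 0)
  have : ε ≤ dens l 0 := by
    refine ge_of_tendsto' (hlim _ hc) fun k => ?_
    rw [havg _ hc, le_inv_mul_iff₀ (by positivity)]
    refine le_trans ?_ (Finset.card_nsmul_le_sum _ _ ε fun s _ => (hcon s).le)
    rw [Finset.card_range, nsmul_eq_mul]
    push_cast
    exact le_rfl
  linarith

/-- The average of the translates of a coupling over a large window. -/
def spatialAvg (l : Measure (Config × Config)) (N : ℕ) : Measure (Config × Config) :=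
  avgMeasure (Finset.Icc (-((2 * N + 2 : ℕ) : ℤ)) ((2 * N + 2 : ℕ) : ℤ)) fun x =>
    l.map (pairShift x)

lemma card_window (M : ℕ) : (Finset.Icc (-(M : ℤ)) M).card = 2 * M + 1 := by
  rw [Int.card_Icc]; omega

lemma window_nonempty (M : ℕ) : (Finset.Icc (-(M : ℤ)) M).Nonempty :=
  Finset.nonempty_Icc.2 (by omega)

lemma sum_Icc_succ_sub (F : ℤ → ℝ) (M : ℕ) :
    ∑ x ∈ Finset.Icc (-(M : ℤ)) M, (F (x + 1) - F x) = F (M + 1) - F (-M) := by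
  have h1 := sum_Icc_shift (fun x => F (x + 1)) (-(M : ℤ) + 1) (M + 1)
  simp only [sub_add_cancel, add_sub_cancel_right] at h1
  rw [Finset.sum_sub_distrib, ← h1,
    ← Finset.insert_Icc_add_one_left_eq_Icc (show -(M : ℤ) ≤ M by omega),
    ← Finset.insert_Icc_right_eq_Icc_add_one (show -(M : ℤ) + 1 ≤ M + 1 by omega),
    Finset.sum_insert (by simp), Finset.sum_insert (by simp)]
  ring

lemma spatialLimit_invariant {l₀ l : Measure (Config × Config)} [IsProbabilityMeasure l₀]
    [IsProbabilityMeasure l] (h : WeakLim (hyperfilter ℕ) (spatialAvg l₀) l) :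
    l.map (pairShift 1) = l := by
  have hp := isProbabilityMeasure_map_pairShift l₀
  have hF := isFeller_map (continuous_pairShift 1)
  refine hF.fixed_of_weakLim (fun k => isProbabilityMeasure_avgMeasure (window_nonempty _) hp)
    inferInstance h fun f hf => ?_
  obtain ⟨C, hC0, hC⟩ := exists_abs_le_of_continuous hf
  have hint : ∀ x, |∫ p, f p ∂(l₀.map (pairShift x))| ≤ C := fun x => by
    have := hp x
    have := norm_integral_le_of_norm_le_const (f := f) (μ := l₀.map (pairShift x)) (ae_of_all _ hC)
    simpa using this
  refine Tendsto.mono_left ?_ Nat.hyperfilter_le_atTop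
  refine squeeze_zero_norm (a := fun k : ℕ => 2 * C * (1 / ((k : ℝ) + 1))) (fun k => ?_) (by
    simpa using tendsto_one_div_add_atTop_nhds_zero_nat.const_mul (2 * C))
  set M := 2 * k + 2
  have e : ∀ x : ℤ, (l₀.map (pairShift x)).map (pairShift 1) = l₀.map (pairShift (x + 1)) :=
    fun x => by
      rw [Measure.map_map (measurable_pairShift 1) (measurable_pairShift x)]
      congr 1
      ext1 p
      exact pairShift_pairShift 1 x p
  rw [hF.integral_avgMeasure (window_nonempty _) hp hf, integral_avgMeasure _
    (fun x _ => have := hp x; integrable_of_continuous hf _), ← mul_sub]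
  simp only [e]
  set F : ℤ → ℝ := fun x => ∫ p, f p ∂(l₀.map (pairShift x))
  rw [← Finset.sum_sub_distrib, sum_Icc_succ_sub F, card_window, norm_mul, norm_inv, Real.norm_natCast, mul_comm, one_div]
  gcongr
  · refine (norm_sub_le _ _).trans ?_
    have h1 := hint (M + 1)
    have h2 := hint (-M)
    simp only [Real.norm_eq_abs, F]
    linarith
  · simp only [M]; push_cast; linarith

/-- By duality the density at time `T` is the integral of a continuous function at time `0`, so the
spatial limit `l` controls the window averages for `l₀`. The constant comes from `(4 * N + 5) * 2 *
ε ≤ 18 * ε * N`. -/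
lemma frequently_count_le (h₁ : b₁ < 1) (h₂ : b₂ < 1) {l₀ l : Measure (Config × Config)}
    [IsProbabilityMeasure l₀] [IsProbabilityMeasure l]
    (h : WeakLim (hyperfilter ℕ) (spatialAvg l₀) l) {T : ℕ} {ε : ℝ} (hε : 0 < ε)
    (hd : dens ((pairEvolve b₁ b₂)^[T] l) 0 ≤ ε) :
    ∃ᶠ N : ℕ in atTop, count ((pairEvolve b₁ b₂)^[T] l₀) (2 * N + 2) ≤ 18 * ε * N := by
  have hp := isProbabilityMeasure_map_pairShift l₀
  obtain ⟨G, hG, hG'⟩ := ((isFeller_pairEvolve h₁ h₂).iterate T).dual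
    (fun p => ind (plus p 0)) (continuous_ind.comp (continuous_plus 0))
  have hlim := h G hG
  have hlt : ∫ p, G p ∂l < 2 * ε := by
    rw [← hG' l inferInstance]
    have : ∫ p, ind (plus p 0) ∂((pairEvolve b₁ b₂)^[T] l) ≤ ε := hd
    linarith
  have hev := (hlim.eventually (gt_mem_nhds hlt)).and
    (Nat.hyperfilter_le_atTop (eventually_ge_atTop 1))
  refine (hev.frequently.filter_mono Nat.hyperfilter_le_atTop).mono ?_
  rintro N ⟨hN, hN1⟩
  rw [spatialAvg, integral_avgMeasure _ (fun x _ => have := hp x; integrable_of_continuous hG _),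
    card_window] at hN
  have e : ∀ x : ℤ, ∫ p, G p ∂(l₀.map (pairShift x)) = dens ((pairEvolve b₁ b₂)^[T] l₀) x := by
    intro x
    rw [← hG' _ (hp x), pairEvolve_map_pairShift]
    have := dens_map_pairShift ((pairEvolve b₁ b₂)^[T] l₀) x 0
    rw [zero_add] at this
    exact this
  simp only [e] at hN
  rw [inv_mul_lt_iff₀ (by positivity)] at hN
  have hN1' : (1 : ℝ) ≤ N := by exact_mod_cast hN1
  have : ((2 * (2 * N + 2) + 1 : ℕ) : ℝ) * (2 * ε) ≤ 18 * ε * N := by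
    push_cast
    nlinarith
  exact hN.le.trans this

/-- Two stationary measures have an ordered stationary coupling, as soon as the translates of some
coupling have a limit with ordered densities. -/
lemma exists_ordered_of_excess_le (hb₁ : 0 < b₁) (h₁ : b₁ < 1) (hb₂ : 0 < b₂) (h₂ : b₂ < 1)
    {α β : Measure Config} (hα : siteEvolve b₁ b₂ α = α) (hβ : siteEvolve b₁ b₂ β = β)
    {l₀ l : Measure (Config × Config)} [IsProbabilityMeasure l₀] [IsProbabilityMeasure l]
    (hlα : l₀.map Prod.fst = α) (hlβ : l₀.map Prod.snd = β)
    (hlim : WeakLim (hyperfilter ℕ) (spatialAvg l₀) l)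
    (h : ∀ ε > 0, ∃ M : ℕ, 0 < M ∧ ∀ t, ∫ p, excess M p ∂((pairEvolve b₁ b₂)^[t] l) ≤ ε) :
    ∃ l, IsStationaryCoupling b₁ b₂ α β l ∧ ∀ᵐ p ∂l, p.1 ≤ p.2 ∨ p.2 ≤ p.1 := by
  refine exists_ordered_of_count_le hb₁ h₁ hb₂ h₂ hα hβ hlα hlβ fun ε hε => ?_
  obtain ⟨T, hT⟩ := exists_dens_le hb₁ h₁ hb₂ h₂ (spatialLimit_invariant hlim) h
    (show 0 < ε / 18 by positivity)
  refine ⟨T, (frequently_count_le h₁ h₂ hlim (by positivity) hT).mono fun N hN => ?_⟩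
  calc _ ≤ _ := hN
    _ = ε * N := by ring

end TranslationInvariantCouplings

/-! ### Ergodic averages, and the coupling of a law with its translate. -/

section OrderedTranslates

/-- Von Neumann's ergodic theorem: time averages are a Cauchy sequence in mean. -/
lemma exists_integral_birkhoffAverage_sub_le {X : Type*} [MeasurableSpace X] {μ : Measure X}
    [IsProbabilityMeasure μ] {g : X → X} (hg : MeasurePreserving g μ μ) {f : X → ℝ}
    (hf : MemLp f 2 μ) {ε : ℝ} (hε : 0 < ε) : ∃ K, ∀ M ≥ K, ∀ N ≥ K,
      ∫ x, |birkhoffAverage ℝ g f M x - birkhoffAverage ℝ g f N x| ∂μ ≤ ε := by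
  have hk : ∀ k, MemLp (f ∘ g^[k]) 2 μ := fun k => hf.comp_measurePreserving (hg.iterate k)
  have hs : ∀ N, MemLp (birkhoffSum g f N) 2 μ := fun N =>
    memLp_finsetSum _ fun k _ => hk k
  have ha : ∀ N, MemLp (birkhoffAverage ℝ g f N) 2 μ := fun N =>
    (hs N).const_smul ((N : ℝ)⁻¹)
  set T := (Lp.compMeasurePreservingₗᵢ (E := ℝ) (p := 2) ℝ g hg).toContinuousLinearMap
  have hT : ∀ k, T^[k] (hf.toLp f) = (hk k).toLp _ := fun k => by
    have : (T : Lp ℝ 2 μ → Lp ℝ 2 μ) = Lp.compMeasurePreserving g hg := rfl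
    rw [this, Lp.compMeasurePreserving_iterate]
    exact Lp.toLp_compMeasurePreserving hf (hg.iterate k)
  have hTs : ∀ N, birkhoffSum T _root_.id N (hf.toLp f) = (hs N).toLp _ := by
    intro N
    induction N with
    | zero => simp only [birkhoffSum_zero']; exact (MemLp.toLp_zero _).symm
    | succ N ih =>
      rw [birkhoffSum_succ, ih, _root_.id, hT, ← MemLp.toLp_add]
      congr 1
      ext x
      simp [birkhoffSum_succ]
  have hTa : ∀ N, birkhoffAverage ℝ T _root_.id N (hf.toLp f) = (ha N).toLp _ := fun N => by
    rw [birkhoffAverage, hTs, ← MemLp.toLp_const_smul]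
    rfl
  have hlim := (T.tendsto_birkhoffAverage_orthogonalProjection
    (LinearIsometry.norm_toContinuousLinearMap_le _) (hf.toLp f)).cauchySeq
  obtain ⟨K, hK⟩ := Metric.cauchySeq_iff.1 hlim ε hε
  refine ⟨K, fun M hM N hN => ?_⟩
  have h1 := (hK M hM N hN).le
  rw [hTa, hTa, dist_eq_norm, ← MemLp.toLp_sub, Lp.norm_toLp] at h1
  refine le_trans ?_ h1
  have h2 := (ha M).sub (ha N)
  have e : ∫ x, |birkhoffAverage ℝ g f M x - birkhoffAverage ℝ g f N x| ∂μ =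
      (eLpNorm (birkhoffAverage ℝ g f M - birkhoffAverage ℝ g f N) 1 μ).toReal := by
    rw [eLpNorm_one_eq_lintegral_enorm, ← integral_norm_eq_lintegral_enorm h2.1]
    rfl
  rw [e]
  exact ENNReal.toReal_mono h2.2.ne (eLpNorm_le_eLpNorm_of_exponent_le (by norm_num) h2.1)

lemma shift_one_iterate (k : ℕ) (η : Config) : (shift 1)^[k] η = shift k η := by
  induction k with
  | zero => ext; simp [shift]
  | succ k ih => rw [Function.iterate_succ_apply', ih, shift_shift]; push_cast; rfl

lemma avgOcc_eq_birkhoffAverage (M : ℕ) (η : Config) :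
    avgOcc M η = birkhoffAverage ℝ (shift 1) (fun η : Config => ind (η 0)) M η := by
  simp [avgOcc, birkhoffAverage, birkhoffSum, shift_one_iterate, shift]

lemma exists_integral_avgOcc_sub_le {α : Measure Config} [IsProbabilityMeasure α]
    (h : α.map (shift 1) = α) {ε : ℝ} (hε : 0 < ε) : ∃ K, ∀ M ≥ K, ∀ N ≥ K,
      ∫ η, |avgOcc M η - avgOcc N η| ∂α ≤ ε := by
  simp only [avgOcc_eq_birkhoffAverage]
  refine exists_integral_birkhoffAverage_sub_le ⟨measurable_shift 1, h⟩ ?_ hε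
  exact MemLp.of_bound (measurable_ind.comp (measurable_pi_apply 0)).aestronglyMeasurable 1
    (ae_of_all _ fun η => abs_ind_le _)

lemma abs_avgOcc_sub_le {N : ℕ} {η ξ : Config} {C : ℝ}
    (h : |∑ i ∈ Finset.range N, ind (η i) - ∑ i ∈ Finset.range N, ind (ξ i)| ≤ C) :
    |avgOcc N η - avgOcc N ξ| ≤ C / N := by
  rw [avgOcc, avgOcc, ← mul_sub, abs_mul, abs_of_nonneg (by positivity), div_eq_inv_mul]
  gcongr

lemma abs_avgOcc_shift_sub_le (N : ℕ) (η : Config) :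
    |avgOcc N (shift 1 η) - avgOcc N η| ≤ 1 / N := by
  refine abs_avgOcc_sub_le ?_
  rw [← Finset.sum_sub_distrib]
  have := Finset.sum_range_sub (fun i : ℕ => ind (η i)) N
  simp only [Nat.cast_add, Nat.cast_one] at this
  simp only [shift, this]
  have h1 := ind_nonneg (η (N : ℤ))
  have h2 := ind_nonneg (η ((0 : ℕ) : ℤ))
  have h3 := ind_le_one (η (N : ℤ))
  have h4 := ind_le_one (η ((0 : ℕ) : ℤ))
  rw [abs_le]
  constructor <;> linarith

lemma ind_siteStep (η : Config) (u : SiteNoise) (x : ℤ) :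
    ind (siteStep η u x) = ind (η (x + 1)) + ind (hor η u x) - ind (hor η u (x + 1)) := by
  have := siteStep_sub_one η u (x + 1)
  rw [add_sub_cancel_right] at this
  rw [this, hor_rec η u (x + 1), add_sub_cancel_right]
  cases hor η u x <;> cases η (x + 1) <;> cases u (x + 1, false) <;> cases u (x + 1, true) <;> simp

/-- The change of the occupation at a site is a discrete derivative of `η - hor`, so only the two
ends of the interval contribute. -/
lemma abs_avgOcc_siteStep_sub_le (N : ℕ) (η : Config) (u : SiteNoise) :
    |avgOcc N (siteStep η u) - avgOcc N η| ≤ 2 / N := by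
  refine abs_avgOcc_sub_le ?_
  rw [← Finset.sum_sub_distrib]
  have h := Finset.sum_range_sub (fun i : ℕ => ind (η i) - ind (hor η u i)) N
  simp only [Nat.cast_add, Nat.cast_one] at h
  have e : ∀ i ∈ Finset.range N, ind (siteStep η u i) - ind (η i) =
      ind (η (i + 1)) - ind (hor η u (i + 1)) - (ind (η i) - ind (hor η u i)) := fun i _ => by
    rw [ind_siteStep]; ring
  rw [Finset.sum_congr rfl e, h]
  have h1 := ind_nonneg (η (N : ℤ))
  have h2 := ind_nonneg (η ((0 : ℕ) : ℤ))
  have h3 := ind_le_one (η (N : ℤ))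
  have h4 := ind_le_one (η ((0 : ℕ) : ℤ))
  have h1' := ind_nonneg (hor η u (N : ℤ))
  have h2' := ind_nonneg (hor η u ((0 : ℕ) : ℤ))
  have h3' := ind_le_one (hor η u (N : ℤ))
  have h4' := ind_le_one (hor η u ((0 : ℕ) : ℤ))
  rw [abs_le]
  constructor <;> linarith

lemma excess_le_add (M N : ℕ) (p q : Config × Config) : excess M p ≤ excess N q +
    (|avgOcc M p.1 - avgOcc N q.1| + |avgOcc M p.2 - avgOcc N q.2|) := by
  have h1 := le_abs_self (avgOcc M p.1 - avgOcc N q.1)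
  have h2 := neg_abs_le (avgOcc M p.2 - avgOcc N q.2)
  have h3 := le_max_right 0 (avgOcc N q.1 - avgOcc N q.2)
  have h4 := le_max_left 0 (avgOcc N q.1 - avgOcc N q.2)
  have h5 := abs_nonneg (avgOcc M p.1 - avgOcc N q.1)
  have h6 := abs_nonneg (avgOcc M p.2 - avgOcc N q.2)
  simp only [excess]
  exact max_le (by linarith) (by linarith)

variable {b₁ b₂ : I}

lemma integral_excess_pairEvolve_le (l : Measure (Config × Config)) [IsProbabilityMeasure l]
    (N t : ℕ) : ∫ p, excess N p ∂((pairEvolve b₁ b₂)^[t] l) ≤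
      ∫ p, excess N p ∂l + t * (4 / N) := by
  induction t with
  | zero => simp
  | succ t ih =>
    have := isProbabilityMeasure_pairEvolve_iterate b₁ b₂ l t
    have hi := integrable_of_continuous (continuous_excess N) ((pairEvolve b₁ b₂)^[t] l)
    have hf : IsFiniteMeasure (((pairEvolve b₁ b₂)^[t] l).prod (siteNoiseLaw b₁ b₂)) :=
      inferInstance
    obtain ⟨C, hC0, hC⟩ := exists_abs_le_of_continuous (continuous_excess N)
    rw [Function.iterate_succ_apply']
    have he := integral_evolve (N := siteNoiseLaw b₁ b₂) measurable_pairStep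
      ((pairEvolve b₁ b₂)^[t] l) (continuous_excess N).measurable
    refine he.trans_le ?_
    calc _ ≤ ∫ q, (excess N q.1 + 4 / N)
          ∂(((pairEvolve b₁ b₂)^[t] l).prod (siteNoiseLaw b₁ b₂)) := by
          refine integral_mono (Integrable.of_bound
            ((continuous_excess N).measurable.comp measurable_pairStep).aestronglyMeasurable C
            (ae_of_all _ fun q => hC _)) ((hi.comp_fst _).add (integrable_const _)) fun q => ?_
          refine (excess_le_add N N _ q.1).trans ?_
          have h1 := abs_avgOcc_siteStep_sub_le N q.1.1 q.2
          have h2 := abs_avgOcc_siteStep_sub_le N q.1.2 q.2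
          simp only [pairStep]
          have : (4 : ℝ) / N = 2 / N + 2 / N := by ring
          linarith
      _ = ∫ p, excess N p ∂((pairEvolve b₁ b₂)^[t] l) + 4 / N := by
          rw [integral_add (hi.comp_fst _) (integrable_const _)]
          simp [integral_fun_fst]
      _ ≤ _ := by push_cast; linarith

/-- For stationary and translation invariant marginals, the excess over long intervals stays small
forever if it is small initially. -/
lemma exists_excess_le {α β : Measure Config} (hα : siteEvolve b₁ b₂ α = α)
    (hβ : siteEvolve b₁ b₂ β = β) (hα' : α.map (shift 1) = α) (hβ' : β.map (shift 1) = β)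
    {l : Measure (Config × Config)} [IsProbabilityMeasure l] (hlα : l.map Prod.fst = α)
    (hlβ : l.map Prod.snd = β)
    (h : ∀ ε > 0, ∀ᶠ N : ℕ in atTop, ∫ p, excess N p ∂l ≤ ε) {ε : ℝ} (hε : 0 < ε) :
    ∃ M : ℕ, 0 < M ∧ ∀ t, ∫ p, excess M p ∂((pairEvolve b₁ b₂)^[t] l) ≤ ε := by
  have hPα : IsProbabilityMeasure α := by
    rw [← hlα]; exact Measure.isProbabilityMeasure_map measurable_fst.aemeasurable
  have hPβ : IsProbabilityMeasure β := by
    rw [← hlβ]; exact Measure.isProbabilityMeasure_map measurable_snd.aemeasurable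
  obtain ⟨K, hK⟩ := exists_integral_avgOcc_sub_le hα' (show 0 < ε / 4 by positivity)
  obtain ⟨K', hK'⟩ := exists_integral_avgOcc_sub_le hβ' (show 0 < ε / 4 by positivity)
  -- `M` is fixed before `t`. Given `t`, the excess over a much longer interval `N` changes by at
  -- most `4 * t / N`. The ergodic theorem for the stationary marginals compares `M` with `N`, with
  -- an error that does not depend on the time.
  refine ⟨max (max K K') 1, by positivity, fun t => ?_⟩
  set M := max (max K K') 1
  have hlim : Tendsto (fun N : ℕ => (t : ℝ) * (4 / N)) atTop (𝓝 0) := by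
    simpa using (tendsto_const_div_atTop_nhds_zero_nat 4).const_mul (t : ℝ)
  obtain ⟨N, hN, hN1, hN2⟩ := ((h (ε / 4) (by positivity)).and
    ((eventually_ge_atTop M).and (hlim.eventually (ge_mem_nhds (show 0 < ε / 4 by positivity))))).exists
  have := isProbabilityMeasure_pairEvolve_iterate b₁ b₂ l t
  have hi := integrable_of_continuous (continuous_excess N) ((pairEvolve b₁ b₂)^[t] l)
  have hc : Continuous fun η => |avgOcc M η - avgOcc N η| :=
    ((continuous_avgOcc M).sub (continuous_avgOcc N)).abs
  have hi1 : Integrable (fun p : Config × Config => |avgOcc M p.1 - avgOcc N p.1|)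
    ((pairEvolve b₁ b₂)^[t] l) := integrable_of_continuous (hc.comp continuous_fst) _
  have hi2 : Integrable (fun p : Config × Config => |avgOcc M p.2 - avgOcc N p.2|)
    ((pairEvolve b₁ b₂)^[t] l) := integrable_of_continuous (hc.comp continuous_snd) _
  have e1 : ∫ p : Config × Config, |avgOcc M p.1 - avgOcc N p.1| ∂((pairEvolve b₁ b₂)^[t] l) =
      ∫ η, |avgOcc M η - avgOcc N η| ∂α := by
    conv_rhs => rw [← Function.iterate_fixed hα t, ← hlα, ← pairEvolve_map_fst,
      integral_map measurable_fst.aemeasurable hc.measurable.aestronglyMeasurable]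
  have e2 : ∫ p : Config × Config, |avgOcc M p.2 - avgOcc N p.2| ∂((pairEvolve b₁ b₂)^[t] l) =
      ∫ η, |avgOcc M η - avgOcc N η| ∂β := by
    conv_rhs => rw [← Function.iterate_fixed hβ t, ← hlβ, ← pairEvolve_map_snd,
      integral_map measurable_snd.aemeasurable hc.measurable.aestronglyMeasurable]
  have hMK : K ≤ M := (le_max_left _ _).trans (le_max_left _ _)
  have hMK' : K' ≤ M := (le_max_right _ _).trans (le_max_left _ _)
  have k1 := hK M hMK N (hMK.trans hN1)
  have k2 := hK' M hMK' N (hMK'.trans hN1)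
  calc _ ≤ ∫ p, (excess N p + (|avgOcc M p.1 - avgOcc N p.1| + |avgOcc M p.2 - avgOcc N p.2|))
        ∂((pairEvolve b₁ b₂)^[t] l) :=
        integral_mono (integrable_of_continuous (continuous_excess M) _) (hi.add (hi1.add hi2))
          fun p => excess_le_add M N p p
    _ = ∫ p, excess N p ∂((pairEvolve b₁ b₂)^[t] l) + (∫ η, |avgOcc M η - avgOcc N η| ∂α +
        ∫ η, |avgOcc M η - avgOcc N η| ∂β) := by
        rw [← e1, ← e2, ← integral_add hi1 hi2]
        exact integral_add hi (hi1.add hi2)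
    _ ≤ _ := by
        have := integral_excess_pairEvolve_le (b₁ := b₁) (b₂ := b₂) l N t
        linarith

/-- For `g` a projection to one marginal: translates of a stationary law are stationary, hence so is
the limit of their averages, which is moreover translation invariant. -/
lemma map_spatialLimit_eq {l₀ l : Measure (Config × Config)} [IsProbabilityMeasure l₀]
    [IsProbabilityMeasure l] (h : WeakLim (hyperfilter ℕ) (spatialAvg l₀) l) (h₁ : b₁ < 1)
    (h₂ : b₂ < 1) {g : Config × Config → Config} (hg : Continuous g)
    (hgs : ∀ x p, g (pairShift x p) = shift x (g p))
    (hst : siteEvolve b₁ b₂ (l₀.map g) = l₀.map g) :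
    siteEvolve b₁ b₂ (l.map g) = l.map g ∧ (l.map g).map (shift 1) = l.map g := by
  have hgm := hg.measurable
  constructor
  · have hp : ∀ x : ℤ, IsProbabilityMeasure ((l₀.map g).map (shift x)) := fun x =>
      have := Measure.isProbabilityMeasure_map (μ := l₀) hgm.aemeasurable
      Measure.isProbabilityMeasure_map (measurable_shift x).aemeasurable
    have hF := isFeller_siteStep h₁ h₂
    refine hF.fixed_of_weakLim (F := (hyperfilter ℕ : Filter ℕ)) (μs := fun N => avgMeasure
      (Finset.Icc (-((2 * N + 2 : ℕ) : ℤ)) ((2 * N + 2 : ℕ) : ℤ)) fun x => (l₀.map g).map (shift x))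
      (fun k => isProbabilityMeasure_avgMeasure (window_nonempty _) hp)
      (Measure.isProbabilityMeasure_map hgm.aemeasurable) (fun f hf => ?_) fun f hf => ?_
    · have h1 := h _ (hf.comp hg)
      rw [integral_map hgm.aemeasurable hf.measurable.aestronglyMeasurable]
      refine h1.congr fun k => ?_
      have hp' := isProbabilityMeasure_map_pairShift l₀
      rw [spatialAvg, integral_avgMeasure _ (fun x _ => have := hp' x
        integrable_of_continuous (hf.comp hg) _), integral_avgMeasure _ (fun x _ => have := hp x
        integrable_of_continuous hf _)]
      congr 1
      refine Finset.sum_congr rfl fun x _ => ?_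
      have hfs : Continuous fun η => f (shift x η) := hf.comp (continuous_shift x)
      rw [integral_map (measurable_pairShift x).aemeasurable
        (hf.comp hg).measurable.aestronglyMeasurable, integral_map (measurable_shift x).aemeasurable
        hf.measurable.aestronglyMeasurable, integral_map hgm.aemeasurable
        hfs.measurable.aestronglyMeasurable]
      simp only [Function.comp_apply, hgs]
    · have := Measure.isProbabilityMeasure_map (μ := l₀) hgm.aemeasurable
      have e : ∀ x : ℤ, evolve (siteNoiseLaw b₁ b₂) siteStep ((l₀.map g).map (shift x)) =
          (l₀.map g).map (shift x) := fun x => by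
        have := siteEvolve_map_shift (b₁ := b₁) (b₂ := b₂) (l₀.map g) x
        rw [hst] at this
        exact this
      have e2 : ∀ k, ∫ x, f x ∂(evolve (siteNoiseLaw b₁ b₂) siteStep (avgMeasure
          (Finset.Icc (-((2 * k + 2 : ℕ) : ℤ)) ((2 * k + 2 : ℕ) : ℤ))
            fun x => (l₀.map g).map (shift x))) - ∫ x, f x ∂(avgMeasure
          (Finset.Icc (-((2 * k + 2 : ℕ) : ℤ)) ((2 * k + 2 : ℕ) : ℤ))
            fun x => (l₀.map g).map (shift x)) = 0 := fun k => by
        rw [hF.integral_avgMeasure (window_nonempty _) hp hf, integral_avgMeasure _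
          (fun x _ => have := hp x; integrable_of_continuous hf _)]
        simp only [e, sub_self]
      simp only [e2]
      exact tendsto_const_nhds
  · conv_rhs => rw [← spatialLimit_invariant h]
    rw [Measure.map_map (measurable_shift 1) hgm, Measure.map_map hgm (measurable_pairShift 1)]
    congr 1
    ext1 p
    exact (hgs 1 p).symm

/-- A stationary measure has an ordered stationary coupling with its translate. -/
lemma exists_ordered_shift (hb₁ : 0 < b₁) (h₁ : b₁ < 1) (hb₂ : 0 < b₂) (h₂ : b₂ < 1)
    {ν : Measure Config} [IsProbabilityMeasure ν] (hν : siteEvolve b₁ b₂ ν = ν) :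
    ∃ l, IsStationaryCoupling b₁ b₂ ν (ν.map (shift 1)) l ∧
      ∀ᵐ p ∂l, p.1 ≤ p.2 ∨ p.2 ≤ p.1 := by
  have hν' : siteEvolve b₁ b₂ (ν.map (shift 1)) = ν.map (shift 1) := by
    rw [siteEvolve_map_shift, hν]
  have hm : Measurable fun η : Config => (η, shift 1 η) :=
    measurable_id.prodMk (measurable_shift 1)
  -- In this coupling the two configurations have nearly equal densities in every long interval,
  -- although they need not be ordered.
  set l₀ := ν.map fun η : Config => (η, shift 1 η) with hl₀
  have : IsProbabilityMeasure l₀ := Measure.isProbabilityMeasure_map hm.aemeasurable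
  have hfst : l₀.map Prod.fst = ν := by
    rw [hl₀, Measure.map_map measurable_fst hm]; exact Measure.map_id
  have hsnd : l₀.map Prod.snd = ν.map (shift 1) := by
    rw [hl₀, Measure.map_map measurable_snd hm]; rfl
  have hp := isProbabilityMeasure_map_pairShift l₀
  obtain ⟨l, hl, hlim⟩ := exists_weakLim (hyperfilter ℕ) (spatialAvg l₀)
    (fun k => isProbabilityMeasure_avgMeasure (window_nonempty _) hp)
  obtain ⟨hα, hα'⟩ := map_spatialLimit_eq (b₁ := b₁) (b₂ := b₂) hlim h₁ h₂ continuous_fst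
    (fun _ _ => rfl) (by rw [hfst, hν])
  obtain ⟨hβ, hβ'⟩ := map_spatialLimit_eq (b₁ := b₁) (b₂ := b₂) hlim h₁ h₂ continuous_snd
    (fun _ _ => rfl) (by rw [hsnd, hν'])
  refine exists_ordered_of_excess_le hb₁ h₁ hb₂ h₂ hν hν' hfst hsnd hlim fun ε hε =>
    exists_excess_le hα hβ hα' hβ' rfl rfl (fun δ hδ => ?_) hε
  -- Shifting an interval by one site changes its number of particles by at most one.
  have key : ∀ N : ℕ, ∫ p, excess N p ∂l ≤ 1 / N := fun N => by
    refine le_of_tendsto' (hlim _ (continuous_excess N)) fun k => ?_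
    rw [spatialAvg, integral_avgMeasure _ (fun x _ => have := hp x
      integrable_of_continuous (continuous_excess N) _), inv_mul_le_iff₀ (by
        exact_mod_cast (window_nonempty _).card_pos), ← nsmul_eq_mul]
    refine Finset.sum_le_card_nsmul _ _ _ fun x _ => ?_
    have hce : Continuous fun p => excess N (pairShift x p) :=
      (continuous_excess N).comp (continuous_pairShift x)
    rw [hl₀, integral_map (measurable_pairShift x).aemeasurable
      (continuous_excess N).measurable.aestronglyMeasurable, integral_map hm.aemeasurable
      hce.measurable.aestronglyMeasurable]
    refine (integral_mono_of_nonneg (ae_of_all _ fun η => le_max_left _ _)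
      (integrable_const (1 / (N : ℝ))) (ae_of_all _ fun η => ?_)).trans (by simp)
    refine max_le (by positivity) ?_
    have h1 := abs_avgOcc_shift_sub_le N (shift x η)
    have h2 := neg_abs_le (avgOcc N (shift 1 (shift x η)) - avgOcc N (shift x η))
    have h3 : shift x (shift 1 η) = shift 1 (shift x η) := by
      rw [shift_shift, shift_shift, add_comm]
    simp only [pairShift, h3]
    linarith
  have h4 := tendsto_one_div_atTop_nhds_zero_nat (𝕜 := ℝ)
  filter_upwards [h4.eventually (ge_mem_nhds hδ)] with N hN
  exact (key N).trans hN

end OrderedTranslates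

/-! ### Extremal laws are translation invariant or steps. -/

section Steps

/-- The probability measures which are invariant under one step of the site dynamics. -/
def invariantLaws (b₁ b₂ : I) : Set (Measure Config) :=
  {μ | IsProbabilityMeasure μ ∧ siteEvolve b₁ b₂ μ = μ}

variable {b₁ b₂ : I}

/-- The remainder `ν - p • ν'` is invariant too. For `p < 1` this writes `ν` as a proper convex
combination, so both components coincide with `ν`. -/
lemma eq_of_smul_le_of_mem_extremal {ν ν' : Measure Config}
    (hν : ν ∈ extremal (invariantLaws b₁ b₂)) (hν' : ν' ∈ invariantLaws b₁ b₂) {p : ℝ≥0∞}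
    (hp : p ≠ 0) (hle : p • ν' ≤ ν) : ν' = ν := by
  obtain ⟨⟨hP, hst⟩, hext⟩ := hν
  obtain ⟨hP', hst'⟩ := hν'
  have hp1 : p ≤ 1 := by simpa using hle Set.univ
  have hptop : p ≠ ∞ := (hp1.trans_lt ENNReal.one_lt_top).ne
  rcases hp1.eq_or_lt with rfl | hp1
  · exact Measure.eq_of_le_of_measure_univ_eq (by simpa using hle) (by simp)
  have hfin : IsFiniteMeasure (p • ν') := isFiniteMeasure_of_le ν hle
  -- This remainder has mass `1 - p`; it will be the second component after normalization.
  set k := ν - p • ν'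
  have hk : k + p • ν' = ν := Measure.sub_add_cancel_of_le hle
  have hkst : siteEvolve b₁ b₂ k = k := by
    have h1 : siteEvolve b₁ b₂ k + p • ν' = k + p • ν' := by
      conv_rhs => rw [hk, ← hst, ← hk]
      rw [siteEvolve, evolve_add measurable_siteStep, evolve_smul]
      congr 2
      exact hst'.symm
    ext s hs
    have h2 := congrArg (fun m => m s) h1
    simp only [Measure.add_apply] at h2
    exact (ENNReal.add_left_inj (measure_ne_top _ _)).1 h2
  have hk1 : k Set.univ = 1 - p := by
    rw [Measure.sub_apply .univ hle]; simp
  have h0 : 1 - p ≠ 0 := (tsub_pos_of_lt hp1).ne'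
  have ht : 1 - p ≠ ∞ := (tsub_le_self.trans_lt ENNReal.one_lt_top).ne
  by_contra hne
  refine hext ⟨ν', ⟨hP', hst'⟩, (1 - p)⁻¹ • k, ⟨⟨?_⟩, ?_⟩, ?_, p.toReal, ?_, ?_, ?_⟩
  · rw [Measure.smul_apply, hk1, smul_eq_mul, ENNReal.inv_mul_cancel h0 ht]
  · rw [siteEvolve, evolve_smul]
    congr 1
  · intro h
    apply hne
    rw [← hk]
    conv_rhs => rw [← one_smul ℝ≥0∞ k, ← ENNReal.mul_inv_cancel h0 ht, mul_smul, ← h, ← add_smul,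
      tsub_add_cancel_of_le hp1.le, one_smul]
  · exact ENNReal.toReal_pos hp hptop
  · simpa using (ENNReal.toReal_lt_toReal hptop ENNReal.one_ne_top).2 hp1
  · have e : ENNReal.ofReal (1 - p.toReal) = 1 - p := by
      rw [ENNReal.ofReal_sub _ ENNReal.toReal_nonneg, ENNReal.ofReal_one, ENNReal.ofReal_toReal hptop]
    rw [ENNReal.ofReal_toReal hptop, e, smul_smul, ENNReal.mul_inv_cancel h0 ht, one_smul, add_comm,
      hk]

lemma mem_extremal_of_forall {ν : Measure Config} (hν : ν ∈ invariantLaws b₁ b₂)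
    (h : ∀ ν' ∈ invariantLaws b₁ b₂, ∀ p : ℝ≥0∞, p ≠ 0 → p • ν' ≤ ν → ν' = ν) :
    ν ∈ extremal (invariantLaws b₁ b₂) := by
  refine ⟨hν, ?_⟩
  rintro ⟨ν₁, h1, ν₂, h2, hne, a, ha0, ha1, rfl⟩
  refine hne ((h ν₁ h1 (ENNReal.ofReal a) ?_ (Measure.le_add_right le_rfl)).trans
    (h ν₂ h2 (ENNReal.ofReal (1 - a)) ?_ (Measure.le_add_left le_rfl)).symm)
  · simpa using ha0
  · simpa using ha1

lemma map_shift_mem_invariantLaws {ν : Measure Config} (hν : ν ∈ invariantLaws b₁ b₂) (n : ℤ) :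
    ν.map (shift n) ∈ invariantLaws b₁ b₂ := by
  have := hν.1
  exact ⟨Measure.isProbabilityMeasure_map (measurable_shift n).aemeasurable, by
    rw [siteEvolve_map_shift, hν.2]⟩

lemma map_shift_map_shift_neg (ν : Measure Config) (n : ℤ) :
    (ν.map (shift n)).map (shift (-n)) = ν := by
  rw [Measure.map_map (measurable_shift _) (measurable_shift _)]
  convert Measure.map_id
  ext1 η
  simp only [Function.comp_apply, shift_shift, id]
  ext x
  simp [shift]

lemma map_shift_mem_extremal {ν : Measure Config} (hν : ν ∈ extremal (invariantLaws b₁ b₂))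
    (n : ℤ) : ν.map (shift n) ∈ extremal (invariantLaws b₁ b₂) := by
  refine mem_extremal_of_forall (map_shift_mem_invariantLaws hν.1 n) fun ν' hν' p hp hle => ?_
  have h1 := Measure.map_mono hle (measurable_shift (-n))
  rw [Measure.map_smul, map_shift_map_shift_neg] at h1
  have h2 := eq_of_smul_le_of_mem_extremal hν (map_shift_mem_invariantLaws hν' (-n)) hp h1
  have h3 := map_shift_map_shift_neg ν' (-n)
  rw [neg_neg, h2] at h3
  exact h3.symm

lemma IsStationaryCoupling.map_cond_mem {α β : Measure Config} {l : Measure (Config × Config)}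
    (hl : IsStationaryCoupling b₁ b₂ α β l) {A : Set (Config × Config)} (hA : MeasurableSet A)
    (habs : ∀ p ∈ A, ∀ᵐ u ∂(siteNoiseLaw b₁ b₂), pairStep p u ∈ A) (h0 : l A ≠ 0) :
    IsProbabilityMeasure (ProbabilityTheory.cond l A) ∧
      pairEvolve b₁ b₂ (ProbabilityTheory.cond l A) = ProbabilityTheory.cond l A := by
  have := hl.isProb
  refine ⟨cond_isProbabilityMeasure h0, ?_⟩
  rw [ProbabilityTheory.cond, pairEvolve, evolve_smul]
  congr 1
  exact evolve_restrict_of_absorbing measurable_pairStep hl.stationary hA habs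

/-- A stationary coupling of extremal measures may be conditioned on absorbing sets. -/
lemma IsStationaryCoupling.cond {α β : Measure Config} {l : Measure (Config × Config)}
    (hα : α ∈ extremal (invariantLaws b₁ b₂)) (hβ : β ∈ extremal (invariantLaws b₁ b₂))
    (hl : IsStationaryCoupling b₁ b₂ α β l) {A : Set (Config × Config)} (hA : MeasurableSet A)
    (habs : ∀ p ∈ A, ∀ᵐ u ∂(siteNoiseLaw b₁ b₂), pairStep p u ∈ A) (h0 : l A ≠ 0) :
    IsStationaryCoupling b₁ b₂ α β (ProbabilityTheory.cond l A) := by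
  obtain ⟨hP, hst⟩ := hl.map_cond_mem hA habs h0
  have := hl.isProb
  -- The conditioned coupling lies below a multiple of `l`, hence its marginals lie below multiples
  -- of `α` and `β`. By extremality they are not changed.
  have hle : l A • ProbabilityTheory.cond l A ≤ l := by
    rw [ProbabilityTheory.cond, smul_smul, ENNReal.mul_inv_cancel h0 (measure_ne_top _ _), one_smul]
    exact Measure.restrict_le_self
  refine ⟨hP, ?_, ?_, hst⟩
  · refine eq_of_smul_le_of_mem_extremal hα ⟨Measure.isProbabilityMeasure_map
      measurable_fst.aemeasurable, ?_⟩ h0 ?_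
    · have := pairEvolve_map_fst (b₁ := b₁) (b₂ := b₂) (ProbabilityTheory.cond l A) 1
      simp only [Function.iterate_one, hst] at this
      exact this.symm
    · rw [← Measure.map_smul, ← hl.map_fst]
      exact Measure.map_mono hle measurable_fst
  · refine eq_of_smul_le_of_mem_extremal hβ ⟨Measure.isProbabilityMeasure_map
      measurable_snd.aemeasurable, ?_⟩ h0 ?_
    · have := pairEvolve_map_snd (b₁ := b₁) (b₂ := b₂) (ProbabilityTheory.cond l A) 1
      simp only [Function.iterate_one, hst] at this
      exact this.symm
    · rw [← Measure.map_smul, ← hl.map_snd]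
      exact Measure.map_mono hle measurable_snd

lemma measurableSet_le : MeasurableSet {p : Config × Config | p.1 ≤ p.2} := by
  have : {p : Config × Config | p.1 ≤ p.2} = ⋂ x, {p | plus p x = false} := by
    ext p
    simp only [Set.mem_ofPred_eq, Set.mem_iInter, Pi.le_def, plus]
    refine forall_congr' fun x => ?_
    cases p.1 x <;> cases p.2 x <;> simp
  rw [this]
  exact MeasurableSet.iInter fun x => measurableSet_apply_eq (measurable_plus x) _

lemma measurableSet_ge : MeasurableSet {p : Config × Config | p.2 ≤ p.1} :=
  measurable_swap measurableSet_le

lemma measurableSet_diag : MeasurableSet {p : Config × Config | p.1 = p.2} := by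
  have : {p : Config × Config | p.1 = p.2} = {p | p.1 ≤ p.2} ∩ {p | p.2 ≤ p.1} := by
    ext p; exact le_antisymm_iff
  rw [this]
  exact measurableSet_le.inter measurableSet_ge

lemma ae_mem_cond {X : Type*} [MeasurableSpace X] {l : Measure X} {A : Set X}
    (hA : MeasurableSet A) : ∀ᵐ p ∂(ProbabilityTheory.cond l A), p ∈ A :=
  Measure.ae_smul_measure (ae_restrict_mem hA) _

lemma IsStationaryCoupling.cond_le {α β : Measure Config} {l : Measure (Config × Config)}
    (hα : α ∈ extremal (invariantLaws b₁ b₂)) (hβ : β ∈ extremal (invariantLaws b₁ b₂))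
    (hl : IsStationaryCoupling b₁ b₂ α β l) (h0 : l {p | p.1 ≤ p.2} ≠ 0) :
    ∃ l, IsStationaryCoupling b₁ b₂ α β l ∧ ∀ᵐ p ∂l, p.1 ≤ p.2 :=
  ⟨_, hl.cond hα hβ measurableSet_le (fun _ hp => ae_of_all _ fun u => siteStep_mono hp u) h0,
    ae_mem_cond measurableSet_le⟩

/-- By attractiveness each of the two orders is absorbing. Condition on `p.1 ≤ p.2` if it has
positive probability; otherwise the reverse order holds almost surely. -/
lemma IsStationaryCoupling.exists_le_or_ge {α β : Measure Config} {l : Measure (Config × Config)}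
    (hα : α ∈ extremal (invariantLaws b₁ b₂)) (hβ : β ∈ extremal (invariantLaws b₁ b₂))
    (hl : IsStationaryCoupling b₁ b₂ α β l) (hord : ∀ᵐ p ∂l, p.1 ≤ p.2 ∨ p.2 ≤ p.1) :
    (∃ l, IsStationaryCoupling b₁ b₂ α β l ∧ ∀ᵐ p ∂l, p.1 ≤ p.2) ∨
      ∃ l, IsStationaryCoupling b₁ b₂ α β l ∧ ∀ᵐ p ∂l, p.2 ≤ p.1 := by
  have := hl.isProb
  by_cases h0 : l {p | p.1 ≤ p.2} = 0
  · refine Or.inr ⟨l, hl, ?_⟩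
    have h1 : ∀ᵐ p ∂l, ¬ p.1 ≤ p.2 := by
      rw [ae_iff]; simpa only [not_not] using h0
    filter_upwards [hord, h1] with p hp hp1 using hp.resolve_left hp1
  · exact Or.inl (hl.cond_le hα hβ h0)

lemma IsStationaryCoupling.eq_of_ae_eq {α β : Measure Config} {l : Measure (Config × Config)}
    (hl : IsStationaryCoupling b₁ b₂ α β l) (h : ∀ᵐ p ∂l, p.1 = p.2) : α = β := by
  rw [← hl.map_fst, ← hl.map_snd]
  exact Measure.map_congr h

/-- Equal configurations stay equal under common coins, so one may condition on the diagonal without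
changing the marginals. -/
lemma IsStationaryCoupling.eq_of_diag {α β : Measure Config} {l : Measure (Config × Config)}
    (hα : α ∈ extremal (invariantLaws b₁ b₂)) (hβ : β ∈ extremal (invariantLaws b₁ b₂))
    (hl : IsStationaryCoupling b₁ b₂ α β l) (h0 : l {p | p.1 = p.2} ≠ 0) : α = β := by
  refine (hl.cond hα hβ measurableSet_diag (fun p hp => ae_of_all _ fun u => ?_) h0).eq_of_ae_eq
    (ae_mem_cond measurableSet_diag)
  have hp' : p.1 = p.2 := hp
  simp only [pairStep, Set.mem_ofPred_eq, hp']

/-- The probability that the site `x` is occupied. -/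
def occ (ν : Measure Config) (x : ℤ) : ℝ := ∫ η, ind (η x) ∂ν

lemma occ_nonneg (ν : Measure Config) (x : ℤ) : 0 ≤ occ ν x := integral_ind_nonneg _ ν

lemma occ_le_one (ν : Measure Config) [IsProbabilityMeasure ν] (x : ℤ) : occ ν x ≤ 1 :=
  integral_ind_le_one (measurable_pi_apply x) ν

lemma occ_map_shift (ν : Measure Config) (n x : ℤ) : occ (ν.map (shift n)) x = occ ν (x + n) := by
  have hm : Measurable fun η : Config => ind (η x) := measurable_ind.comp (measurable_pi_apply x)
  rw [occ, integral_map (measurable_shift n).aemeasurable hm.aestronglyMeasurable]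
  rfl

lemma IsStationaryCoupling.occ_fst {α β : Measure Config} {l : Measure (Config × Config)}
    (hl : IsStationaryCoupling b₁ b₂ α β l) (x : ℤ) : occ α x = ∫ p, ind (p.1 x) ∂l := by
  have hm : Measurable fun η : Config => ind (η x) := measurable_ind.comp (measurable_pi_apply x)
  rw [occ, ← hl.map_fst, integral_map measurable_fst.aemeasurable hm.aestronglyMeasurable]

lemma IsStationaryCoupling.occ_snd {α β : Measure Config} {l : Measure (Config × Config)}
    (hl : IsStationaryCoupling b₁ b₂ α β l) (x : ℤ) : occ β x = ∫ p, ind (p.2 x) ∂l := by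
  have hm : Measurable fun η : Config => ind (η x) := measurable_ind.comp (measurable_pi_apply x)
  rw [occ, ← hl.map_snd, integral_map measurable_snd.aemeasurable hm.aestronglyMeasurable]

/-- If `η < ξ` almost surely, then the sum of the differences of the densities over large windows
is at least one in the limit. -/
lemma le_of_lt_coupling {α β : Measure Config} {l : Measure (Config × Config)}
    (hl : IsStationaryCoupling b₁ b₂ α β l) (hlt : ∀ᵐ p ∂l, p.1 < p.2) {c : ℝ} (hc : c < 1) :
    ∀ᶠ N : ℕ in atTop, c < ∑ x ∈ Finset.Icc (-(N : ℤ)) N, (occ β x - occ α x) := by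
  have := hl.isProb
  have hi : ∀ (x : ℤ), Integrable (fun p : Config × Config => ind (p.1 x)) l := fun x =>
    integrable_ind ((measurable_pi_apply x).comp measurable_fst) l
  have hi' : ∀ (x : ℤ), Integrable (fun p : Config × Config => ind (p.2 x)) l := fun x =>
    integrable_ind ((measurable_pi_apply x).comp measurable_snd) l
  have e : ∀ N : ℕ, ∑ x ∈ Finset.Icc (-(N : ℤ)) N, (occ β x - occ α x) =
      ∫ p, ∑ x ∈ Finset.Icc (-(N : ℤ)) N, (ind (p.2 x) - ind (p.1 x)) ∂l := fun N => by
    have hd : ∀ x ∈ Finset.Icc (-(N : ℤ)) N,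
        Integrable (fun p : Config × Config => ind (p.2 x) - ind (p.1 x)) l :=
      fun x _ => (hi' x).sub (hi x)
    rw [integral_finsetSum _ hd]
    refine Finset.sum_congr rfl fun x _ => ?_
    rw [hl.occ_fst, hl.occ_snd, ← integral_sub (hi' x) (hi x)]
  -- On `B N` at least one discrepancy is visible in the window, so the sum of the differences is at
  -- least one. These events increase to an event of full measure, since the order is strict.
  set B : ℕ → Set (Config × Config) := fun N => ⋃ x ∈ Finset.Icc (-(N : ℤ)) N, {p | plus p.swap x = true}
  have hBm : ∀ N, MeasurableSet (B N) := fun N => Finset.measurableSet_biUnion _ fun x _ =>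
    measurableSet_apply_eq ((measurable_plus x).comp measurable_swap) true
  have hmono : Monotone B := fun M N hMN =>
    Set.biUnion_subset_biUnion_left fun x hx => by
      simp only [Finset.mem_coe, Finset.mem_Icc] at hx ⊢
      constructor <;> omega
  have hU : l (⋃ N, B N) = 1 := by
    rw [prob_compl_eq_zero_iff₀ (MeasurableSet.iUnion hBm).nullMeasurableSet |>.symm]
    refine measure_mono_null (fun p hp => ?_) (ae_iff.1 hlt)
    simp only [Set.mem_compl_iff, Set.mem_iUnion, not_exists, B, Set.mem_ofPred_eq] at hp ⊢
    intro hlt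
    obtain ⟨x, hx⟩ := (Pi.lt_def.1 hlt).2
    refine hp x.natAbs x (Finset.mem_Icc.2 (by omega)) ?_
    revert hx
    simp only [plus, Prod.fst_swap, Prod.snd_swap]
    cases p.1 x <;> cases p.2 x <;> simp
  have hlim : Tendsto (fun N => l.real (B N)) atTop (𝓝 1) := by
    have h1 := tendsto_measure_iUnion_atTop (μ := l) hmono
    rw [hU] at h1
    exact (ENNReal.tendsto_toReal ENNReal.one_ne_top).comp h1
  filter_upwards [hlim.eventually (lt_mem_nhds hc)] with N hN
  refine hN.trans_le ?_
  rw [e, ← integral_indicator_one (hBm N)]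
  have hint : Integrable ((B N).indicator (1 : Config × Config → ℝ)) l :=
    (integrable_const (1 : ℝ)).indicator (hBm N)
  refine integral_mono_ae hint (integrable_finsetSum _ fun x _ => (hi' x).sub (hi x)) ?_
  filter_upwards [hlt] with p hp
  have hnn : ∀ x ∈ Finset.Icc (-(N : ℤ)) N, 0 ≤ ind (p.2 x) - ind (p.1 x) := fun x _ =>
    sub_nonneg.2 (ind_mono (hp.le x))
  by_cases hpB : p ∈ B N
  · rw [Set.indicator_of_mem hpB]
    simp only [B, Set.mem_iUnion, exists_prop, Set.mem_ofPred_eq] at hpB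
    obtain ⟨x, hx, hpx⟩ := hpB
    refine le_trans ?_ (Finset.single_le_sum hnn hx)
    revert hpx
    simp only [plus, Prod.fst_swap, Prod.snd_swap]
    cases p.1 x <;> cases p.2 x <;> simp
  · rw [Set.indicator_of_notMem hpB]
    exact Finset.sum_nonneg hnn

/-- The density tends to `1` at one end and to `0` at the other end: at `-∞` if `e = true`, and at
`+∞` if `e = false`. -/
def IsStep (e : Bool) (ν : Measure Config) : Prop :=
  Tendsto (occ ν) atBot (𝓝 (ind e)) ∧ Tendsto (occ ν) atTop (𝓝 (ind !e))

lemma ae_lt_of_diag {l : Measure (Config × Config)} (h0 : l {p | p.1 = p.2} = 0)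
    (hle : ∀ᵐ p ∂l, p.1 ≤ p.2) : ∀ᵐ p ∂l, p.1 < p.2 := by
  have h1 : ∀ᵐ p ∂l, ¬ p.1 = p.2 := by
    rw [ae_iff]; simpa only [not_not] using h0
  filter_upwards [h1, hle] with p hp hp' using lt_of_le_of_ne hp' hp

lemma tendsto_of_le_coupling {f : ℤ → ℝ} (h0 : ∀ x, 0 ≤ f x) (h1 : ∀ x, f x ≤ 1)
    (hmono : ∀ x, f x ≤ f (x + 1)) (h : ∀ c < (1 : ℝ), ∃ N : ℕ, c < f (N + 1) - f (-N)) :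
    Tendsto f atBot (𝓝 0) ∧ Tendsto f atTop (𝓝 1) := by
  have hm : Monotone f := monotone_int_of_le_succ hmono
  constructor
  · rw [Metric.tendsto_nhds]
    intro ε hε
    obtain ⟨N, hN⟩ := h (1 - ε) (by linarith)
    filter_upwards [eventually_le_atBot (-(N : ℤ))] with x hx
    rw [Real.dist_eq, sub_zero, abs_of_nonneg (h0 x)]
    linarith [hm hx, h1 (N + 1)]
  · rw [Metric.tendsto_nhds]
    intro ε hε
    obtain ⟨N, hN⟩ := h (1 - ε) (by linarith)
    filter_upwards [eventually_ge_atTop ((N : ℤ) + 1)] with x hx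
    rw [dist_comm, Real.dist_eq, abs_of_nonneg (by linarith [h1 x])]
    linarith [hm hx, h0 (-N)]

/-- For a law and its translate the density differences telescope to `occ ν (N + 1) - occ ν (-N)`.
Their limit is at least one by `le_of_lt_coupling`, so a density which is monotone and lies in `[0,
1]` uses its whole range. -/
lemma isStep_false_of_le {ν : Measure Config} [IsProbabilityMeasure ν]
    {l : Measure (Config × Config)} (hl : IsStationaryCoupling b₁ b₂ ν (ν.map (shift 1)) l)
    (h : ∀ᵐ p ∂l, p.1 < p.2) : IsStep false ν := by
  refine tendsto_of_le_coupling (occ_nonneg ν) (occ_le_one ν) (fun x => ?_) fun c hc => ?_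
  · have := hl.isProb
    rw [← occ_map_shift, hl.occ_fst, hl.occ_snd]
    exact integral_mono_ae (integrable_ind ((measurable_pi_apply x).comp measurable_fst) l)
      (integrable_ind ((measurable_pi_apply x).comp measurable_snd) l)
      (h.mono fun p hp => ind_mono (hp.le x))
  · obtain ⟨N, hN⟩ := (le_of_lt_coupling hl h hc).exists
    simp only [occ_map_shift, sum_Icc_succ_sub] at hN
    exact ⟨N, hN⟩

lemma IsStationaryCoupling.swap {α β : Measure Config} {l : Measure (Config × Config)}
    (hl : IsStationaryCoupling b₁ b₂ α β l) : IsStationaryCoupling b₁ b₂ β α (l.map Prod.swap) := by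
  have := hl.isProb
  refine ⟨Measure.isProbabilityMeasure_map measurable_swap.aemeasurable, ?_, ?_, ?_⟩
  · rw [Measure.map_map measurable_fst measurable_swap, ← hl.map_snd]; rfl
  · rw [Measure.map_map measurable_snd measurable_swap, ← hl.map_fst]; rfl
  · rw [pairEvolve_swap, hl.stationary]

lemma isStep_true_of_le {ν : Measure Config} [IsProbabilityMeasure ν]
    {l : Measure (Config × Config)} (hl : IsStationaryCoupling b₁ b₂ ν (ν.map (shift 1)) l)
    (h : ∀ᵐ p ∂l, p.2 < p.1) : IsStep true ν := by
  have hl' := hl.swap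
  have h' : ∀ᵐ p ∂(l.map Prod.swap), p.1 < p.2 := by
    have hm : MeasurableSet {p : Config × Config | p.1 < p.2} := by
      simp only [lt_iff_le_not_ge]
      exact measurableSet_le.inter measurableSet_ge.compl
    rw [ae_map_iff measurable_swap.aemeasurable hm]
    exact h
  have key := tendsto_of_le_coupling (f := fun x => 1 - occ ν x)
    (fun x => sub_nonneg.2 (occ_le_one ν x)) (fun x => by linarith [occ_nonneg ν x])
    (fun x => ?_) fun c hc => ?_
  · constructor
    · simpa using key.1.const_sub 1
    · simpa using key.2.const_sub 1
  · have := hl.isProb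
    refine sub_le_sub_left ?_ 1
    rw [← occ_map_shift, hl.occ_fst, hl.occ_snd]
    exact integral_mono_ae (integrable_ind ((measurable_pi_apply x).comp measurable_snd) l)
      (integrable_ind ((measurable_pi_apply x).comp measurable_fst) l)
      (h.mono fun p hp => ind_mono (hp.le x))
  · obtain ⟨N, hN⟩ := (le_of_lt_coupling hl' h' hc).exists
    simp only [occ_map_shift] at hN
    have e := sum_Icc_succ_sub (fun x => 1 - occ ν x) N
    simp only [sub_sub_sub_cancel_left] at e
    exact ⟨N, by simpa only [sub_sub_sub_cancel_left, e] using hN⟩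

/-- An extremal measure is translation invariant or a step. -/
lemma invariant_or_isStep (hb₁ : 0 < b₁) (h₁ : b₁ < 1) (hb₂ : 0 < b₂) (h₂ : b₂ < 1)
    {ν : Measure Config} (hν : ν ∈ extremal (invariantLaws b₁ b₂)) :
    ν.map (shift 1) = ν ∨ ∃ e, IsStep e ν := by
  have := hν.1.1
  have hν' := map_shift_mem_extremal hν 1
  obtain ⟨l, hl, hord⟩ := exists_ordered_shift hb₁ h₁ hb₂ h₂ hν.1.2
  rcases hl.exists_le_or_ge hν hν' hord with ⟨l, hl, hle⟩ | ⟨l, hl, hle⟩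
  · by_cases h0 : l {p | p.1 = p.2} = 0
    · exact Or.inr ⟨false, isStep_false_of_le hl (ae_lt_of_diag h0 hle)⟩
    · exact Or.inl (hl.eq_of_diag hν hν' h0).symm
  · by_cases h0 : l {p | p.1 = p.2} = 0
    · refine Or.inr ⟨true, isStep_true_of_le hl ?_⟩
      have h1 : ∀ᵐ p ∂l, ¬ p.1 = p.2 := by
        rw [ae_iff]; simpa only [not_not] using h0
      filter_upwards [h1, hle] with p hp hp' using lt_of_le_of_ne hp' (Ne.symm hp)
    · exact Or.inl (hl.eq_of_diag hν hν' h0).symm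

end Steps

/-! ### Flux of steps, and packed configurations. -/

section Flux

/-- The probability of a horizontal arrow to the right of the site `x`. -/
def horOcc (b₁ b₂ : I) (ν : Measure Config) (x : ℤ) : ℝ :=
  ∫ q, ind (hor q.1 q.2 x) ∂(ν.prod (siteNoiseLaw b₁ b₂))

variable {b₁ b₂ : I}

lemma horOcc_nonneg (ν : Measure Config) (x : ℤ) : 0 ≤ horOcc b₁ b₂ ν x := integral_ind_nonneg _ _

lemma horOcc_le_one (ν : Measure Config) [IsProbabilityMeasure ν] (x : ℤ) :
    horOcc b₁ b₂ ν x ≤ 1 := integral_ind_le_one (measurable_hor x) _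

/-- Conservation of particles and stationarity make the flux in the moving frame independent of the
site. -/
lemma horOcc_sub_occ_eq {ν : Measure Config} (hν : ν ∈ invariantLaws b₁ b₂) (x : ℤ) :
    horOcc b₁ b₂ ν x - occ ν x = horOcc b₁ b₂ ν 0 - occ ν 0 := by
  have := hν.1
  refine eq_zero_of_shift_invariant (f := fun x => horOcc b₁ b₂ ν x - occ ν x) (fun x => ?_) x
  have h1 : occ ν x = ∫ q, ind (siteStep q.1 q.2 x) ∂(ν.prod (siteNoiseLaw b₁ b₂)) := by
    conv_lhs => rw [occ, ← hν.2]
    exact integral_evolve measurable_siteStep ν (measurable_ind.comp (measurable_pi_apply x))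
  have i1 : Integrable (fun q : Config × SiteNoise => ind (q.1 (x + 1)))
      (ν.prod (siteNoiseLaw b₁ b₂)) :=
    integrable_ind ((measurable_pi_apply (x + 1)).comp measurable_fst) _
  have i2 := fun x => integrable_ind (measurable_hor x) (ν.prod (siteNoiseLaw b₁ b₂))
  have h2 : occ ν (x + 1) = ∫ q, ind (q.1 (x + 1)) ∂(ν.prod (siteNoiseLaw b₁ b₂)) := by
    rw [occ, integral_fun_fst (fun η : Config => ind (η (x + 1)))]
    simp
  have h3 : occ ν x = occ ν (x + 1) + horOcc b₁ b₂ ν x - horOcc b₁ b₂ ν (x + 1) := by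
    rw [h1, h2, horOcc, horOcc, ← integral_add i1 (i2 x), ← integral_sub _ (i2 (x + 1))]
    · simp only [ind_siteStep]
    · exact i1.add (i2 x)
  linarith

/-- In comparison with the empty configuration every particle is a positive discrepancy, so
`horDens_le` applies. -/
lemma horOcc_le (ν : Measure Config) [IsProbabilityMeasure ν] (x : ℤ) :
    horOcc b₁ b₂ ν x ≤ occ ν x + (1 - resetProb b₁ b₂) * horOcc b₁ b₂ ν (x - 1) := by
  have hm : Measurable fun η : Config => (η, (fun _ => false : Config)) :=
    measurable_id.prodMk measurable_const
  have hP : IsProbabilityMeasure (ν.map fun η : Config => (η, (fun _ => false : Config))) :=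
    Measure.isProbabilityMeasure_map hm.aemeasurable
  have h := horDens_le b₁ b₂ (ν.map fun η : Config => (η, (fun _ => false : Config))) x
  have h0 : ∀ (u : SiteNoise) (x : ℤ), hor (fun _ => false) u x = false := fun u x => by
    rw [← Bool.not_eq_true, hor_eq_true]; simp
  have e1 : dens (ν.map fun η : Config => (η, (fun _ => false : Config))) x = occ ν x := by
    have hp : Measurable fun p => ind (plus p x) := measurable_ind.comp (measurable_plus x)
    rw [dens, integral_map hm.aemeasurable hp.aestronglyMeasurable]
    simp [plus, occ]
  have e2 : ∀ x, horDens b₁ b₂ (ν.map fun η : Config => (η, (fun _ => false : Config))) x =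
      horOcc b₁ b₂ ν x := fun x => by
    have hp : Measurable fun q : (Config × Config) × SiteNoise => ind (horPlus q.1 q.2 x) :=
      measurable_ind.comp (measurable_horPlus x)
    have e : (ν.map fun η : Config => (η, (fun _ => false : Config))).prod (siteNoiseLaw b₁ b₂) =
        (ν.prod (siteNoiseLaw b₁ b₂)).map
          (Prod.map (fun η : Config => (η, (fun _ => false : Config))) id) := by
      rw [← Measure.map_prod_map _ _ hm measurable_id, Measure.map_id]
    rw [horDens, e, integral_map (hm.prodMap measurable_id).aemeasurable hp.aestronglyMeasurable]
    simp [horPlus, h0, horOcc]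
  rwa [e1, e2, e2] at h

/-- For steps, the flux vanishes. -/
lemma horOcc_eq_occ (h₁ : b₁ < 1) (h₂ : b₂ < 1) {ν : Measure Config}
    (hν : ν ∈ invariantLaws b₁ b₂) {e : Bool} (he : IsStep e ν) (x : ℤ) :
    horOcc b₁ b₂ ν x = occ ν x := by
  have := hν.1
  have hr := resetProb_pos h₁ h₂
  set k := horOcc b₁ b₂ ν 0 - occ ν 0
  have hk : ∀ x, horOcc b₁ b₂ ν x = k + occ ν x := fun x => by
    linarith [horOcc_sub_occ_eq hν x]
  -- A step of either orientation has an end where its density vanishes. There `horOcc ≥ 0` gives `k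
  -- ≥ 0`, and `horOcc_le` gives `k * resetProb b₁ b₂ ≤ 0` in the limit.
  have key : ∀ F : Filter ℤ, F.NeBot → Tendsto (occ ν) F (𝓝 0) → k = 0 := fun F hF hlim => by
    refine le_antisymm ?_ ?_
    · have h1 : ∀ x, k * resetProb b₁ b₂ ≤ (1 - resetProb b₁ b₂) * occ ν x := fun x => by
        have := horOcc_le (b₁ := b₁) (b₂ := b₂) ν (x + 1)
        rw [add_sub_cancel_right, hk, hk] at this
        linarith
      have h2 := ge_of_tendsto' (hlim.const_mul (1 - resetProb b₁ b₂)) h1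
      rw [mul_zero] at h2
      nlinarith
    · have h1 : ∀ x, -k ≤ occ ν x := fun x => by
        linarith [hk x, horOcc_nonneg (b₁ := b₁) (b₂ := b₂) ν x]
      linarith [ge_of_tendsto' hlim h1]
  have hk0 : k = 0 := by
    cases e
    · exact key _ inferInstance he.1
    · exact key _ inferInstance he.2
  rw [hk, hk0, zero_add]

lemma ind_and_not_bounds (a b : Bool) : ind (a && !b) ≤ ind a ∧ ind (a && !b) ≤ 1 - ind b ∧
    ind a - ind b ≤ ind (a && !b) := by
  cases a <;> cases b <;> simp

lemma integral_and_not_bounds {X : Type*} [MeasurableSpace X] (μ : Measure X)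
    [IsProbabilityMeasure μ] {f g : X → Bool} (hf : Measurable f) (hg : Measurable g) :
    ∫ x, ind (f x && !g x) ∂μ ≤ ∫ x, ind (f x) ∂μ ∧
    ∫ x, ind (f x && !g x) ∂μ ≤ 1 - ∫ x, ind (g x) ∂μ ∧
    ∫ x, ind (f x) ∂μ - ∫ x, ind (g x) ∂μ ≤ ∫ x, ind (f x && !g x) ∂μ := by
  have i1 := integrable_ind hf μ
  have i2 := integrable_ind hg μ
  have i3 := integrable_ind (measurable_and_not.comp (hf.prodMk hg)) μ
  refine ⟨integral_mono i3 i1 fun x => (ind_and_not_bounds _ _).1, ?_, ?_⟩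
  · have : (1 : ℝ) = ∫ _, (1 : ℝ) ∂μ := by simp
    rw [this, ← integral_sub (integrable_const _) i2]
    exact integral_mono i3 ((integrable_const _).sub i2) fun x => (ind_and_not_bounds _ _).2.1
  · rw [← integral_sub i1 i2]
    exact integral_mono (i1.sub i2) i3 fun x => (ind_and_not_bounds _ _).2.2

lemma IsStationaryCoupling.dens_bounds {α β : Measure Config} {l : Measure (Config × Config)}
    (hl : IsStationaryCoupling b₁ b₂ α β l) (x : ℤ) : dens l x ≤ occ α x ∧
      dens l x ≤ 1 - occ β x ∧ occ α x - occ β x ≤ dens l x := by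
  have := hl.isProb
  rw [hl.occ_fst, hl.occ_snd]
  exact integral_and_not_bounds l ((measurable_pi_apply x).comp measurable_fst)
    ((measurable_pi_apply x).comp measurable_snd)

lemma IsStationaryCoupling.horDens_bounds {α β : Measure Config} {l : Measure (Config × Config)}
    (hl : IsStationaryCoupling b₁ b₂ α β l) (x : ℤ) : horDens b₁ b₂ l x ≤ horOcc b₁ b₂ α x ∧
      horDens b₁ b₂ l x ≤ 1 - horOcc b₁ b₂ β x ∧
      horOcc b₁ b₂ α x - horOcc b₁ b₂ β x ≤ horDens b₁ b₂ l x := by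
  have := hl.isProb
  have hm : Measurable fun q : Config × SiteNoise => ind (hor q.1 q.2 x) :=
    measurable_ind.comp (measurable_hor x)
  have m1 : Measurable (Prod.map Prod.fst id : (Config × Config) × SiteNoise → _) :=
    measurable_fst.prodMap measurable_id
  have m2 : Measurable (Prod.map Prod.snd id : (Config × Config) × SiteNoise → _) :=
    measurable_snd.prodMap measurable_id
  have e1 : α.prod (siteNoiseLaw b₁ b₂) = (l.prod (siteNoiseLaw b₁ b₂)).map
      (Prod.map Prod.fst id) := by
    rw [← Measure.map_prod_map _ _ measurable_fst measurable_id, Measure.map_id, hl.map_fst]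
  have e2 : β.prod (siteNoiseLaw b₁ b₂) = (l.prod (siteNoiseLaw b₁ b₂)).map
      (Prod.map Prod.snd id) := by
    rw [← Measure.map_prod_map _ _ measurable_snd measurable_id, Measure.map_id, hl.map_snd]
  rw [horOcc, horOcc, e1, e2, integral_map m1.aemeasurable hm.aestronglyMeasurable,
    integral_map m2.aemeasurable hm.aestronglyMeasurable]
  exact integral_and_not_bounds _ ((measurable_hor x).comp m1) ((measurable_hor x).comp m2)

/-- Two stationary steps have an ordered stationary coupling. -/
lemma exists_ordered_of_isStep (hb₁ : 0 < b₁) (h₁ : b₁ < 1) (hb₂ : 0 < b₂) (h₂ : b₂ < 1)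
    {α β : Measure Config} (hα : α ∈ invariantLaws b₁ b₂) (hβ : β ∈ invariantLaws b₁ b₂)
    {e e' : Bool} (he : IsStep e α) (he' : IsStep e' β) :
    ∃ l, IsStationaryCoupling b₁ b₂ α β l ∧ ∀ᵐ p ∂l, p.1 ≤ p.2 ∨ p.2 ≤ p.1 := by
  have := hα.1
  have := hβ.1
  obtain ⟨l, hl, -⟩ := exists_stationaryCoupling h₁ h₂ hα.2 hβ.2
    (ls := fun _ => α.prod β) (fun _ => inferInstance)
    (fun _ => by rw [Measure.map_fst_prod]; simp) (fun _ => by rw [Measure.map_snd_prod]; simp)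
    (S := fun k => k + 1) (fun k => k.lt_succ_self)
  have := hl.isProb
  refine ⟨l, hl, ae_ordered hb₁ h₁ hb₂ h₂ hl.stationary ?_⟩
  set D : ℤ → ℝ := fun x => dens l x - horDens b₁ b₂ l x
  -- By stationarity the total annihilation in a window is the difference of the flux `D` of
  -- positive discrepancies at its two ends.
  have hsum : ∀ N : ℕ, ∑ x ∈ Finset.Icc (-(N : ℤ)) N, annRate b₁ b₂ l (x + 1) =
      D (N + 1) - D (-N) := fun N => by
    rw [← sum_Icc_succ_sub]
    refine Finset.sum_congr rfl fun x _ => ?_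
    rw [annRate_eq, add_sub_cancel_right, hl.stationary]
    simp only [D]
    ring
  -- Since `horOcc = occ` for steps, both terms of `D` obey the same bounds. They tend to `0` if `α`
  -- becomes empty or `β` becomes full, and to `1` if `α` becomes full and `β` empty. In each case
  -- the difference vanishes.
  have hD : ∀ (F : Filter ℤ) (a b : Bool), Tendsto (occ α) F (𝓝 (ind a)) →
      Tendsto (occ β) F (𝓝 (ind b)) → Tendsto D F (𝓝 0) := by
    intro F a b ha hb
    have k1 := fun x => hl.dens_bounds x
    have k2 := fun x => hl.horDens_bounds x
    simp only [horOcc_eq_occ h₁ h₂ hα he, horOcc_eq_occ h₁ h₂ hβ he'] at k2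
    have k3 := fun x => dens_nonneg l x
    have k4 := fun x => horDens_nonneg b₁ b₂ l x
    cases a with
    | false =>
      refine squeeze_zero_norm (fun x => ?_) ha
      obtain ⟨p1, p2, p3⟩ := k1 x
      obtain ⟨q1, q2, q3⟩ := k2 x
      exact abs_le.2 ⟨by linarith [k3 x, k4 x], by linarith [k3 x, k4 x]⟩
    | true =>
      cases b with
      | true =>
        have hb' : Tendsto (fun x => 1 - occ β x) F (𝓝 0) := by simpa using hb.const_sub 1
        refine squeeze_zero_norm (fun x => ?_) hb'
        obtain ⟨p1, p2, p3⟩ := k1 x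
        obtain ⟨q1, q2, q3⟩ := k2 x
        exact abs_le.2 ⟨by linarith [k3 x, k4 x], by linarith [k3 x, k4 x]⟩
      | false =>
        have hb' : Tendsto (fun x => 1 - (occ α x - occ β x)) F (𝓝 0) := by
          simpa using (ha.sub hb).const_sub 1
        refine squeeze_zero_norm (fun x => ?_) hb'
        obtain ⟨p1, p2, p3⟩ := k1 x
        obtain ⟨q1, q2, q3⟩ := k2 x
        have o1 := occ_le_one α x
        exact abs_le.2 ⟨by linarith [k3 x, k4 x], by linarith [k3 x, k4 x]⟩
  have hlim : Tendsto (fun N : ℕ => D (N + 1) - D (-N)) atTop (𝓝 0) := by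
    have t1 : Tendsto (fun N : ℕ => (N : ℤ) + 1) atTop atTop :=
      tendsto_atTop_add_const_right _ _ tendsto_natCast_atTop_atTop
    have t2 : Tendsto (fun N : ℕ => -(N : ℤ)) atTop atBot :=
      tendsto_neg_atTop_atBot.comp tendsto_natCast_atTop_atTop
    simpa using ((hD _ _ _ he.2 he'.2).comp t1).sub ((hD _ _ _ he.1 he'.1).comp t2)
  intro x
  refine le_antisymm (ge_of_tendsto hlim ?_) (annRate_nonneg b₁ b₂ l x)
  filter_upwards [eventually_ge_atTop (x - 1).natAbs] with N hN
  rw [← hsum]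
  have hmem : x - 1 ∈ Finset.Icc (-(N : ℤ)) N := Finset.mem_Icc.2 (by omega)
  have := Finset.single_le_sum (f := fun x => annRate b₁ b₂ l (x + 1))
    (fun x _ => annRate_nonneg b₁ b₂ l (x + 1)) hmem
  simpa using this

/-- The number of particles in `(-K, K]`. -/
def particles (η : Config) (K : ℕ) : ℤ := ∑ i ∈ Finset.Ioc (-(K : ℤ)) K, if η i then 1 else 0

/-- The configurations which agree with `e` far to the left and with `!e` far to the right, with
excess `m` in comparison with the sharp step. -/
def packed (e : Bool) (m : ℤ) : Set Config :=
  {η | ∀ᶠ K : ℕ in atTop, (η (-K) = e ∧ η (K + 1) = !e) ∧ particles η K = K + m}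

lemma particles_succ (η : Config) (K : ℕ) : particles η (K + 1) = particles η K +
    ((if η (-K) then 1 else 0) + (if η (K + 1) then 1 else 0)) := by
  have e1 : Finset.Ioc (-((K + 1 : ℕ) : ℤ)) ((K + 1 : ℕ) : ℤ) =
      insert (-(K : ℤ)) (insert ((K : ℤ) + 1) (Finset.Ioc (-(K : ℤ)) K)) := by
    ext x; simp only [Finset.mem_insert, Finset.mem_Ioc]; push_cast; omega
  rw [particles, e1, Finset.sum_insert, Finset.sum_insert (by simp), particles]
  · ring
  · simp only [Finset.mem_insert, Finset.mem_Ioc]; omega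

lemma measurableSet_eventually {p : ℕ → Set Config} (h : ∀ K, MeasurableSet (p K)) :
    MeasurableSet {η | ∀ᶠ K in atTop, η ∈ p K} := by
  have : {η | ∀ᶠ K in atTop, η ∈ p K} = ⋃ K₀, ⋂ K, ⋂ (_ : K₀ ≤ K), p K := by
    ext η; simp [eventually_atTop]
  rw [this]
  exact MeasurableSet.iUnion fun K₀ => MeasurableSet.iInter fun K => MeasurableSet.iInter fun _ => h K

lemma measurable_particles (K : ℕ) : Measurable fun η : Config => particles η K := by
  refine Finset.measurable_fun_sum _ fun i _ => ?_
  exact (measurable_of_countable fun b : Bool => if b then (1 : ℤ) else 0).comp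
    (measurable_pi_apply i)

lemma measurableSet_packed (e : Bool) (m : ℤ) : MeasurableSet (packed e m) := by
  refine measurableSet_eventually (p := fun K => {η : Config | (η (-K) = e ∧ η (K + 1) = !e) ∧
    particles η K = K + m}) fun K => ?_
  exact ((measurableSet_apply_eq (measurable_pi_apply _) _).inter
    (measurableSet_apply_eq (measurable_pi_apply _) _)).inter
    (measurable_particles K (measurableSet_singleton _))

lemma packed_eventually {e : Bool} {m : ℤ} {η : Config} (h : η ∈ packed e m) :
    ∃ N : ℤ, (∀ x ≤ -N, η x = e) ∧ ∀ x > N, η x = !e := by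
  obtain ⟨K, hK⟩ := eventually_atTop.1 h
  refine ⟨K, fun x hx => ?_, fun x hx => ?_⟩
  · have := (hK (-x).toNat (by omega)).1.1
    rwa [Int.toNat_of_nonneg (by omega), neg_neg] at this
  · have := (hK (x - 1).toNat (by omega)).1.2
    rwa [Int.toNat_of_nonneg (by omega), sub_add_cancel] at this

lemma hor_eq_of_reset {η : Config} {u : SiteNoise} {y : ℤ} {b : Bool} (hy : IsReset u y) {x : ℤ}
    (hx : y ≤ x) (h : ∀ z, y ≤ z → z ≤ x → η z = b) : hor η u x = b := by
  induction x, hx using Int.leInduction with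
  | base => rw [hor_of_isReset hy, h y le_rfl le_rfl]
  | succ x hx ih =>
    have h1 := ih fun z hz hz' => h z hz (by omega)
    rw [hor_rec, add_sub_cancel_right, h1, h (x + 1) (by omega) le_rfl]
    cases b <;> simp

lemma sum_Ioc_succ (F : ℤ → ℤ) (K : ℕ) :
    ∑ x ∈ Finset.Ioc (-(K : ℤ)) K, (F (x + 1) - F x) = F (K + 1) - F (-K + 1) := by
  induction K with
  | zero => simp
  | succ K ih =>
    have e1 : Finset.Ioc (-((K + 1 : ℕ) : ℤ)) ((K + 1 : ℕ) : ℤ) =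
        insert (-(K : ℤ)) (insert ((K : ℤ) + 1) (Finset.Ioc (-(K : ℤ)) K)) := by
      ext x; simp only [Finset.mem_insert, Finset.mem_Ioc]; push_cast; omega
    rw [e1, Finset.sum_insert, Finset.sum_insert (by simp), ih]
    · push_cast
      have : -((K : ℤ) + 1) + 1 = -K := by ring
      rw [this]
      ring
    · simp only [Finset.mem_insert, Finset.mem_Ioc]; omega

/-- Transport of the particles by a flow `g` of particles: the excess is unchanged if in both ends
the flow agrees with the configuration. -/
lemma siteStep_mem_packed {u : SiteNoise} (hu : ManyResets u) {e : Bool} {m : ℤ} {η : Config}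
    (h : η ∈ packed e m) : siteStep η u ∈ packed e m := by
  obtain ⟨N, hl, hr⟩ := packed_eventually h
  obtain ⟨y, hy, hyr⟩ := (hu (N + 1)).2
  have h1 : ∀ x ≤ -N, hor η u x = e := fun x hx => by
    obtain ⟨z, hz, hzr⟩ := (hu x).1
    exact hor_eq_of_reset hzr hz fun w _ hw => hl w (by omega)
  have h2 : ∀ x ≥ y, hor η u x = !e := fun x hx =>
    hor_eq_of_reset hyr hx fun w hw _ => hr w (by omega)
  filter_upwards [h, eventually_ge_atTop (N + 2).toNat, eventually_ge_atTop y.toNat] with K hK hKN hKy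
  refine ⟨⟨?_, ?_⟩, ?_⟩
  · simp only [siteStep, out]
    rw [h1 _ (by omega), h1 _ (by omega), hl _ (by omega)]
    simp
  · simp only [siteStep, out]
    rw [h2 _ (by omega), h2 _ (by omega), hr _ (by omega)]
    simp
  -- The change of occupation is the discrete derivative of `η - hor`, which is zero at both ends,
  -- where `hor` agrees with `η`.
  · rw [← hK.2, particles, particles, ← sub_eq_zero, ← Finset.sum_sub_distrib]
    have e1 : ∀ x ∈ Finset.Ioc (-(K : ℤ)) K, ((if siteStep η u x then (1 : ℤ) else 0) -
        if η x then 1 else 0) = ((if η (x + 1) then (1 : ℤ) else 0) -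
        if hor η u (x + 1) then 1 else 0) - ((if η x then (1 : ℤ) else 0) -
        if hor η u x then 1 else 0) := fun x _ => by
      have := siteStep_sub_one η u (x + 1)
      rw [add_sub_cancel_right] at this
      rw [this, hor_rec η u (x + 1), add_sub_cancel_right]
      cases hor η u x <;> cases η (x + 1) <;> cases u (x + 1, false) <;>
        cases u (x + 1, true) <;> cases η x <;> simp
    rw [Finset.sum_congr rfl e1, sum_Ioc_succ (fun x => (if η x then (1 : ℤ) else 0) -
        if hor η u x then 1 else 0), h1 (-K + 1) (by omega), h2 (K + 1) (by omega),
        hl (-K + 1) (by omega), hr (K + 1) (by omega)]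
    simp

/-- In every large window the two ordered configurations have the same number of particles. -/
lemma eq_of_le_of_mem_packed {e : Bool} {m : ℤ} {η ξ : Config} (hη : η ∈ packed e m)
    (hξ : ξ ∈ packed e m) (h : η ≤ ξ) : η = ξ := by
  ext x : 1
  obtain ⟨K, ⟨h1, h2⟩, h3⟩ := ((hη.and hξ).and (eventually_ge_atTop (x.natAbs + 1))).exists
  have hle : ∀ i ∈ Finset.Ioc (-(K : ℤ)) K, (if η i then (1 : ℤ) else 0) ≤ if ξ i then 1 else 0 :=
    fun i _ => by
      have := h i
      revert this
      cases η i <;> cases ξ i <;> simp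
  have := (Finset.sum_eq_sum_iff_of_le hle).1 (h1.2.trans h2.2.symm) x
    (Finset.mem_Ioc.2 (by omega))
  revert this
  cases η x <;> cases ξ x <;> simp

lemma isStep_of_packed {ν : Measure Config} [IsProbabilityMeasure ν] {e : Bool} {m : ℤ}
    (h : ∀ᵐ η ∂ν, η ∈ packed e m) : IsStep e ν := by
  have key : ∀ (F : Filter ℤ) [F.IsCountablyGenerated] (b : Bool),
      (∀ η ∈ packed e m, ∀ᶠ x in F, η x = b) → Tendsto (occ ν) F (𝓝 (ind b)) := by
    intro F _ b hF
    have h1 : ind b = ∫ _, ind b ∂ν := by simp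
    rw [h1]
    refine tendsto_integral_filter_of_dominated_convergence (fun _ => 1)
      (Eventually.of_forall fun x =>
        (measurable_ind.comp (measurable_pi_apply x)).aestronglyMeasurable)
      (Eventually.of_forall fun x => ae_of_all _ fun η => abs_ind_le _) (integrable_const _) ?_
    filter_upwards [h] with η hη
    refine tendsto_const_nhds.congr' ?_
    filter_upwards [hF η hη] with x hx
    rw [hx]
  constructor
  · refine key _ _ fun η hη => ?_
    obtain ⟨N, hN, -⟩ := packed_eventually hη
    filter_upwards [eventually_le_atBot (-N)] with x hx using hN x hx
  · refine key _ _ fun η hη => ?_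
    obtain ⟨N, -, hN⟩ := packed_eventually hη
    filter_upwards [eventually_gt_atTop N] with x hx using hN x hx

end Flux

/-! ### Uniqueness on packed classes, and classification of extremal steps. -/

section PackedClasses

variable {b₁ b₂ : I}

lemma IsStationaryCoupling.ae_fst {α β : Measure Config} {l : Measure (Config × Config)}
    (hl : IsStationaryCoupling b₁ b₂ α β l) {p : Config → Prop} (h : ∀ᵐ η ∂α, p η) :
    ∀ᵐ q ∂l, p q.1 := by
  rw [← hl.map_fst] at h
  exact ae_of_ae_map measurable_fst.aemeasurable h

lemma IsStationaryCoupling.ae_snd {α β : Measure Config} {l : Measure (Config × Config)}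
    (hl : IsStationaryCoupling b₁ b₂ α β l) {p : Config → Prop} (h : ∀ᵐ η ∂β, p η) :
    ∀ᵐ q ∂l, p q.2 := by
  rw [← hl.map_snd] at h
  exact ae_of_ae_map measurable_snd.aemeasurable h

/-- There is at most one stationary measure on every class of packed configurations. -/
lemma eq_of_ae_mem_packed (hb₁ : 0 < b₁) (h₁ : b₁ < 1) (hb₂ : 0 < b₂) (h₂ : b₂ < 1)
    {α β : Measure Config} (hα : α ∈ invariantLaws b₁ b₂) (hβ : β ∈ invariantLaws b₁ b₂)
    {e : Bool} {m : ℤ} (hα' : ∀ᵐ η ∂α, η ∈ packed e m) (hβ' : ∀ᵐ η ∂β, η ∈ packed e m) :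
    α = β := by
  have := hα.1
  have := hβ.1
  -- Laws on packed classes are steps, hence have an ordered coupling; within one class, order means
  -- equality.
  obtain ⟨l, hl, hord⟩ := exists_ordered_of_isStep hb₁ h₁ hb₂ h₂ hα hβ (isStep_of_packed hα')
    (isStep_of_packed hβ')
  refine hl.eq_of_ae_eq ?_
  filter_upwards [hord, hl.ae_fst hα', hl.ae_snd hβ'] with p hp h1 h2
  rcases hp with hp | hp
  · exact eq_of_le_of_mem_packed h1 h2 hp
  · exact (eq_of_le_of_mem_packed h2 h1 hp).symm

lemma ae_of_smul_le {X : Type*} [MeasurableSpace X] {μ ν : Measure X} {c : ℝ≥0∞} (hc : c ≠ 0)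
    (h : c • μ ≤ ν) {p : X → Prop} (hp : ∀ᵐ x ∂ν, p x) : ∀ᵐ x ∂μ, p x := by
  rw [ae_iff] at hp ⊢
  have h1 := h {x | ¬ p x}
  rw [hp, Measure.smul_apply, smul_eq_mul, nonpos_iff_eq_zero, mul_eq_zero] at h1
  exact h1.resolve_left hc

lemma mem_extremal_of_packed (hb₁ : 0 < b₁) (h₁ : b₁ < 1) (hb₂ : 0 < b₂) (h₂ : b₂ < 1)
    {ν : Measure Config} (hν : ν ∈ invariantLaws b₁ b₂) {e : Bool} {m : ℤ}
    (h : ∀ᵐ η ∂ν, η ∈ packed e m) : ν ∈ extremal (invariantLaws b₁ b₂) :=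
  mem_extremal_of_forall hν fun _ hν' _ hp hle =>
    eq_of_ae_mem_packed hb₁ h₁ hb₂ h₂ hν' hν (ae_of_smul_le hp hle h) h

/-- The change of the excess under the shift by `1`. -/
def packedShift (e : Bool) : ℤ := if e then -1 else 1

lemma shift_mem_packed {e : Bool} {m : ℤ} {η : Config} (h : η ∈ packed e m) :
    shift 1 η ∈ packed e (m + packedShift e) := by
  obtain ⟨N, hl, hr⟩ := packed_eventually h
  filter_upwards [h, eventually_ge_atTop (N.natAbs + 2)] with K hK hKN
  refine ⟨⟨hl _ (by omega), hr _ (by omega)⟩, ?_⟩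
  rw [← add_assoc, ← hK.2, particles, particles, ← sub_eq_iff_eq_add', ← Finset.sum_sub_distrib]
  have := sum_Ioc_succ (fun x => if η x then 1 else 0) K
  refine this.trans ?_
  rw [hl (-K + 1) (by omega), hr (K + 1) (by omega), packedShift]
  cases e <;> simp

lemma ae_shift_mem_packed {ν : Measure Config} {e : Bool} {m : ℤ}
    (h : ∀ᵐ η ∂ν, η ∈ packed e m) :
    ∀ᵐ η ∂(ν.map (shift 1)), η ∈ packed e (m + packedShift e) := by
  exact (ae_map_iff (p := fun η => η ∈ packed e (m + packedShift e))
    (measurable_shift 1).aemeasurable (measurableSet_packed _ _)).2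
    (h.mono fun η => shift_mem_packed)

/-- Translation by one site maps the class `m` to the class `m + packedShift e`. By uniqueness all
`β n` are therefore translates of `β 0`. -/
lemma occ_packed_eq (hb₁ : 0 < b₁) (h₁ : b₁ < 1) (hb₂ : 0 < b₂) (h₂ : b₂ < 1) {e : Bool}
    {β : ℤ → Measure Config} (hβ : ∀ n, β n ∈ invariantLaws b₁ b₂)
    (hβ' : ∀ n, ∀ᵐ η ∂(β n), η ∈ packed e n) (x y : ℤ) :
    occ (β (packedShift e * x)) y = occ (β 0) (y + x) := by
  have key : ∀ m x, occ (β (m + packedShift e)) x = occ (β m) (x + 1) := fun m x => by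
    rw [← occ_map_shift, eq_of_ae_mem_packed hb₁ h₁ hb₂ h₂
      (map_shift_mem_invariantLaws (hβ m) 1) (hβ _) (ae_shift_mem_packed (hβ' m)) (hβ' _)]
  induction x using Int.induction_on generalizing y with
  | zero => simp
  | succ n ih => rw [mul_add, mul_one, key, ih, add_assoc, add_comm (1 : ℤ)]
  | pred n ih =>
    have := key (packedShift e * (-(n : ℤ) - 1)) (y - 1)
    rw [sub_add_cancel] at this
    rw [← this, mul_sub, mul_one, sub_add_cancel, ih]
    congr 1
    ring

lemma exists_packed {e : Bool} {η : Config} (h : ∀ᶠ K : ℕ in atTop, η (-K) = e ∧ η (K + 1) = !e) :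
    ∃ m, η ∈ packed e m := by
  obtain ⟨K₀, hK₀⟩ := eventually_atTop.1 h
  refine ⟨particles η K₀ - K₀, eventually_atTop.2 ⟨K₀, fun K hK => ⟨hK₀ K hK, ?_⟩⟩⟩
  induction K, hK using Nat.le_induction with
  | base => ring
  | succ K hK ih =>
    rw [particles_succ, ih, (hK₀ K hK).1, (hK₀ K hK).2]
    push_cast
    cases e <;> simp <;> ring

/-- An order between the two coordinates transfers the value `b` from the second to the first: full
sites if the first is the larger one, empty sites if it is the smaller one. So the first is packed
at the end where the class has the value `b`. -/
lemma ae_eventually_left {α β : Measure Config} {l : Measure (Config × Config)}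
    (hl : IsStationaryCoupling b₁ b₂ α β l) {e : Bool} {m : ℤ} (hβ : ∀ᵐ η ∂β, η ∈ packed e m)
    {b : Bool} (hb : ∀ᵐ p ∂l, ∀ x, p.2 x = b → p.1 x = b) :
    ∀ᵐ η ∂α, ∀ᶠ K : ℕ in atTop, (e = b → η (-K) = e) ∧ ((!e) = b → η (K + 1) = !e) := by
  have hm : MeasurableSet {η : Config | ∀ᶠ K : ℕ in atTop,
      (e = b → η (-K) = e) ∧ ((!e) = b → η (K + 1) = !e)} := by
    refine measurableSet_eventually (p := fun K => {η : Config | (e = b → η (-K) = e) ∧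
      ((!e) = b → η (K + 1) = !e)}) fun K => ?_
    refine MeasurableSet.inter ?_ ?_
    · by_cases h : e = b
      · simp only [h, forall_const]
        exact measurableSet_apply_eq (f := fun η : Config => η (-(K : ℤ))) (measurable_pi_apply _) b
      · simp only [h, false_imp_iff]
        exact MeasurableSet.univ
    · by_cases h : (!e) = b
      · simp only [h, forall_const]
        exact measurableSet_apply_eq (f := fun η : Config => η ((K : ℤ) + 1)) (measurable_pi_apply _) b
      · simp only [h, false_imp_iff]
        exact MeasurableSet.univ
  rw [← hl.map_fst, ae_map_iff measurable_fst.aemeasurable hm]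
  filter_upwards [hb, hl.ae_snd hβ] with p hp hp2
  filter_upwards [hp2] with K hK
  refine ⟨fun h => ?_, fun h => ?_⟩
  · rw [h]; exact hp _ (by rw [hK.1.1, h])
  · rw [h]; exact hp _ (by rw [hK.1.2, h])

lemma cond_packed_mem (h₁ : b₁ < 1) (h₂ : b₂ < 1) {ν : Measure Config}
    (hν : ν ∈ invariantLaws b₁ b₂) {e : Bool} {m : ℤ} (h : ν (packed e m) ≠ 0) :
    ProbabilityTheory.cond ν (packed e m) ∈ invariantLaws b₁ b₂ := by
  have := hν.1
  refine ⟨cond_isProbabilityMeasure h, ?_⟩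
  rw [ProbabilityTheory.cond, siteEvolve, evolve_smul]
  congr 1
  exact evolve_restrict_of_absorbing measurable_siteStep hν.2 (measurableSet_packed e m)
    fun η hη => (ae_manyResets h₁ h₂).mono fun u hu => siteStep_mem_packed hu hη

/-- An extremal step is one of the measures on the classes of packed configurations. -/
lemma exists_eq_of_isStep (hb₁ : 0 < b₁) (h₁ : b₁ < 1) (hb₂ : 0 < b₂) (h₂ : b₂ < 1) {e : Bool}
    {β : ℤ → Measure Config} (hβ : ∀ n, β n ∈ invariantLaws b₁ b₂)
    (hβ' : ∀ n, ∀ᵐ η ∂(β n), η ∈ packed e n) {ν : Measure Config}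
    (hν : ν ∈ extremal (invariantLaws b₁ b₂)) {e' : Bool} (he' : IsStep e' ν) : ∃ n, β n = ν := by
  have hP := hν.1.1
  have hβP := fun n => (hβ n).1
  have hβe := fun n => mem_extremal_of_packed hb₁ h₁ hb₂ h₂ (hβ n) (hβ' n)
  have hst := isStep_of_packed (hβ' 0)
  have hocc := occ_packed_eq hb₁ h₁ hb₂ h₂ hβ hβ'
  have hdich : ∀ n, (∃ l, IsStationaryCoupling b₁ b₂ ν (β n) l ∧ ∀ᵐ p ∂l, p.1 ≤ p.2) ∨
      ∃ l, IsStationaryCoupling b₁ b₂ ν (β n) l ∧ ∀ᵐ p ∂l, p.2 ≤ p.1 := fun n => by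
    obtain ⟨l, hl, hord⟩ := exists_ordered_of_isStep hb₁ h₁ hb₂ h₂ hν.1 (hβ n) he'
      (isStep_of_packed (hβ' n))
    exact hl.exists_le_or_ge hν (hβe n) hord
  -- Moving the step far away in one direction or the other turns it into the empty or the full
  -- configuration near `y`.
  have hlim : ∀ (b : Bool) (y : ℤ), ∃ F : Filter ℤ, F.NeBot ∧
      Tendsto (fun x => occ (β (packedShift e * x)) y) F (𝓝 (ind b)) := fun b y => by
    simp only [hocc]
    by_cases hb : b = e
    · exact ⟨atBot, inferInstance, by rw [hb]; exact hst.1.comp (tendsto_atBot_add_const_left _ y tendsto_id)⟩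
    · have hb' : b = !e := by cases b <;> cases e <;> simp_all
      exact ⟨atTop, inferInstance, by rw [hb']; exact hst.2.comp (tendsto_atTop_add_const_left _ y tendsto_id)⟩
  have hmono : ∀ {μ μ' : Measure Config} {l}, IsStationaryCoupling b₁ b₂ μ μ' l →
      (∀ᵐ p ∂l, p.1 ≤ p.2) → ∀ y, occ μ y ≤ occ μ' y := fun hl hle y => by
    have := hl.isProb
    rw [hl.occ_fst, hl.occ_snd]
    exact integral_mono_ae (integrable_ind ((measurable_pi_apply y).comp measurable_fst) _)
      (integrable_ind ((measurable_pi_apply y).comp measurable_snd) _)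
      (hle.mono fun p hp => ind_mono (hp y))
  -- The density of the step `ν` has different limits at its two ends.
  have hends : ∀ b : Bool, ¬ ∀ y, occ ν y = ind b := fun b hb => by
    rcases Bool.eq_or_eq_not e' b with h | h
    · have h1 : ind b = ind !e' := tendsto_nhds_unique
        (tendsto_const_nhds.congr fun y => (hb y).symm) he'.2
      rw [h] at h1
      cases b <;> simp at h1
    · have h1 : ind b = ind e' := tendsto_nhds_unique
        (tendsto_const_nhds.congr fun y => (hb y).symm) he'.1
      rw [h] at h1
      cases b <;> simp at h1
  -- If `ν` were never above any `β n`, it would be below all of them, hence empty. The next step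
  -- excludes in the same way that `ν` is above all of them.
  obtain ⟨n, ln, hln, hge⟩ : ∃ n l, IsStationaryCoupling b₁ b₂ ν (β n) l ∧ ∀ᵐ p ∂l, p.2 ≤ p.1 := by
    by_contra hcon
    refine hends false fun y => le_antisymm ?_ (occ_nonneg ν y)
    obtain ⟨F, hF, hFl⟩ := hlim false y
    refine ge_of_tendsto' hFl fun x => ?_
    obtain ⟨l, hl, hle⟩ := (hdich (packedShift e * x)).resolve_right fun h => hcon ⟨_, h⟩
    exact hmono hl hle y
  obtain ⟨m, lm, hlm, hle⟩ : ∃ n l, IsStationaryCoupling b₁ b₂ ν (β n) l ∧ ∀ᵐ p ∂l, p.1 ≤ p.2 := by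
    by_contra hcon
    refine hends true fun y => le_antisymm (occ_le_one ν y) ?_
    obtain ⟨F, hF, hFl⟩ := hlim true y
    refine le_of_tendsto' hFl fun x => ?_
    obtain ⟨l, hl, hle⟩ := (hdich (packedShift e * x)).resolve_left fun h => hcon ⟨_, h⟩
    have := hl.isProb
    refine hmono hl.swap ?_ y
    rw [ae_map_iff measurable_swap.aemeasurable measurableSet_le]
    exact hle
  have h1 := ae_eventually_left hln (hβ' n) (b := true) (hge.mono fun p hp x hx => by
    have := hp x; rw [hx] at this; exact top_le_iff.1 this)
  have h2 := ae_eventually_left hlm (hβ' m) (b := false) (hle.mono fun p hp x hx => by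
    have := hp x; rw [hx] at this; exact le_bot_iff.1 this)
  -- The lower bound `β n` fills the full end, and the upper bound `β m` empties the other one.
  have h3 : ∀ᵐ η ∂ν, ∃ k, η ∈ packed e k := by
    filter_upwards [h1, h2] with η h1 h2
    refine exists_packed ?_
    filter_upwards [h1, h2] with K h1 h2
    cases e
    · exact ⟨h2.1 rfl, h1.2 rfl⟩
    · exact ⟨h1.1 rfl, h2.2 rfl⟩
  -- Some class has positive mass. Conditioning on it does not change the extremal `ν`, so `ν` lives
  -- on this class.
  obtain ⟨k, hk⟩ : ∃ k, ν (packed e k) ≠ 0 := by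
    by_contra! hcon
    have h4 : ν (⋃ k, packed e k) = 0 := measure_iUnion_null hcon
    have h5 : ∀ᵐ η ∂ν, False := by
      filter_upwards [h3, measure_eq_zero_iff_ae_notMem.1 h4] with η h3 h4
      exact h4 (Set.mem_iUnion.2 h3)
    simpa using h5.exists
  refine ⟨k, ?_⟩
  have hcs := cond_packed_mem h₁ h₂ hν.1 hk
  have hcl : ν (packed e k) • ProbabilityTheory.cond ν (packed e k) ≤ ν := by
    rw [ProbabilityTheory.cond, smul_smul, ENNReal.mul_inv_cancel hk (measure_ne_top _ _), one_smul]
    exact Measure.restrict_le_self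
  have hcν := eq_of_smul_le_of_mem_extremal hν hcs hk hcl
  have hae := ae_mem_cond (l := ν) (measurableSet_packed e k)
  rw [hcν] at hae
  exact eq_of_ae_mem_packed hb₁ h₁ hb₂ h₂ (hβ k) hν.1 (hβ' k) hae

end PackedClasses

/-! ### Product inputs at a single vertex. -/

section ProductLaws

/-- The inhomogeneous Bernoulli product measure. -/
def productLaw (f : ℤ → I) : Measure Config :=
  Measure.infinitePi fun x => bernoulliMeasure true false (f x)

instance (f : ℤ → I) : IsProbabilityMeasure (productLaw f) := by
  unfold productLaw; infer_instance

/-- The mean of a function of a Bernoulli variable. -/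
def bernoulliMean (p : I) (k : Bool → ℝ) : ℝ := p * k true + (1 - p) * k false

variable {b₁ b₂ : I}

lemma hor_update_left (η : Config) (u : SiteNoise) {x y : ℤ} (h : y < x) (v : Bool) :
    hor (Function.update η x v) u y = hor η u y := by
  have : ∀ z ≤ y, Function.update η x v z = η z := fun z hz => by
    rw [Function.update_of_ne (by omega)]
  rw [Bool.eq_iff_iff, hor_eq_true, hor_eq_true]
  constructor <;> rintro ⟨z, hz, h1, h2, h3⟩ <;> refine ⟨z, hz, ?_, h2, fun a ha ha' => ?_⟩
  · rwa [this z hz] at h1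
  · simpa only [this a ha'] using h3 a ha ha'
  · rwa [this z hz]
  · simpa only [this a ha'] using h3 a ha ha'

/-- The variables at the site `x` are independent of functions which do not depend on them. -/
lemma integral_mul_site (f : ℤ → I) {x : ℤ} {X : Config → SiteNoise → ℝ}
    (hX : Measurable fun q : Config × SiteNoise => X q.1 q.2) {C : ℝ} (hC : ∀ η u, |X η u| ≤ C)
    (hX1 : ∀ η u v, X (Function.update η x v) u = X η u)
    (hX2 : ∀ η u i v, X η (Function.update u (x, i) v) = X η u) (k k₁ k₂ : Bool → ℝ) :
    ∫ q, X q.1 q.2 * k (q.1 x) * k₁ (q.2 (x, false)) * k₂ (q.2 (x, true))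
      ∂((productLaw f).prod (siteNoiseLaw b₁ b₂)) =
    (∫ q, X q.1 q.2 ∂((productLaw f).prod (siteNoiseLaw b₁ b₂))) * bernoulliMean (f x) k *
      bernoulliMean (σ b₁) k₁ * bernoulliMean b₂ k₂ := by
  have hb : ∀ k : Bool → ℝ, ∃ D, ∀ b, |k b| ≤ D := fun k =>
    ⟨max |k true| |k false|, fun b => by cases b <;> simp⟩
  have hkm : ∀ k : Bool → ℝ, Measurable k := fun k => measurable_of_countable k
  obtain ⟨D, hD⟩ := hb k
  obtain ⟨D₁, hD₁⟩ := hb k₁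
  obtain ⟨D₂, hD₂⟩ := hb k₂
  have hC0 : 0 ≤ C := (abs_nonneg _).trans (hC (fun _ => false) fun _ => false)
  have hD0 : 0 ≤ D := (abs_nonneg _).trans (hD true)
  have hD10 : 0 ≤ D₁ := (abs_nonneg _).trans (hD₁ true)
  have hmk : Measurable fun q : Config × SiteNoise => k (q.1 x) :=
    (hkm k).comp ((measurable_pi_apply x).comp measurable_fst)
  have hmn : ∀ (k : Bool → ℝ) (i : Bool), Measurable fun q : Config × SiteNoise => k (q.2 (x, i)) :=
    fun k i => (hkm k).comp ((measurable_pi_apply (x, i)).comp measurable_snd)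
  have hb1 : ∀ η u, |X η u * k (η x)| ≤ C * D := fun η u => by
    rw [abs_mul]; exact mul_le_mul (hC η u) (hD _) (abs_nonneg _) hC0
  have hb2 : ∀ η u, |X η u * k (η x) * k₁ (u (x, false))| ≤ C * D * D₁ := fun η u => by
    rw [abs_mul]; exact mul_le_mul (hb1 η u) (hD₁ _) (abs_nonneg _) (by positivity)
  have hb3 : ∀ η u, |X η u * k (η x) * k₁ (u (x, false)) * k₂ (u (x, true))| ≤ C * D * D₁ * D₂ :=
    fun η u => by
      rw [abs_mul]; exact mul_le_mul (hb2 η u) (hD₂ _) (abs_nonneg _) (by positivity)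
  have hm1 : Measurable fun q : Config × SiteNoise => X q.1 q.2 * k (q.1 x) := hX.mul hmk
  have hm2 : Measurable fun q : Config × SiteNoise => X q.1 q.2 * k (q.1 x) * k₁ (q.2 (x, false)) :=
    hm1.mul (hmn k₁ false)
  have e1 : ∫ q, X q.1 q.2 * k (q.1 x) * k₁ (q.2 (x, false)) * k₂ (q.2 (x, true))
      ∂((productLaw f).prod (siteNoiseLaw b₁ b₂)) =
      (∫ q, X q.1 q.2 * k (q.1 x) ∂((productLaw f).prod (siteNoiseLaw b₁ b₂))) *
        bernoulliMean (σ b₁) k₁ * bernoulliMean b₂ k₂ := by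
    rw [integral_prod_noise (g := fun η u => X η u * k (η x) * k₁ (u (x, false)) * k₂ (u (x, true)))
      (hm2.mul (hmn k₂ true)) hb3, integral_prod_noise (g := fun η u => X η u * k (η x)) hm1 hb1,
      ← integral_mul_const, ← integral_mul_const]
    refine integral_congr_ae (ae_of_all _ fun η => ?_)
    have h1 := integral_infinitePi_mul_coord
      (fun p : ℤ × Bool => bernoulliMeasure true false (bif p.2 then b₂ else σ b₁)) (i := (x, true))
      (f := fun u => X η u * k (η x) * k₁ (u (x, false))) (k := k₂)
      (hm2.comp measurable_prodMk_left)
      (fun u v => by rw [hX2, Function.update_of_ne (by simp)]) (hkm k₂)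
    have h2 := integral_infinitePi_mul_coord
      (fun p : ℤ × Bool => bernoulliMeasure true false (bif p.2 then b₂ else σ b₁)) (i := (x, false))
      (f := fun u => X η u * k (η x)) (k := k₁) (hm1.comp measurable_prodMk_left)
      (fun u v => by rw [hX2]) (hkm k₁)
    rw [h2] at h1
    simp only [cond_true, cond_false, integral_bernoulliMeasure_bool] at h1
    exact h1
  have e2 : ∫ q, X q.1 q.2 * k (q.1 x) ∂((productLaw f).prod (siteNoiseLaw b₁ b₂)) =
      (∫ q, X q.1 q.2 ∂((productLaw f).prod (siteNoiseLaw b₁ b₂))) * bernoulliMean (f x) k := by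
    rw [integral_prod_symm _ (Integrable.of_bound hm1.aestronglyMeasurable _
      (ae_of_all _ fun q => hb1 q.1 q.2)), integral_prod_symm _ (Integrable.of_bound
      hX.aestronglyMeasurable _ (ae_of_all _ fun q => hC q.1 q.2)), ← integral_mul_const]
    refine integral_congr_ae (ae_of_all _ fun u => ?_)
    have h1 := integral_infinitePi_mul_coord (fun x => bernoulliMeasure true false (f x)) (i := x)
      (f := fun η => X η u) (k := k) (hX.comp measurable_prodMk_right) (fun η v => hX1 η u v) (hkm k)
    rw [integral_bernoulliMeasure_bool] at h1
    exact h1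
  rw [e1, e2]

/-- The local computation at one vertex. -/
lemma integral_vertex (f : ℤ → I) {x : ℤ} {X : Config → SiteNoise → ℝ}
    (hX : Measurable fun q : Config × SiteNoise => X q.1 q.2) {C : ℝ} (hC : ∀ η u, |X η u| ≤ C)
    (hX1 : ∀ η u v, X (Function.update η x v) u = X η u)
    (hX2 : ∀ η u i v, X η (Function.update u (x, i) v) = X η u) (k φ : Bool → ℝ) :
    ∫ q, X q.1 q.2 * (k (out q.1 q.2 x) * φ (hor q.1 q.2 x))
      ∂((productLaw f).prod (siteNoiseLaw b₁ b₂)) =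
    (∫ q, X q.1 q.2 * ind (hor q.1 q.2 (x - 1)) ∂((productLaw f).prod (siteNoiseLaw b₁ b₂))) *
      (f x * (k true * φ true) + (1 - f x) * (b₂ * (k false * φ true) +
        (1 - b₂) * (k true * φ false))) +
    (∫ q, X q.1 q.2 * ind (!hor q.1 q.2 (x - 1)) ∂((productLaw f).prod (siteNoiseLaw b₁ b₂))) *
      ((1 - f x) * (k false * φ false) + f x * ((1 - b₁) * (k false * φ true) +
        b₁ * (k true * φ false))) := by
  set P := (productLaw f).prod (siteNoiseLaw b₁ b₂)
  have hC0 : 0 ≤ C := (abs_nonneg _).trans (hC (fun _ => false) fun _ => false)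
  have hkm : ∀ k : Bool → ℝ, Measurable k := fun k => measurable_of_countable k
  have hmh : ∀ ψ : Bool → ℝ, Measurable fun q : Config × SiteNoise =>
      X q.1 q.2 * ψ (hor q.1 q.2 (x - 1)) := fun ψ => hX.mul ((hkm ψ).comp (measurable_hor _))
  have hi : ∀ (ψ k k₁ k₂ : Bool → ℝ), Integrable (fun q : Config × SiteNoise =>
      X q.1 q.2 * ψ (hor q.1 q.2 (x - 1)) * k (q.1 x) * k₁ (q.2 (x, false)) * k₂ (q.2 (x, true)))
      P := fun ψ k k₁ k₂ => by
    have hb : ∀ k : Bool → ℝ, ∃ D, ∀ b, |k b| ≤ D := fun k =>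
      ⟨max |k true| |k false|, fun b => by cases b <;> simp⟩
    obtain ⟨D₀, hD₀⟩ := hb ψ
    obtain ⟨D, hD⟩ := hb k
    obtain ⟨D₁, hD₁⟩ := hb k₁
    obtain ⟨D₂, hD₂⟩ := hb k₂
    refine Integrable.of_bound ((((hmh ψ).mul ((hkm k).comp ((measurable_pi_apply x).comp
      measurable_fst))).mul ((hkm k₁).comp ((measurable_pi_apply (x, false)).comp
      measurable_snd))).mul ((hkm k₂).comp ((measurable_pi_apply (x, true)).comp
      measurable_snd))).aestronglyMeasurable (C * D₀ * D * D₁ * D₂) (ae_of_all _ fun q => ?_)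
    simp only [Real.norm_eq_abs, abs_mul]
    have := hC q.1 q.2
    have := hD₀ (hor q.1 q.2 (x - 1))
    have := hD (q.1 x)
    have := hD₁ (q.2 (x, false))
    have := hD₂ (q.2 (x, true))
    have : 0 ≤ D₀ := (abs_nonneg _).trans (hD₀ true)
    have : 0 ≤ D := (abs_nonneg _).trans (hD true)
    have : 0 ≤ D₁ := (abs_nonneg _).trans (hD₁ true)
    gcongr
  have hs : ∀ (ψ k k₁ k₂ : Bool → ℝ), ∫ q, X q.1 q.2 * ψ (hor q.1 q.2 (x - 1)) * k (q.1 x) *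
      k₁ (q.2 (x, false)) * k₂ (q.2 (x, true)) ∂P = (∫ q, X q.1 q.2 * ψ (hor q.1 q.2 (x - 1)) ∂P) *
      bernoulliMean (f x) k * bernoulliMean (σ b₁) k₁ * bernoulliMean b₂ k₂ := by
    intro ψ k k₁ k₂
    obtain ⟨D, hD⟩ : ∃ D, ∀ b, |ψ b| ≤ D := ⟨max |ψ true| |ψ false|, fun b => by cases b <;> simp⟩
    refine integral_mul_site f (X := fun η u => X η u * ψ (hor η u (x - 1))) (hmh ψ) (C := C * D)
      (fun η u => ?_) (fun η u v => ?_) (fun η u i v => ?_) k k₁ k₂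
    · rw [abs_mul]; exact mul_le_mul (hC η u) (hD _) (abs_nonneg _) hC0
    · rw [hX1, hor_update_left _ _ (by omega)]
    · rw [hX2, hor_update _ _ (by omega)]
  set n : Bool → ℝ := fun b => ind !b
  set o : Bool → ℝ := fun _ => 1
  -- The six summands are the six types of vertices, each written as a product of functions of
  -- independent inputs.
  have e : ∀ q : Config × SiteNoise, X q.1 q.2 * (k (out q.1 q.2 x) * φ (hor q.1 q.2 x)) =
      (k true * φ true) * (X q.1 q.2 * ind (hor q.1 q.2 (x - 1)) * ind (q.1 x) *
        o (q.2 (x, false)) * o (q.2 (x, true))) +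
      ((k false * φ true) * (X q.1 q.2 * ind (hor q.1 q.2 (x - 1)) * n (q.1 x) *
        o (q.2 (x, false)) * ind (q.2 (x, true))) +
      ((k true * φ false) * (X q.1 q.2 * ind (hor q.1 q.2 (x - 1)) * n (q.1 x) *
        o (q.2 (x, false)) * n (q.2 (x, true))) +
      ((k false * φ false) * (X q.1 q.2 * n (hor q.1 q.2 (x - 1)) * n (q.1 x) *
        o (q.2 (x, false)) * o (q.2 (x, true))) +
      ((k false * φ true) * (X q.1 q.2 * n (hor q.1 q.2 (x - 1)) * ind (q.1 x) *
        ind (q.2 (x, false)) * o (q.2 (x, true))) +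
      (k true * φ false) * (X q.1 q.2 * n (hor q.1 q.2 (x - 1)) * ind (q.1 x) *
        n (q.2 (x, false)) * o (q.2 (x, true))))))) := fun q => by
    rw [out, hor_rec q.1 q.2 x]
    simp only [n, o]
    cases hor q.1 q.2 (x - 1) <;> cases q.1 x <;> cases q.2 (x, false) <;>
      cases q.2 (x, true) <;> simp <;> ring
  simp only [e]
  have j := fun (c : ℝ) ψ k k₁ k₂ => (hi ψ k k₁ k₂).const_mul c
  have ha : ∀ {F G : Config × SiteNoise → ℝ}, Integrable F P → Integrable G P →
      Integrable (fun q => F q + G q) P := fun hF hG => hF.add hG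
  rw [integral_add (j _ _ _ _ _) (ha (j _ _ _ _ _) (ha (j _ _ _ _ _) (ha (j _ _ _ _ _)
      (ha (j _ _ _ _ _) (j _ _ _ _ _))))),
    integral_add (j _ _ _ _ _) (ha (j _ _ _ _ _) (ha (j _ _ _ _ _)
      (ha (j _ _ _ _ _) (j _ _ _ _ _)))),
    integral_add (j _ _ _ _ _) (ha (j _ _ _ _ _) (ha (j _ _ _ _ _) (j _ _ _ _ _))),
    integral_add (j _ _ _ _ _) (ha (j _ _ _ _ _) (j _ _ _ _ _)),
    integral_add (j _ _ _ _ _) (j _ _ _ _ _)]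
  simp only [integral_const_mul]
  rw [hs ind ind o o, hs ind n o ind, hs ind n o n, hs n n o o, hs n ind ind o, hs n ind n o]
  simp only [bernoulliMean, n, o, ind_true, ind_false, Bool.not_true,
    Bool.not_false, unitInterval.coe_symm_eq]
  ring

end ProductLaws

/-! ### Local balance implies stationarity. -/

section BalancedProductLaws

variable {b₁ b₂ : I}

/-- The densities `f` of vertical and `g` of horizontal arrows are in local balance: independent
Bernoulli inputs at the vertex `x` have independent Bernoulli outputs. -/
structure IsBalanced (b₁ b₂ : I) (f g : ℤ → I) : Prop where
  step (x : ℤ) : (g x : ℝ) = f x * (1 - b₁) + g (x - 1) * (f x * b₁ + (1 - f x) * b₂)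
  conservation (x : ℤ) : (f x : ℝ) + g (x - 1) = f (x - 1) + g x
  mul_eq (x : ℤ) : (f x : ℝ) * g (x - 1) = f (x - 1) * g x

lemma horOcc_productLaw (f : ℤ → I) (x : ℤ) : horOcc b₁ b₂ (productLaw f) x =
    f x * (1 - b₁) + horOcc b₁ b₂ (productLaw f) (x - 1) * (f x * b₁ + (1 - f x) * b₂) := by
  have h := integral_vertex (b₁ := b₁) (b₂ := b₂) f (x := x) (X := fun _ _ => 1) measurable_const
    (C := 1) (fun _ _ => by simp) (fun _ _ _ => rfl) (fun _ _ _ _ => rfl) (fun _ => 1) ind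
  have e : ∀ b, ind (!b) = 1 - ind b := fun b => by cases b <;> simp
  simp only [one_mul, ind_true, ind_false, mul_zero, mul_one, add_zero, e] at h
  rw [integral_sub (integrable_const _) (integrable_ind (measurable_hor _) _)] at h
  simp only [integral_const, probReal_univ, smul_eq_mul, mul_one] at h
  rw [horOcc, horOcc, h]
  ring

/-- Both sides solve the same affine recursion, whose factor is at most `max b₁ b₂ < 1`. Since they
are bounded, following it `n` steps to the left leaves a difference of at most `c ^ n`. -/
lemma IsBalanced.horOcc_eq (h₁ : b₁ < 1) (h₂ : b₂ < 1) {f g : ℤ → I} (h : IsBalanced b₁ b₂ f g)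
    (x : ℤ) : horOcc b₁ b₂ (productLaw f) x = g x := by
  set c : ℝ := max b₁ b₂
  have hc0 : 0 ≤ c := le_max_of_le_left b₁.2.1
  have hc1 : c < 1 := max_lt h₁ h₂
  have key : ∀ n : ℕ, ∀ x, |horOcc b₁ b₂ (productLaw f) x - g x| ≤ c ^ n := by
    intro n
    induction n with
    | zero =>
      intro x
      have k1 := horOcc_nonneg (b₁ := b₁) (b₂ := b₂) (productLaw f) x
      have k2 := horOcc_le_one (b₁ := b₁) (b₂ := b₂) (productLaw f) x
      have k3 := (g x).2.1
      have k4 := (g x).2.2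
      rw [pow_zero, abs_le]
      constructor <;> linarith
    | succ n ih =>
      intro x
      have e : horOcc b₁ b₂ (productLaw f) x - g x = (f x * b₁ + (1 - f x) * b₂) *
          (horOcc b₁ b₂ (productLaw f) (x - 1) - g (x - 1)) := by
        rw [horOcc_productLaw, h.step x]; ring
      have k3 := (f x).2.1
      have k4 : (0 : ℝ) ≤ 1 - f x := sub_nonneg.2 (f x).2.2
      have k5 : (b₁ : ℝ) ≤ c := le_max_left _ _
      have k6 : (b₂ : ℝ) ≤ c := le_max_right _ _
      have k7 : (f x : ℝ) * b₁ + (1 - f x) * b₂ ≤ c := by nlinarith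
      have k8 : 0 ≤ (f x : ℝ) * b₁ + (1 - f x) * b₂ :=
        add_nonneg (mul_nonneg k3 b₁.2.1) (mul_nonneg k4 b₂.2.1)
      rw [e, abs_mul, abs_of_nonneg k8, pow_succ']
      exact mul_le_mul k7 (ih (x - 1)) (abs_nonneg _) hc0
  have h0 := ge_of_tendsto' (tendsto_pow_atTop_nhds_zero_of_lt_one hc0 hc1) fun n => key n x
  exact sub_eq_zero.1 (abs_nonpos_iff.1 h0)

lemma out_update_left (η : Config) (u : SiteNoise) {x y : ℤ} (h : y < x) (v : Bool) :
    out (Function.update η x v) u y = out η u y := by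
  rw [out, out, hor_update_left _ _ h, hor_update_left _ _ (by omega),
    Function.update_of_ne (by omega)]

lemma out_update (η : Config) (u : SiteNoise) {x y : ℤ} (h : y < x) (i v : Bool) :
    out η (Function.update u (x, i) v) y = out η u y := by
  rw [out, out, hor_update _ _ h, hor_update _ _ (by omega)]

/-- A Burke property: the vertical outputs of consecutive vertices are independent of one another
and of the last horizontal output. The test function `φ` is arbitrary because the induction step
needs `ind` and its complement for the arrow that enters the next vertex. -/
lemma IsBalanced.integral_prod_out (h₁ : b₁ < 1) (h₂ : b₂ < 1) {f g : ℤ → I}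
    (h : IsBalanced b₁ b₂ f g) {k : ℤ → Bool → ℝ} (hk : ∀ i b, |k i b| ≤ 1) (m : ℤ) (n : ℕ)
    (φ : Bool → ℝ) :
    ∫ q, (∏ i ∈ Finset.range n, k (m + i) (out q.1 q.2 (m + i))) * φ (hor q.1 q.2 (m + n - 1))
      ∂((productLaw f).prod (siteNoiseLaw b₁ b₂)) =
    (∏ i ∈ Finset.range n, bernoulliMean (f (m + i - 1)) (k (m + i))) *
      bernoulliMean (g (m + n - 1)) φ := by
  have hd : ∀ φ : Bool → ℝ, ∀ b, φ b = φ false + (φ true - φ false) * ind b := fun φ b => by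
    cases b <;> simp
  induction n generalizing φ with
  | zero =>
    simp only [Finset.range_zero, Finset.prod_empty, one_mul, Nat.cast_zero, add_zero]
    have e : ∀ q : Config × SiteNoise, φ (hor q.1 q.2 (m - 1)) =
        φ false + (φ true - φ false) * ind (hor q.1 q.2 (m - 1)) := fun q => hd φ _
    simp only [e]
    rw [integral_add (integrable_const _) ((integrable_ind (measurable_hor _) _).const_mul _),
      integral_const_mul]
    have := h.horOcc_eq h₁ h₂ (m - 1)
    rw [horOcc] at this
    rw [this, bernoulliMean]
    simp only [integral_const, probReal_univ, smul_eq_mul, one_mul]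
    ring
  | succ n ih =>
    have hkm : ∀ k : Bool → ℝ, Measurable k := fun k => measurable_of_countable k
    set X : Config → SiteNoise → ℝ := fun η u => ∏ i ∈ Finset.range n, k (m + i) (out η u (m + i))
    have hX : Measurable fun q : Config × SiteNoise => X q.1 q.2 :=
      Finset.measurable_fun_prod _ fun i _ => (hkm _).comp (measurable_out _)
    have hv := integral_vertex (b₁ := b₁) (b₂ := b₂) f (x := m + n) hX (C := 1) (fun η u => by
      rw [Finset.abs_prod]
      exact Finset.prod_le_one (fun _ _ => abs_nonneg _) fun i _ => hk _ _) (fun η u v => by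
      refine Finset.prod_congr rfl fun i hi => ?_
      rw [out_update_left _ _ (by have := Finset.mem_range.1 hi; omega)]) (fun η u i v => by
      refine Finset.prod_congr rfl fun i hi => ?_
      rw [out_update _ _ (by have := Finset.mem_range.1 hi; omega)]) (k (m + n)) φ
    rw [ih ind, ih fun b => ind !b] at hv
    have e : m + ((n + 1 : ℕ) : ℤ) - 1 = m + n := by push_cast; ring
    simp only [Finset.prod_range_succ, e, mul_assoc]
    simp only [X] at hv
    rw [hv]
    simp only [bernoulliMean, ind_true, ind_false, Bool.not_true, Bool.not_false]
    have q1 := h.step (m + n)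
    have q2 := h.conservation (m + n)
    have q3 := h.mul_eq (m + n)
    set A := k (m + n) true
    set B := k (m + n) false
    set Q := ∏ x ∈ Finset.range n, ((f (m + x - 1) : ℝ) * k (m + x) true +
      (1 - (f (m + x - 1) : ℝ)) * k (m + x) false)
    -- These are the probabilities of the four pairs of outputs. Both outputs present is `mul_eq`,
    -- and the other three follow by means of the marginals.
    linear_combination Q * (φ true * A * q3 + φ true * B * (-q1 - q3) + φ false * B * (-q2 + q3) +
      φ false * A * (q2 + q1 - q3))

/-- Product measures in local balance are stationary. -/
lemma IsBalanced.productLaw_mem (h₁ : b₁ < 1) (h₂ : b₂ < 1) {f g : ℤ → I}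
    (h : IsBalanced b₁ b₂ f g) : productLaw f ∈ invariantLaws b₁ b₂ := by
  refine ⟨inferInstance, Measure.eq_infinitePi _ fun s t ht => ?_⟩
  obtain ⟨m, n, hmn⟩ : ∃ (m : ℤ) (n : ℕ), ∀ i ∈ s, m ≤ i + 1 ∧ i + 1 < m + n := by
    obtain ⟨a, ha⟩ := s.bddBelow
    obtain ⟨b, hb⟩ := s.bddAbove
    refine ⟨a, (b + 2 - a).toNat, fun i hi => ?_⟩
    have := ha hi
    have := hb hi
    omega
  -- The index is shifted because the new configuration at `x` is the output of the vertex `x + 1`.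
  set k : ℤ → Bool → ℝ := fun i => if i - 1 ∈ s then (t (i - 1)).indicator 1 else 1
  have hk : ∀ i b, |k i b| ≤ 1 := fun i b => by
    simp only [k]
    split_ifs
    · by_cases hb : b ∈ t (i - 1) <;> simp [hb]
    · simp
  have key := h.integral_prod_out h₁ h₂ hk m n fun _ => 1
  have hmeas : MeasurableSet (Set.pi (s : Set ℤ) t) := .pi s.countable_toSet fun _ _ => ht _
  have hre : ∀ F : ℤ → ℝ, (∏ i ∈ Finset.range n, if m + (i : ℤ) - 1 ∈ s then F (m + i - 1) else 1) =
      ∏ i ∈ s, F i := fun F => by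
    rw [← Finset.prod_filter]
    refine Finset.prod_nbij' (fun i => m + i - 1) (fun z => (z + 1 - m).toNat) ?_ ?_ ?_ ?_ ?_
    · intro i hi; exact (Finset.mem_filter.1 hi).2
    · intro z hz
      have := hmn z hz
      have e : m + ((z + 1 - m).toNat : ℤ) - 1 = z := by omega
      rw [Finset.mem_filter, Finset.mem_range, e]
      exact ⟨by omega, hz⟩
    · intro i hi; simp
    · intro z hz
      have := hmn z hz
      omega
    · intro i hi; rfl
  have e1 : ∀ q : Config × SiteNoise, ∏ i ∈ Finset.range n, k (m + i) (out q.1 q.2 (m + i)) =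
      (Set.pi (s : Set ℤ) t).indicator 1 (siteStep q.1 q.2) := fun q => by
    have e : ∀ i : ℕ, k (m + i) (out q.1 q.2 (m + i)) = if m + (i : ℤ) - 1 ∈ s then
        (t (m + i - 1)).indicator 1 (siteStep q.1 q.2 (m + i - 1)) else 1 := fun i => by
      simp only [k, siteStep, sub_add_cancel]
      split_ifs <;> rfl
    simp only [e]
    rw [hre fun j => (t j).indicator 1 (siteStep q.1 q.2 j)]
    by_cases hq : siteStep q.1 q.2 ∈ Set.pi (s : Set ℤ) t
    · rw [Set.indicator_of_mem hq]
      exact Finset.prod_eq_one fun i hi => Set.indicator_of_mem (hq i hi) _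
    · rw [Set.indicator_of_notMem hq]
      simp only [Set.mem_pi, not_forall] at hq
      obtain ⟨i, hi, hit⟩ := hq
      exact Finset.prod_eq_zero hi (Set.indicator_of_notMem hit _)
  have e2 : ∏ i ∈ Finset.range n, bernoulliMean (f (m + i - 1)) (k (m + i)) =
      ∏ i ∈ s, (bernoulliMeasure true false (f i)).real (t i) := by
    rw [← hre]
    refine Finset.prod_congr rfl fun i _ => ?_
    rw [bernoulliMean, ← integral_bernoulliMeasure_bool]
    simp only [k]
    split_ifs
    · exact integral_indicator_one (ht _)
    · simp
  simp only [mul_one, e1, e2] at key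
  have e3 : bernoulliMean (g (m + n - 1)) (fun _ => 1) = 1 := by simp [bernoulliMean]
  have hP : IsProbabilityMeasure (siteEvolve b₁ b₂ (productLaw f)) :=
    isProbabilityMeasure_evolve measurable_siteStep _
  rw [e3, mul_one, ← integral_evolve (f := (Set.pi (s : Set ℤ) t).indicator 1) measurable_siteStep _
    (measurable_one.indicator hmeas), integral_indicator_one hmeas] at key
  have h4 := congrArg ENNReal.ofReal key
  rw [ENNReal.ofReal_prod_of_nonneg fun _ _ => measureReal_nonneg] at h4
  refine (ofReal_measureReal (measure_ne_top _ _)).symm.trans (h4.trans ?_)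
  exact Finset.prod_congr rfl fun i _ => ofReal_measureReal (measure_ne_top _ _)

end BalancedProductLaws

/-! ### Stationarity of the product measures, and the blocking measures. -/

section BlockingMeasures

variable {b₁ b₂ : I}

lemma bernoulliProduct_mem (h₁ : b₁ < 1) (h₂ : b₂ < 1) (ρ : I) :
    bernoulliProduct ρ ∈ invariantLaws b₁ b₂ := by
  have k1 : (0 : ℝ) < 1 - b₁ := sub_pos.2 h₁
  have k2 : (0 : ℝ) < 1 - b₂ := sub_pos.2 h₂
  have k3 := ρ.2.1
  have k4 : (0 : ℝ) ≤ 1 - ρ := sub_nonneg.2 ρ.2.2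
  have hD : 0 < (ρ : ℝ) * (1 - b₁) + (1 - ρ) * (1 - b₂) := by
    rcases k3.eq_or_lt with h | h
    · rw [← h]; simpa using k2
    · have := mul_pos h k1
      have := mul_nonneg k4 k2.le
      linarith
  -- This horizontal density is the fixed point of the recursion `step` for the constant vertical
  -- density `ρ`.
  have hmem : (ρ : ℝ) * (1 - b₁) / (ρ * (1 - b₁) + (1 - ρ) * (1 - b₂)) ∈ I := by
    refine ⟨by positivity, div_le_one_of_le₀ ?_ hD.le⟩
    have := mul_nonneg k4 k2.le
    linarith
  refine IsBalanced.productLaw_mem h₁ h₂ (f := fun _ => ρ) (g := fun _ => ⟨_, hmem⟩)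
    ⟨fun _ => ?_, fun _ => rfl, fun _ => rfl⟩
  simp only
  field_simp
  ring

/-- With equal vertical and horizontal densities `f`, only `step` has content. It is the detailed
balance `b₁ * f x * (1 - f (x - 1)) = b₂ * (1 - f x) * f (x - 1)`: the odds grow by the factor `q`
from `x` to `x - 1`. -/
lemma blockingProduct_mem (hb₁ : 0 < b₁) (h₁ : b₁ < 1) (hb₂ : 0 < b₂) (h₂ : b₂ < 1) :
    blockingProduct b₁ b₂ ∈ invariantLaws b₁ b₂ := by
  have k1 : (0 : ℝ) < b₁ := hb₁
  have k2 : (0 : ℝ) < b₂ := hb₂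
  have hr : 0 < ratio b₁ b₂ := div_pos k1 k2
  refine IsBalanced.productLaw_mem h₁ h₂ (f := blockingDensity b₁ b₂) (g := blockingDensity b₁ b₂)
    ⟨fun x => ?_, fun x => by ring, fun x => by ring⟩
  simp only [blockingDensity]
  have e : ratio b₁ b₂ ^ (-(x - 1)) = ratio b₁ b₂ ^ (-x) * ratio b₁ b₂ := by
    rw [← zpow_add_one₀ hr.ne']; congr 1; ring
  rw [e]
  have hw : 0 < ratio b₁ b₂ ^ (-x) := zpow_pos hr _
  have e2 : ratio b₁ b₂ * b₂ = b₁ := div_mul_cancel₀ _ k2.ne'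
  set w := ratio b₁ b₂ ^ (-x)
  set r := ratio b₁ b₂
  have hwr : 0 < 1 + w * r := by positivity
  rw [← e2]
  field_simp
  ring

lemma update_mem_packed {e : Bool} {m : ℤ} {η : Config} (h : η ∈ packed e m) (x : ℤ) (b : Bool) :
    Function.update η x b ∈
      packed e (m + ((if b then 1 else 0) - if η x then 1 else 0)) := by
  filter_upwards [h, eventually_ge_atTop (x.natAbs + 1)] with K hK hKx
  refine ⟨?_, ?_⟩
  · rw [Function.update_of_ne (by omega), Function.update_of_ne (by omega)]
    exact hK.1
  · have hmem : x ∈ Finset.Ioc (-(K : ℤ)) K := Finset.mem_Ioc.2 (by omega)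
    rw [← add_assoc, ← hK.2, particles, particles, ← Finset.add_sum_erase _ _ hmem,
      ← Finset.add_sum_erase _ _ hmem, Function.update_self]
    have : ∑ i ∈ (Finset.Ioc (-(K : ℤ)) K).erase x, (if Function.update η x b i then (1 : ℤ) else 0) =
        ∑ i ∈ (Finset.Ioc (-(K : ℤ)) K).erase x, if η i then 1 else 0 :=
      Finset.sum_congr rfl fun i hi => by rw [Function.update_of_ne (Finset.ne_of_mem_erase hi)]
    rw [this]
    ring

lemma exists_apply_eq_of_mem_packed {e : Bool} {m : ℤ} {η : Config} (h : η ∈ packed e m)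
    (b : Bool) : ∃ x, η x = b := by
  obtain ⟨K, hK, -⟩ := h.exists
  rcases Bool.eq_or_eq_not b e with hb | hb
  · exact ⟨_, hb ▸ hK.1⟩
  · exact ⟨_, hb ▸ hK.2⟩

/-- Some site has the value `!b` with positive probability on the class. Resampling it to `b`, which
has positive probability, leads to the neighbouring class. -/
lemma productLaw_packed_ne_zero_of_flip {f : ℤ → I} (h0 : ∀ x, 0 < f x) (h1 : ∀ x, f x < 1)
    {e : Bool} {m : ℤ} (h : productLaw f (packed e m) ≠ 0) (b : Bool) :
    productLaw f (packed e (m + ((if b then 1 else 0) - if b then 0 else 1))) ≠ 0 := by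
  obtain ⟨x, hx⟩ : ∃ x, productLaw f (packed e m ∩ {η | η x = !b}) ≠ 0 := by
    by_contra! hcon
    refine h (measure_mono_null (fun η hη => ?_) (measure_iUnion_null hcon))
    obtain ⟨x, hx⟩ := exists_apply_eq_of_mem_packed hη (!b)
    exact Set.mem_iUnion.2 ⟨x, hη, hx⟩
  have hm : Measurable fun p : Config × Bool => Function.update p.1 x p.2 := by
    refine measurable_pi_lambda _ fun j => ?_
    by_cases h : j = x
    · subst h; simpa using measurable_snd
    · have : Measurable fun p : Config × Bool => p.1 j :=
        (measurable_pi_apply j).comp measurable_fst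
      simpa [Function.update_of_ne h] using this
  rw [productLaw, ← infinitePi_map_update (fun x => bernoulliMeasure true false (f x)) x,
    Measure.map_apply hm (measurableSet_packed _ _)]
  have hsub : (packed e m ∩ {η | η x = !b}) ×ˢ {b} ⊆ (fun p : Config × Bool =>
      Function.update p.1 x p.2) ⁻¹' packed e (m + ((if b then 1 else 0) - if b then 0 else 1)) := by
    rintro ⟨η, v⟩ ⟨⟨hη, hηx⟩, rfl⟩
    have := update_mem_packed hη x v
    rw [hηx] at this
    simp only [Set.mem_preimage]
    convert this using 3
    cases v <;> simp
  refine fun hz => ?_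
  have h2 := measure_mono_null hsub hz
  rw [Measure.prod_prod, mul_eq_zero] at h2
  exact h2.elim hx (bernoulliMeasure_singleton_pos (h0 x) (h1 x) b)

/-- Wrong values have geometrically small probabilities, so by Borel–Cantelli almost every
configuration is packed and some class has positive mass. Flipping single sites reaches all other
classes. -/
lemma productLaw_packed_ne_zero {f : ℤ → I} (h0 : ∀ x, 0 < f x) (h1 : ∀ x, f x < 1)
    {e : Bool} {s : ℝ} (hs0 : 0 ≤ s) (hs : s < 1)
    (hl : ∀ K : ℕ, bernoulliMean (f (-K)) (fun b => ind (b ^^ e)) ≤ s ^ K)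
    (hr : ∀ K : ℕ, bernoulliMean (f (K + 1)) (fun b => ind (b ^^ !e)) ≤ s ^ K) (m : ℤ) :
    productLaw f (packed e m) ≠ 0 := by
  have hBC : ∀ (g : ℕ → ℤ) (c : Bool),
      (∀ K : ℕ, bernoulliMean (f (g K)) (fun b => ind (b ^^ c)) ≤ s ^ K) →
      ∀ᵐ η ∂(productLaw f), ∀ᶠ K : ℕ in atTop, η (g K) = c := fun g c hg => by
    have hle : ∀ K, productLaw f {η | η (g K) = !c} ≤ ENNReal.ofReal (s ^ K) := fun K => by
      have h2 := hg K
      have h3 : productLaw f {η | η (g K) = !c} = bernoulliMeasure true false (f (g K)) {!c} := by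
        have h4 := Measure.infinitePi_map_eval (fun x => bernoulliMeasure true false (f x)) (g K)
        rw [← h4, Measure.map_apply (measurable_pi_apply _) (measurableSet_singleton _)]
        rfl
      rw [h3]
      cases c
      · rw [Bool.not_false, bernoulliMeasure_singleton_true]
        refine ENNReal.ofReal_le_ofReal ?_
        simpa [bernoulliMean] using h2
      · rw [Bool.not_true, bernoulliMeasure_singleton_false]
        refine ENNReal.ofReal_le_ofReal ?_
        simpa [bernoulliMean] using h2
    have hsum : ∑' K, productLaw f {η | η (g K) = !c} ≠ ∞ := by
      refine ne_top_of_le_ne_top ?_ (ENNReal.tsum_le_tsum hle)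
      exact (summable_geometric_of_lt_one hs0 hs).tsum_ofReal_ne_top
    filter_upwards [ae_eventually_notMem hsum] with η hη
    filter_upwards [hη] with K hK
    simpa using hK
  have hU : ∃ m, productLaw f (packed e m) ≠ 0 := by
    by_contra! hcon
    have h4 : productLaw f (⋃ k, packed e k) = 0 := measure_iUnion_null hcon
    have h5 : ∀ᵐ η ∂(productLaw f), False := by
      filter_upwards [hBC (fun K => -K) e hl, hBC (fun K => K + 1) (!e) hr,
        measure_eq_zero_iff_ae_notMem.1 h4] with η h1 h2 h3
      exact h3 (Set.mem_iUnion.2 (exists_packed (h1.and h2)))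
    simpa using h5.exists
  obtain ⟨m₀, hm₀⟩ := hU
  have key : ∀ k : ℤ, productLaw f (packed e (m₀ + k)) ≠ 0 := fun k => by
    induction k using Int.induction_on with
    | zero => simpa using hm₀
    | succ n ih =>
      have := productLaw_packed_ne_zero_of_flip h0 h1 ih true
      convert this using 3
      simp; ring
    | pred n ih =>
      have := productLaw_packed_ne_zero_of_flip h0 h1 ih false
      convert this using 3
      simp; ring
  simpa using key (m - m₀)

/-- The number of particles in a large window. -/
lemma particles_eq {η : Config} (hH : {i : ℤ | i ≤ 0 ∧ η i = false}.Finite)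
    (hP : {i : ℤ | 1 ≤ i ∧ η i = true}.Finite) : ∀ᶠ K : ℕ in atTop,
      (η (-K) = true ∧ η (K + 1) = false) ∧ particles η K =
        K + ({i : ℤ | 1 ≤ i ∧ η i = true}.ncard - {i : ℤ | i ≤ 0 ∧ η i = false}.ncard : ℤ) := by
  obtain ⟨a, ha⟩ := hH.bddBelow
  obtain ⟨b, hb⟩ := hP.bddAbove
  filter_upwards [eventually_ge_atTop (a.natAbs + 1), eventually_ge_atTop b.natAbs] with K hKa hKb
  refine ⟨⟨?_, ?_⟩, ?_⟩
  · by_contra h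
    have := ha (show -(K : ℤ) ∈ {i : ℤ | i ≤ 0 ∧ η i = false} from ⟨by omega, by simpa using h⟩)
    omega
  · by_contra h
    have := hb (show (K : ℤ) + 1 ∈ {i : ℤ | 1 ≤ i ∧ η i = true} from ⟨by omega, by simpa using h⟩)
    omega
  · have e1 : {i : ℤ | i ≤ 0 ∧ η i = false} =
        ((Finset.Ioc (-(K : ℤ)) 0).filter fun i => ¬ η i = true : Finset ℤ) := by
      ext i
      simp only [Set.mem_ofPred_eq, Finset.coe_filter, Finset.mem_Ioc, Bool.not_eq_true]
      constructor
      · rintro ⟨h1, h2⟩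
        have := ha (show i ∈ {i : ℤ | i ≤ 0 ∧ η i = false} from ⟨h1, h2⟩)
        exact ⟨⟨by omega, h1⟩, h2⟩
      · rintro ⟨h1, h2⟩; exact ⟨h1.2, h2⟩
    have e2 : {i : ℤ | 1 ≤ i ∧ η i = true} =
        ((Finset.Ioc 0 (K : ℤ)).filter fun i => η i = true : Finset ℤ) := by
      ext i
      simp only [Set.mem_ofPred_eq, Finset.coe_filter, Finset.mem_Ioc]
      constructor
      · rintro ⟨h1, h2⟩
        have := hb (show i ∈ {i : ℤ | 1 ≤ i ∧ η i = true} from ⟨h1, h2⟩)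
        exact ⟨⟨by omega, by omega⟩, h2⟩
      · rintro ⟨h1, h2⟩; exact ⟨by omega, h2⟩
    have e3 : Finset.Ioc (-(K : ℤ)) K = Finset.Ioc (-(K : ℤ)) 0 ∪ Finset.Ioc 0 (K : ℤ) :=
      (Finset.Ioc_union_Ioc_eq_Ioc (by omega) (by omega)).symm
    have hdis : Disjoint (Finset.Ioc (-(K : ℤ)) 0) (Finset.Ioc 0 (K : ℤ)) :=
      Finset.disjoint_left.2 fun i h1 h2 => by
        simp only [Finset.mem_Ioc] at h1 h2; omega
    have e4 := Finset.card_filter_add_card_filter_not (s := Finset.Ioc (-(K : ℤ)) 0)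
      (fun i => η i = true)
    have e5 : (Finset.Ioc (-(K : ℤ)) 0).card = K := by simp
    rw [e1, e2, Set.ncard_coe_finset, Set.ncard_coe_finset, particles, e3,
      Finset.sum_union hdis, Finset.sum_boole, Finset.sum_boole]
    omega

lemma leftPackedClass_eq (n : ℤ) : leftPackedClass n = packed true n := by
  ext η
  constructor
  · rintro ⟨hH, hP, h⟩
    filter_upwards [particles_eq hH hP] with K hK
    refine ⟨hK.1, ?_⟩
    rw [hK.2]
    omega
  · intro h
    obtain ⟨N, hl, hr⟩ := packed_eventually h
    have hH : {i : ℤ | i ≤ 0 ∧ η i = false}.Finite := by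
      refine (Finset.Ioc (-N) 0).finite_toSet.subset fun i hi => ?_
      simp only [Finset.coe_Ioc, Set.mem_Ioc]
      refine ⟨?_, hi.1⟩
      by_contra hc
      have := hl i (by omega)
      rw [hi.2] at this
      simp at this
    have hP : {i : ℤ | 1 ≤ i ∧ η i = true}.Finite := by
      refine (Finset.Icc 1 N).finite_toSet.subset fun i hi => ?_
      simp only [Finset.coe_Icc, Set.mem_Icc]
      refine ⟨hi.1, ?_⟩
      by_contra hc
      have := hr i (by omega)
      rw [hi.2] at this
      simp at this
    obtain ⟨K, hK1, hK2⟩ := ((particles_eq hH hP).and h).exists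
    refine ⟨hH, hP, ?_⟩
    have := hK1.2.symm.trans hK2.2
    omega

/-- Exchange particles and holes: the excess changes its sign, because a window of `2 * K` sites has
`2 * K - particles η K` holes. -/
lemma rightPackedClass_eq (n : ℤ) : rightPackedClass n = packed false (-n) := by
  ext η
  have h1 : η ∈ rightPackedClass n ↔ (fun x => !η x) ∈ leftPackedClass n := by
    simp [rightPackedClass, leftPackedClass]
  have h2 : ∀ K : ℕ, particles (fun x => !η x) K = 2 * K - particles η K := fun K => by
    have h3 : particles (fun x => !η x) K + particles η K = ∑ i ∈ Finset.Ioc (-(K : ℤ)) K, 1 := by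
      rw [particles, particles, ← Finset.sum_add_distrib]
      refine Finset.sum_congr rfl fun i _ => ?_
      cases η i <;> simp
    rw [Finset.sum_const, Int.card_Ioc] at h3
    simp only [nsmul_eq_mul, mul_one] at h3
    omega
  rw [h1, leftPackedClass_eq]
  refine eventually_congr (Eventually.of_forall fun K => ?_)
  rw [h2]
  refine and_congr ?_ ?_
  · simp
  · constructor <;> intro h <;> omega

/-- The left end of the configurations in the blocking classes. -/
def blockingEnd (b₁ b₂ : I) : Bool := decide (1 < ratio b₁ b₂)

lemma blockingClass_eq (n : ℤ) : blockingClass b₁ b₂ n =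
    packed (blockingEnd b₁ b₂) (if 1 < ratio b₁ b₂ then n else -n) := by
  by_cases h : 1 < ratio b₁ b₂
  · simp [blockingClass, blockingEnd, h, leftPackedClass_eq]
  · simp [blockingClass, blockingEnd, h, rightPackedClass_eq]

/-- The probability of a particle at `x` is at most `q ^ (-x)` and that of a hole at most `q ^ x`.
For `q ≠ 1` the wrong values thus decay geometrically at both ends. -/
lemma blockingProduct_packed_ne_zero (hb₁ : 0 < b₁) (hb₂ : 0 < b₂) (hq : ratio b₁ b₂ ≠ 1) (m : ℤ) :
    blockingProduct b₁ b₂ (packed (blockingEnd b₁ b₂) m) ≠ 0 := by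
  have k1 : (0 : ℝ) < b₁ := hb₁
  have k2 : (0 : ℝ) < b₂ := hb₂
  have hr : 0 < ratio b₁ b₂ := div_pos k1 k2
  have hw := fun x : ℤ => zpow_pos hr (-x)
  have hpos : ∀ x, 0 < blockingDensity b₁ b₂ x := fun x => by
    have := hw x
    refine Subtype.mk_lt_mk.2 ?_
    positivity
  have hlt : ∀ x, blockingDensity b₁ b₂ x < 1 := fun x => by
    have := hw x
    refine Subtype.mk_lt_mk.2 ?_
    rw [div_lt_one (by positivity)]
    linarith
  have ht : ∀ x, bernoulliMean (blockingDensity b₁ b₂ x) ind ≤ ratio b₁ b₂ ^ (-x) := fun x => by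
    have := hw x
    simp only [bernoulliMean, blockingDensity, ind_true, ind_false, mul_one, mul_zero, add_zero]
    rw [div_le_iff₀ (by positivity)]
    nlinarith
  have hf : ∀ x, bernoulliMean (blockingDensity b₁ b₂ x) (fun b => ind !b) ≤ ratio b₁ b₂ ^ x :=
    fun x => by
      have := hw x
      simp only [bernoulliMean, blockingDensity, ind_true, ind_false, mul_one, mul_zero, zero_add,
        Bool.not_true, Bool.not_false]
      have e : ratio b₁ b₂ ^ x = (ratio b₁ b₂ ^ (-x))⁻¹ := by rw [zpow_neg, inv_inv]
      rw [e]
      set w := ratio b₁ b₂ ^ (-x)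
      rw [show 1 - w / (1 + w) = (1 + w)⁻¹ by field_simp; ring]
      gcongr
      linarith
  by_cases h : 1 < ratio b₁ b₂
  · have he : blockingEnd b₁ b₂ = true := by simp [blockingEnd, h]
    rw [he]
    have hi : (ratio b₁ b₂)⁻¹ ≤ 1 := inv_le_one_of_one_le₀ h.le
    refine productLaw_packed_ne_zero hpos hlt (s := (ratio b₁ b₂)⁻¹) (by positivity)
      (inv_lt_one_of_one_lt₀ h) (fun K => ?_) (fun K => ?_) m
    · simpa using hf (-K)
    · have h2 := ht (K + 1)
      have e : ratio b₁ b₂ ^ (-((K : ℤ) + 1)) = (ratio b₁ b₂)⁻¹ ^ (K + 1) := by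
        rw [zpow_neg, inv_pow]; norm_cast
      rw [e] at h2
      simpa using h2.trans (pow_le_pow_of_le_one (by positivity) hi (Nat.le_succ K))
  · have he : blockingEnd b₁ b₂ = false := by simp [blockingEnd, h]
    rw [he]
    have hle : ratio b₁ b₂ ≤ 1 := not_lt.1 h
    refine productLaw_packed_ne_zero hpos hlt (s := ratio b₁ b₂) hr.le
      (lt_of_le_of_ne hle hq) (fun K => ?_) (fun K => ?_) m
    · simpa using ht (-K)
    · have h2 := hf (K + 1)
      have e : ratio b₁ b₂ ^ ((K : ℤ) + 1) = ratio b₁ b₂ ^ (K + 1) := by norm_cast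
      rw [e] at h2
      simpa using h2.trans (pow_le_pow_of_le_one hr.le hle (Nat.le_succ K))

/-- The blocking measures, as a subset of the extremal measures. -/
lemma blockingMeasure_mem (hb₁ : 0 < b₁) (h₁ : b₁ < 1) (hb₂ : 0 < b₂) (h₂ : b₂ < 1)
    (hq : ratio b₁ b₂ ≠ 1) (n : ℤ) : blockingMeasure b₁ b₂ n ∈ extremal (invariantLaws b₁ b₂) := by
  rw [blockingMeasure, blockingClass_eq]
  exact mem_extremal_of_packed hb₁ h₁ hb₂ h₂ (cond_packed_mem h₁ h₂
    (blockingProduct_mem hb₁ h₁ hb₂ h₂) (blockingProduct_packed_ne_zero hb₁ hb₂ hq _))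
    (ae_mem_cond (measurableSet_packed _ _))

/-- Extremal steps are blocking measures. -/
lemma mem_range_blockingMeasure (hb₁ : 0 < b₁) (h₁ : b₁ < 1) (hb₂ : 0 < b₂) (h₂ : b₂ < 1)
    (hq : ratio b₁ b₂ ≠ 1) {ν : Measure Config} (hν : ν ∈ extremal (invariantLaws b₁ b₂))
    {e : Bool} (he : IsStep e ν) : ν ∈ Set.range (blockingMeasure b₁ b₂) := by
  have hne := blockingProduct_packed_ne_zero hb₁ hb₂ hq
  obtain ⟨m, hm⟩ := exists_eq_of_isStep hb₁ h₁ hb₂ h₂ (e := blockingEnd b₁ b₂)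
    (β := fun m => ProbabilityTheory.cond (blockingProduct b₁ b₂) (packed (blockingEnd b₁ b₂) m))
    (fun m => cond_packed_mem h₁ h₂ (blockingProduct_mem hb₁ h₁ hb₂ h₂) (hne m))
    (fun m => ae_mem_cond (measurableSet_packed _ _)) hν he
  refine ⟨if 1 < ratio b₁ b₂ then m else -m, ?_⟩
  rw [blockingMeasure, blockingClass_eq, ← hm]
  split_ifs <;> simp

end BlockingMeasures

/-! ### Extremality and characterization of the Bernoulli product measures. -/

section BernoulliProducts

variable {b₁ b₂ : I}

instance (ρ : I) : IsProbabilityMeasure (bernoulliProduct ρ) := by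
  unfold bernoulliProduct; infer_instance

lemma bernoulliProduct_map_shift (ρ : I) (n : ℤ) :
    (bernoulliProduct ρ).map (shift n) = bernoulliProduct ρ :=
  Measure.map_infinitePi_infinitePi_of_inj (P := fun _ : ℤ => bernoulliMeasure true false ρ)
    (add_left_injective n)

lemma bernoulliProduct_map_eval (ρ : I) (x : ℤ) :
    (bernoulliProduct ρ).map (fun η => η x) = bernoulliMeasure true false ρ :=
  Measure.infinitePi_map_eval (fun _ : ℤ => bernoulliMeasure true false ρ) x

lemma occ_bernoulliProduct (ρ : I) (x : ℤ) : occ (bernoulliProduct ρ) x = ρ := by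
  have h := integral_bernoulliMeasure_bool ρ ind
  rw [← bernoulliProduct_map_eval ρ x, integral_map (measurable_pi_apply x).aemeasurable
    measurable_ind.aestronglyMeasurable] at h
  exact h.trans (by simp [ind])

/-- The law of large numbers. -/
lemma tendsto_integral_avgOcc_sub (ρ : I) :
    Tendsto (fun N => ∫ η, |avgOcc N η - ρ| ∂(bernoulliProduct ρ)) atTop (𝓝 0) := by
  have hm : ∀ i : ℕ, Measurable fun η : Config => ind (η i) := fun i =>
    measurable_ind.comp (measurable_pi_apply (i : ℤ))
  have hind : iIndepFun (fun (i : ℤ) (η : Config) => ind (η i)) (bernoulliProduct ρ) :=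
    iIndepFun_infinitePi (P := fun _ : ℤ => bernoulliMeasure true false ρ) fun _ => measurable_ind
  have h := strong_law_Lp (μ := bernoulliProduct ρ) le_rfl ENNReal.one_ne_top
    (fun (i : ℕ) η => ind (η (i : ℤ)))
    (MemLp.of_bound (hm 0).aestronglyMeasurable 1 (ae_of_all _ fun η => abs_ind_le _))
    (fun i j hij => hind.indepFun (by exact_mod_cast hij)) fun i => by
      have e := (bernoulliProduct_map_eval ρ (i : ℤ)).trans
        (bernoulliProduct_map_eval ρ ((0 : ℕ) : ℤ)).symm
      have h1 : IdentDistrib (fun η : Config => η (i : ℤ)) (fun η : Config => η ((0 : ℕ) : ℤ))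
          (bernoulliProduct ρ) (bernoulliProduct ρ) :=
        ⟨(measurable_pi_apply _).aemeasurable, (measurable_pi_apply _).aemeasurable, e⟩
      exact h1.comp measurable_ind
  have h2 := (ENNReal.tendsto_toReal ENNReal.zero_ne_top).comp h
  rw [ENNReal.toReal_zero] at h2
  refine h2.congr fun N => ?_
  have e : ∫ η, ind (η ((0 : ℕ) : ℤ)) ∂(bernoulliProduct ρ) = ρ := occ_bernoulliProduct ρ _
  rw [Function.comp_apply, e, eLpNorm_one_eq_lintegral_enorm, ← integral_norm_eq_lintegral_enorm]
  · rfl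
  · exact ((continuous_avgOcc N).sub continuous_const).measurable.aestronglyMeasurable

lemma integral_le_of_smul_le {X : Type*} [MeasurableSpace X] {μ ν : Measure X} {p : ℝ≥0∞}
    (h : p • μ ≤ ν) {g : X → ℝ} (hg : ∀ x, 0 ≤ g x) (hi : Integrable g ν) :
    p.toReal * ∫ x, g x ∂μ ≤ ∫ x, g x ∂ν := by
  have := integral_mono_measure h (ae_of_all _ hg) hi
  rwa [integral_smul_measure] at this

lemma integrable_avgOcc_sub (μ : Measure Config) [IsFiniteMeasure μ] (N : ℕ) (ρ : ℝ) :
    Integrable (fun η => |avgOcc N η - ρ|) μ :=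
  integrable_of_continuous ((continuous_avgOcc N).sub continuous_const).abs μ

/-- Domination by a multiple of a translation invariant law gives the law of large numbers uniformly
over all translates. -/
lemma tendsto_integral_avgOcc_sub_of_le {α : Measure Config} [IsProbabilityMeasure α] {ρ : I}
    {p : ℝ≥0∞} (hp : p ≠ 0) (h : p • α ≤ bernoulliProduct ρ) {δ : ℝ} (hδ : 0 < δ) :
    ∀ᶠ N : ℕ in atTop, ∀ x, ∫ η, |avgOcc N η - ρ| ∂(α.map (shift x)) ≤ δ := by
  have hp1 : p ≤ 1 := by simpa using h Set.univ
  have hp0 : 0 < p.toReal := ENNReal.toReal_pos hp (hp1.trans_lt ENNReal.one_lt_top).ne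
  filter_upwards [(tendsto_integral_avgOcc_sub ρ).eventually
    (ge_mem_nhds (mul_pos hp0 hδ))] with N hN x
  have h1 := Measure.map_mono h (measurable_shift x)
  rw [Measure.map_smul, bernoulliProduct_map_shift] at h1
  have h2 := integral_le_of_smul_le h1 (fun η => abs_nonneg _) (integrable_avgOcc_sub _ N ρ)
  exact le_of_mul_le_mul_left (h2.trans hN) hp0

/-- Stationary measures below multiples of Bernoulli product measures are ordered like these. -/
lemma exists_le_coupling (hb₁ : 0 < b₁) (h₁ : b₁ < 1) (hb₂ : 0 < b₂) (h₂ : b₂ < 1)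
    {α β : Measure Config} (hα : α ∈ invariantLaws b₁ b₂) (hβ : β ∈ invariantLaws b₁ b₂)
    {a b : I} (hab : a < b) {p p' : ℝ≥0∞} (hp : p ≠ 0) (hp' : p' ≠ 0)
    (hαa : p • α ≤ bernoulliProduct a) (hβb : p' • β ≤ bernoulliProduct b) :
    ∃ l, IsStationaryCoupling b₁ b₂ α β l ∧ ∀ᵐ q ∂l, q.1 ≤ q.2 := by
  have := hα.1
  have := hβ.1
  have hab' : (0 : ℝ) < b - a := sub_pos.2 hab
  have hfst : (α.prod β).map Prod.fst = α := by rw [Measure.map_fst_prod]; simp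
  have hsnd : (α.prod β).map Prod.snd = β := by rw [Measure.map_snd_prod]; simp
  have hp := isProbabilityMeasure_map_pairShift (α.prod β)
  obtain ⟨l, hl, hlim⟩ := exists_weakLim (hyperfilter ℕ) (spatialAvg (α.prod β))
    (fun k => isProbabilityMeasure_avgMeasure (window_nonempty _) hp)
  obtain ⟨hα₂, hα₃⟩ := map_spatialLimit_eq (b₁ := b₁) (b₂ := b₂) hlim h₁ h₂ continuous_fst
    (fun _ _ => rfl) (by rw [hfst, hα.2])
  obtain ⟨hβ₂, hβ₃⟩ := map_spatialLimit_eq (b₁ := b₁) (b₂ := b₂) hlim h₁ h₂ continuous_snd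
    (fun _ _ => rfl) (by rw [hsnd, hβ.2])
  have hgc : ∀ (N : ℕ) (r : I), Continuous fun η : Config => |avgOcc N η - r| := fun N r =>
    ((continuous_avgOcc N).sub continuous_const).abs
  -- Since `a < b`, an excess of the first configuration is bounded by the deviations of the two
  -- averages from `a` and `b`.
  have key : ∀ δ > 0, ∀ᶠ N : ℕ in atTop, ∫ q, excess N q ∂l ≤ δ := fun δ hδ => by
    filter_upwards [tendsto_integral_avgOcc_sub_of_le ‹p ≠ 0› hαa (half_pos hδ),
      tendsto_integral_avgOcc_sub_of_le hp' hβb (half_pos hδ)] with N hN hN'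
    refine le_of_tendsto' (hlim _ (continuous_excess N)) fun k => ?_
    rw [spatialAvg, integral_avgMeasure _ (fun x _ => have := hp x
      integrable_of_continuous (continuous_excess N) _), inv_mul_le_iff₀ (by
        exact_mod_cast (window_nonempty _).card_pos), ← nsmul_eq_mul]
    refine Finset.sum_le_card_nsmul _ _ _ fun x _ => ?_
    have := hp x
    have i1 : Integrable (fun q : Config × Config => |avgOcc N q.1 - a|)
        ((α.prod β).map (pairShift x)) :=
      integrable_of_continuous ((hgc N a).comp continuous_fst) _
    have i2 : Integrable (fun q : Config × Config => |avgOcc N q.2 - b|)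
        ((α.prod β).map (pairShift x)) :=
      integrable_of_continuous ((hgc N b).comp continuous_snd) _
    have e1 : ∫ q : Config × Config, |avgOcc N q.1 - a| ∂((α.prod β).map (pairShift x)) =
        ∫ η, |avgOcc N η - a| ∂(α.map (shift x)) := by
      have h3 : α.map (shift x) = ((α.prod β).map (pairShift x)).map Prod.fst := by
        conv_lhs => rw [← hfst]
        rw [Measure.map_map (measurable_shift x) measurable_fst,
          Measure.map_map measurable_fst (measurable_pairShift x)]
        rfl
      rw [h3, integral_map measurable_fst.aemeasurable (hgc N a).measurable.aestronglyMeasurable]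
    have e2 : ∫ q : Config × Config, |avgOcc N q.2 - b| ∂((α.prod β).map (pairShift x)) =
        ∫ η, |avgOcc N η - b| ∂(β.map (shift x)) := by
      have h3 : β.map (shift x) = ((α.prod β).map (pairShift x)).map Prod.snd := by
        conv_lhs => rw [← hsnd]
        rw [Measure.map_map (measurable_shift x) measurable_snd,
          Measure.map_map measurable_snd (measurable_pairShift x)]
        rfl
      rw [h3, integral_map measurable_snd.aemeasurable (hgc N b).measurable.aestronglyMeasurable]
    calc _ ≤ ∫ q : Config × Config, (|avgOcc N q.1 - a| + |avgOcc N q.2 - b|)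
          ∂((α.prod β).map (pairShift x)) := by
          refine integral_mono (integrable_of_continuous (continuous_excess N) _) (i1.add i2)
            fun q => ?_
          have h3 := le_abs_self (avgOcc N q.1 - a)
          have h4 := neg_abs_le (avgOcc N q.2 - b)
          exact max_le (by positivity) (by linarith)
      _ ≤ δ := by
          rw [integral_add i1 i2, e1, e2]
          linarith [hN x, hN' x]
  obtain ⟨l, hl, hord⟩ := exists_ordered_of_excess_le hb₁ h₁ hb₂ h₂ hα.2 hβ.2 hfst hsnd hlim
    fun ε hε => exists_excess_le hα₂ hβ₂ hα₃ hβ₃ rfl rfl key hε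
  refine ⟨l, hl, ?_⟩
  have := hl.isProb
  have hzero : l.real {q | q.2 ≤ q.1} = 0 := by
    refine le_antisymm (le_of_forall_pos_le_add fun δ hδ => ?_) measureReal_nonneg
    -- In the reverse order the two deviations add up to at least `b - a`, while their expected sum
    -- is at most `(b - a) * δ`. So this order has probability at most `δ`.
    have hδ' : 0 < (b - a) * δ / 2 := by positivity
    obtain ⟨N, hN, hN'⟩ := ((tendsto_integral_avgOcc_sub_of_le ‹p ≠ 0› hαa hδ').and
      (tendsto_integral_avgOcc_sub_of_le hp' hβb hδ')).exists
    have hs0 : ∀ μ : Measure Config, μ.map (shift 0) = μ := fun μ => by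
      have : shift 0 = id := by ext η x; simp [shift]
      rw [this, Measure.map_id]
    have hN := hN 0
    have hN' := hN' 0
    rw [hs0, ← hl.map_fst, integral_map measurable_fst.aemeasurable
      (hgc N a).measurable.aestronglyMeasurable] at hN
    rw [hs0, ← hl.map_snd, integral_map measurable_snd.aemeasurable
      (hgc N b).measurable.aestronglyMeasurable] at hN'
    have i1 : Integrable (fun q : Config × Config => |avgOcc N q.1 - a|) l :=
      integrable_of_continuous ((hgc N a).comp continuous_fst) _
    have i2 : Integrable (fun q : Config × Config => |avgOcc N q.2 - b|) l :=
      integrable_of_continuous ((hgc N b).comp continuous_snd) _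
    have h5 : ∫ q, {q : Config × Config | q.2 ≤ q.1}.indicator (fun _ => (b - a : ℝ)) q ∂l ≤
        ∫ q : Config × Config, (|avgOcc N q.1 - a| + |avgOcc N q.2 - b|) ∂l := by
      refine integral_mono ((integrable_const _).indicator measurableSet_ge) (i1.add i2) fun q => ?_
      by_cases hq : q.2 ≤ q.1
      · rw [Set.indicator_of_mem (show q ∈ {q : Config × Config | q.2 ≤ q.1} from hq)]
        have h1 : avgOcc N q.2 ≤ avgOcc N q.1 :=
          mul_le_mul_of_nonneg_left (Finset.sum_le_sum fun i _ => ind_mono (hq i)) (by positivity)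
        have h3 := le_abs_self (avgOcc N q.1 - a)
        have h4 := neg_abs_le (avgOcc N q.2 - b)
        simp only
        linarith
      · rw [Set.indicator_of_notMem (show q ∉ {q : Config × Config | q.2 ≤ q.1} from hq)]
        positivity
    rw [integral_indicator_const _ measurableSet_ge, integral_add i1 i2, smul_eq_mul] at h5
    have h6 : (b - a) * l.real {q | q.2 ≤ q.1} ≤ (b - a) * δ := by linarith
    have := le_of_mul_le_mul_left h6 hab'
    linarith
  have h0 : ∀ᵐ q ∂l, ¬ q.2 ≤ q.1 := by
    have hz : l {q | q.2 ≤ q.1} = 0 := (measureReal_eq_zero_iff (measure_ne_top _ _)).1 hzero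
    rw [ae_iff]; simpa only [not_not] using hz
  filter_upwards [hord, h0] with q h1 h2 using h1.resolve_right h2

/-- The configurations in which all sites of `F` are occupied. -/
def fullSet (F : Finset ℤ) : Set Config := {η | ∀ x ∈ F, η x = true}

lemma fullSet_eq_pi (F : Finset ℤ) : fullSet F = Set.pi F fun _ => {true} := by
  ext η; simp [fullSet]

lemma measurableSet_fullSet (F : Finset ℤ) : MeasurableSet (fullSet F) := by
  rw [fullSet_eq_pi]
  exact .pi F.countable_toSet fun _ _ => measurableSet_singleton _

lemma fullSet_singleton (x : ℤ) : fullSet {x} = {η | η x = true} := by simp [fullSet]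

lemma bernoulliProduct_fullSet (ρ : I) (F : Finset ℤ) :
    (bernoulliProduct ρ).real (fullSet F) = (ρ : ℝ) ^ F.card := by
  rw [fullSet_eq_pi, measureReal_def, bernoulliProduct,
    Measure.infinitePi_pi _ fun _ _ => measurableSet_singleton _]
  simp only [bernoulliMeasure_singleton_true, Finset.prod_const, ENNReal.toReal_pow]
  rw [ENNReal.toReal_ofReal ρ.2.1]

/-- A measure is determined by the probabilities that finite sets are occupied. -/
lemma eq_of_fullSet {μ ν : Measure Config} [IsProbabilityMeasure μ] [IsProbabilityMeasure ν]
    (h : ∀ F, μ.real (fullSet F) = ν.real (fullSet F)) : μ = ν := by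
  refine ext_of_generate_finite (Set.range fullSet) ?_ ?_ ?_ (by simp)
  · refine le_antisymm ?_ ?_
    · refine iSup_le fun x => ?_
      have hx : @Measurable Config Bool (MeasurableSpace.generateFrom (Set.range fullSet)) _
          fun η => η x := by
        refine @measurable_to_bool Config (MeasurableSpace.generateFrom (Set.range fullSet)) _ ?_
        refine MeasurableSpace.measurableSet_generateFrom ⟨{x}, ?_⟩
        rw [fullSet_singleton]
        rfl
      exact hx.comap_le
    · refine MeasurableSpace.generateFrom_le ?_
      rintro _ ⟨F, rfl⟩
      exact measurableSet_fullSet F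
  · rintro _ ⟨F, rfl⟩ _ ⟨G, rfl⟩ -
    refine ⟨F ∪ G, ?_⟩
    ext η
    simp only [fullSet, Finset.mem_union, Set.mem_inter_iff, Set.mem_ofPred_eq]
    constructor
    · exact fun h => ⟨fun x hx => h x (Or.inl hx), fun x hx => h x (Or.inr hx)⟩
    · rintro ⟨h1, h2⟩ x (hx | hx)
      exacts [h1 x hx, h2 x hx]
  · rintro _ ⟨F, rfl⟩
    have := h F
    rwa [measureReal_def, measureReal_def, ENNReal.toReal_eq_toReal_iff' (measure_ne_top _ _)
      (measure_ne_top _ _)] at this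

lemma IsStationaryCoupling.fullSet_le {α β : Measure Config} {l : Measure (Config × Config)}
    (hl : IsStationaryCoupling b₁ b₂ α β l) (h : ∀ᵐ q ∂l, q.1 ≤ q.2) (F : Finset ℤ) :
    α.real (fullSet F) ≤ β.real (fullSet F) := by
  have := hl.isProb
  rw [← hl.map_fst, ← hl.map_snd, map_measureReal_apply measurable_fst (measurableSet_fullSet F),
    map_measureReal_apply measurable_snd (measurableSet_fullSet F)]
  refine ENNReal.toReal_mono (measure_ne_top _ _) (measure_mono_ae ?_)
  filter_upwards [h] with q hq hqF x hx
  have := hq x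
  rw [hqF x hx] at this
  exact top_le_iff.1 this

/-- Let `a` increase and `b` decrease to `ρ`. One side has no room if `ρ` is `0` or `1`, but there
the bound is trivial for a probability. -/
lemma eq_bernoulliProduct_of_forall {ν : Measure Config} [IsProbabilityMeasure ν] {ρ : I}
    (hlow : ∀ a < ρ, ∀ F, (a : ℝ) ^ F.card ≤ ν.real (fullSet F))
    (hup : ∀ b > ρ, ∀ F, ν.real (fullSet F) ≤ (b : ℝ) ^ F.card) : ν = bernoulliProduct ρ := by
  refine eq_of_fullSet fun F => ?_
  rw [bernoulliProduct_fullSet]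
  have hc : Continuous fun a : ℝ => a ^ F.card := continuous_pow _
  refine le_antisymm ?_ ?_
  · by_cases hρ : ρ = 1
    · rw [hρ]; simp
    · have h1 : (ρ : ℝ) < 1 := lt_of_le_of_ne ρ.2.2 fun h => hρ (Subtype.ext h)
      refine ge_of_tendsto (hc.continuousAt.mono_left nhdsWithin_le_nhds :
        Tendsto _ (𝓝[Set.Ioi (ρ : ℝ)] (ρ : ℝ)) _) ?_
      filter_upwards [Ioo_mem_nhdsGT h1] with b hb
      exact hup ⟨b, ρ.2.1.trans hb.1.le, hb.2.le⟩ hb.1 F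
  · by_cases hρ : ρ = 0
    · by_cases hF : F.card = 0
      · have : F = ∅ := Finset.card_eq_zero.1 hF
        subst this
        simp [fullSet]
      · rw [hρ]; simp [hF]
    · have h1 : (0 : ℝ) < ρ := lt_of_le_of_ne ρ.2.1 fun h => hρ (Subtype.ext h.symm)
      refine le_of_tendsto (hc.continuousAt.mono_left nhdsWithin_le_nhds :
        Tendsto _ (𝓝[Set.Iio (ρ : ℝ)] (ρ : ℝ)) _) ?_
      filter_upwards [Ioo_mem_nhdsLT h1] with a ha
      exact hlow ⟨a, ha.1.le, ha.2.le.trans ρ.2.2⟩ ha.2 F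

/-- Bernoulli product measures are extremal. -/
lemma bernoulliProduct_mem_extremal (hb₁ : 0 < b₁) (h₁ : b₁ < 1) (hb₂ : 0 < b₂) (h₂ : b₂ < 1)
    (ρ : I) : bernoulliProduct ρ ∈ extremal (invariantLaws b₁ b₂) := by
  refine mem_extremal_of_forall (bernoulliProduct_mem h₁ h₂ ρ) fun ν hν p hp hle => ?_
  have := hν.1
  -- A law below a multiple of `μ_ρ` inherits its asymptotic density, hence lies above every `μ_a`
  -- with `a < ρ` and below every `μ_b` with `b > ρ`.
  refine eq_bernoulliProduct_of_forall (fun a ha F => ?_) fun b hb F => ?_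
  · obtain ⟨l, hl, h⟩ := exists_le_coupling hb₁ h₁ hb₂ h₂ (bernoulliProduct_mem h₁ h₂ a) hν ha
      one_ne_zero hp (one_smul _ _).le hle
    rw [← bernoulliProduct_fullSet]
    exact hl.fullSet_le h F
  · obtain ⟨l, hl, h⟩ := exists_le_coupling hb₁ h₁ hb₂ h₂ hν (bernoulliProduct_mem h₁ h₂ b) hb
      hp one_ne_zero hle (one_smul _ _).le
    rw [← bernoulliProduct_fullSet]
    exact hl.fullSet_le h F

/-- Translation invariant extremal measures are Bernoulli product measures. -/
lemma mem_range_bernoulliProduct (hb₁ : 0 < b₁) (h₁ : b₁ < 1) (hb₂ : 0 < b₂) (h₂ : b₂ < 1)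
    {ν : Measure Config} (hν : ν ∈ extremal (invariantLaws b₁ b₂)) (hinv : ν.map (shift 1) = ν) :
    ν ∈ Set.range bernoulliProduct := by
  have := hν.1.1
  -- The independent coupling with `μ_r` is translation invariant, so its time averages have a limit
  -- without annihilation, and extremality selects one order.
  have hdich : ∀ r : I, (∀ F, ν.real (fullSet F) ≤ (r : ℝ) ^ F.card) ∨
      ∀ F, (r : ℝ) ^ F.card ≤ ν.real (fullSet F) := fun r => by
    have hr := bernoulliProduct_mem_extremal hb₁ h₁ hb₂ h₂ r
    obtain ⟨l, hl, hlim⟩ := exists_stationaryCoupling h₁ h₂ hν.1.2 hr.1.2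
      (ls := fun _ => ν.prod (bernoulliProduct r)) (fun _ => inferInstance)
      (fun _ => by rw [Measure.map_fst_prod]; simp) (fun _ => by rw [Measure.map_snd_prod]; simp)
      (S := fun k => k + 1) (fun k => k.lt_succ_self)
    have := hl.isProb
    have hprod : (ν.prod (bernoulliProduct r)).map (pairShift 1) = ν.prod (bernoulliProduct r) := by
      conv_rhs => rw [← hinv, ← bernoulliProduct_map_shift r 1,
        Measure.map_prod_map _ _ (measurable_shift 1) (measurable_shift 1)]
      rfl
    have hord := ae_ordered hb₁ h₁ hb₂ h₂ hl.stationary (timeLimit_invariant h₁ h₂ hprod hlim).2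
    rcases hl.exists_le_or_ge hν hr hord with ⟨l, hl, h⟩ | ⟨l, hl, h⟩
    · refine Or.inl fun F => ?_
      rw [← bernoulliProduct_fullSet]
      exact hl.fullSet_le h F
    · refine Or.inr fun F => ?_
      rw [← bernoulliProduct_fullSet]
      have := hl.isProb
      refine hl.swap.fullSet_le ?_ F
      rw [ae_map_iff measurable_swap.aemeasurable measurableSet_le]
      exact h
  -- The density of `ν` at the origin is the parameter: the singleton `{0}` decides on which side of
  -- `μ_r` the law lies.
  have h0 : ν.real (fullSet {0}) ∈ I := ⟨measureReal_nonneg, measureReal_le_one⟩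
  refine ⟨⟨_, h0⟩, (eq_bernoulliProduct_of_forall (fun a ha => ?_) fun b hb => ?_).symm⟩
  · refine (hdich a).resolve_left fun h => ?_
    have := h {0}
    rw [Finset.card_singleton, pow_one] at this
    exact absurd ha (not_lt.2 this)
  · refine (hdich b).resolve_right fun h => ?_
    have := h {0}
    rw [Finset.card_singleton, pow_one] at this
    exact absurd hb (not_lt.2 this)

end BernoulliProducts

/-! ### From jumping particles to site coins, for a fixed configuration. -/

section Update

variable {η : Config} {u : SiteNoise} {w : StepNoise}

/-- A moving particle that starts at `x` arrives at `l`, according to the site noise. -/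
def IsLanding (η : Config) (u : SiteNoise) (x l : ℤ) : Prop :=
  x < l ∧ (η l = true ∨ u (l, true) = false) ∧
    ∀ z, x < z → z < l → η z = false ∧ u (z, true) = true

/-- Take the last particle `p` before `z`. A landing before `z` would need a later particle or a
stop, against the choice of `p` and `hmid`; passing over `z` contradicts `hz`. -/
lemma exists_landing_eq (hL : ∀ x, η x = true → IsLanding η u x (landing η w x)) {y z : ℤ}
    (hyz : y < z) (hy : η y = true) (hmid : ∀ t, y < t → t < z → η t = true ∨ u (t, true) = true)
    (hz : η z = true ∨ u (z, true) = false) :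
    ∃ p, y ≤ p ∧ p < z ∧ η p = true ∧ landing η w p = z := by
  obtain ⟨p, ⟨hp1, hp2, hp3⟩, hmax⟩ := Int.exists_greatest_of_bdd
    (P := fun p => y ≤ p ∧ p < z ∧ η p = true) ⟨z, fun p hp => hp.2.1.le⟩ ⟨y, le_rfl, hyz, hy⟩
  refine ⟨p, hp1, hp2, hp3, ?_⟩
  obtain ⟨h1, h2, h3⟩ := hL p hp3
  rcases lt_trichotomy (landing η w p) z with h | h | h
  · rcases h2 with h2 | h2
    · have := hmax _ ⟨by omega, h, h2⟩
      omega
    · rcases hmid _ (by omega) h with h4 | h4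
      · have := hmax _ ⟨by omega, h, h4⟩
        omega
      · simp [h2] at h4
  · exact h
  · obtain ⟨h4, h5⟩ := h3 z hp2 h
    simp [h4, h5] at hz

lemma hor_sub_one_of_isLanding {x l : ℤ} (h : IsLanding η u x l) (hx : hor η u x = true) :
    hor η u (l - 1) = true := by
  rw [hor_eq_true] at hx ⊢
  obtain ⟨y, hy, h1, h2, h3⟩ := hx
  have := h.1
  refine ⟨y, by omega, h1, h2, fun z hz hz' => ?_⟩
  by_cases hzx : z ≤ x
  · exact h3 z hz hzx
  · exact Or.inr (h.2.2 z (by omega) (by omega)).2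

/-- A chain of pushes is an uninterrupted path of arrows. Conversely, by induction on the distance
from the source `y`, the last particle before `x` is on the path and lands on `x`. -/
lemma moves_iff_hor (hL : ∀ x, η x = true → IsLanding η u x (landing η w x))
    (hw : ∀ x, (w x).1 = !u (x, false)) {x : ℤ} (hx : η x = true) :
    Moves η w x ↔ hor η u x = true := by
  constructor
  · intro h
    clear hx
    induction h with
    | wake x h1 h2 =>
      rw [hor_rec, h1]
      rw [hw] at h2
      simp_all
    | push y x h h1 h2 h3 ih =>
      have hy : η y = true := by cases h <;> assumption
      have := hor_sub_one_of_isLanding (h2 ▸ hL y hy) ih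
      rw [hor_rec, h1, this]
      simp
  · rw [hor_eq_true]
    rintro ⟨y, hyx, h1, h2, h3⟩
    obtain ⟨n, hn⟩ : ∃ n : ℕ, x = y + n := ⟨(x - y).toNat, by omega⟩
    induction n using Nat.strong_induction_on generalizing x with
    | _ n ih =>
      rcases hyx.eq_or_lt with rfl | hlt
      · exact .wake _ h1 (by simp [hw, h2])
      · obtain ⟨p, hp1, hp2, hp3, hp4⟩ := exists_landing_eq hL hlt h1
          (fun t ht ht' => h3 t ht ht'.le) (Or.inl hx)
        exact .push p x (ih (p - y).toNat (by omega) hp3 hp1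
          (fun z hz hz' => h3 z hz (by omega)) (by omega)) hx hp4 hp2

lemma exists_landing_iff (hL : ∀ x, η x = true → IsLanding η u x (landing η w x)) (z : ℤ) :
    (∃ x, η x = true ∧ hor η u x = true ∧ landing η w x = z) ↔
      hor η u (z - 1) = true ∧ (η z = true ∨ u (z, true) = false) := by
  constructor
  · rintro ⟨x, hx, h, rfl⟩
    exact ⟨hor_sub_one_of_isLanding (hL x hx) h, (hL x hx).2.1⟩
  · rintro ⟨h, hz⟩
    rw [hor_eq_true] at h
    obtain ⟨y, hy, h1, h2, h3⟩ := h
    obtain ⟨p, hp1, hp2, hp3, hp4⟩ := exists_landing_eq hL (by omega) h1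
      (fun t ht ht' => h3 t ht (by omega)) hz
    exact ⟨p, hp3, hor_eq_true.2 ⟨y, hp1, h1, h2, fun t ht ht' => h3 t ht (by omega)⟩, hp4⟩

/-- The update by jumps of particles agrees with the update by site noise. -/
lemma step_eq_out (hL : ∀ x, η x = true → IsLanding η u x (landing η w x))
    (hw : ∀ x, (w x).1 = !u (x, false)) (z : ℤ) : step η w z = out η u z := by
  have h : step η w z = true ↔ (hor η u (z - 1) = true ∧ (η z = true ∨ u (z, true) = false)) ∨
      (η z = true ∧ hor η u z = false) := by
    have hs : step η w z = true ↔ ∃ x, η x = true ∧ newPos η w x = z := by simp [step]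
    rw [← exists_landing_iff hL, hs]
    constructor
    · rintro ⟨x, hx, h⟩
      have hm := moves_iff_hor hL hw hx
      rw [newPos] at h
      split_ifs at h with hmv
      · exact Or.inl ⟨x, hx, hm.1 hmv, h⟩
      · subst h
        exact Or.inr ⟨hx, by simpa [hmv] using hm⟩
    · rintro (⟨x, hx, h1, h2⟩ | ⟨hz, h⟩)
      · exact ⟨x, hx, by rw [newPos, if_pos ((moves_iff_hor hL hw hx).2 h1), h2]⟩
      · refine ⟨z, hz, ?_⟩
        rw [newPos, if_neg]
        rw [moves_iff_hor hL hw hz, h]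
        simp
  rw [Bool.eq_iff_iff, h, out, hor_rec η u z]
  cases η z <;> cases hor η u (z - 1) <;> simp

end Update

/-! ### Realizing both kinds of noise by coins of the particles. -/

section Coins

/-- Coins attached to the particles: `c (x, 0)` says whether the particle at `x` wakes up, and
`c (x, n)` says whether it continues after `n` steps. -/
abbrev Coins : Type := ℤ × ℕ → Bool

/-- The law of the coins of one particle. -/
def coinLaw (b₁ b₂ : I) (n : ℕ) : Measure Bool :=
  bernoulliMeasure true false (if n = 0 then σ b₁ else b₂)

instance (b₁ b₂ : I) (n : ℕ) : IsProbabilityMeasure (coinLaw b₁ b₂ n) := by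
  unfold coinLaw; infer_instance

/-- The law of all coins. -/
def coinsLaw (b₁ b₂ : I) : Measure Coins :=
  Measure.infinitePi fun p : ℤ × ℕ => coinLaw b₁ b₂ p.2

/-- The noise `(χ x, j x)` of a particle with given coins. -/
def coinNoise (c : ℕ → Bool) : Bool × ℕ := (!c 0, sInf {n | 0 < n ∧ c n = false})

/-- The distance from `x` to the next occupied site on its left; this is `1` if there is none. -/
def gap (η : Config) (x : ℤ) : ℕ := max 1 (sInf {n : ℕ | 0 < n ∧ η (x - n) = true})

/-- The site noise which the coins induce. -/
def siteOfCoins (η : Config) (c : Coins) : SiteNoise := fun p =>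
  c (p.1 - (bif p.2 then gap η p.1 else 0 : ℕ), bif p.2 then gap η p.1 else 0)

lemma gap_eq {η : Config} {x : ℤ} {n : ℕ} (hx : η x = true) (hn : 0 < n)
    (h : ∀ z, x < z → z < x + n → η z = false) : gap η (x + n) = n := by
  have hmem : n ∈ {m : ℕ | 0 < m ∧ η (x + n - m) = true} := ⟨hn, by simpa using hx⟩
  have h1 := Nat.sInf_le hmem
  have h2 := Nat.sInf_mem ⟨n, hmem⟩
  have h3 : ¬ sInf {m : ℕ | 0 < m ∧ η (x + n - m) = true} < n := fun hlt => by
    have h4 := h2.1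
    have := h _ (by omega) (by omega) |>.symm.trans h2.2
    simp at this
  rw [gap]
  omega

lemma gap_spec {η : Config} {x z : ℤ} (hx : η x = true) (hxz : x < z) :
    0 < gap η z ∧ (gap η z : ℤ) ≤ z - x ∧ η (z - gap η z) = true := by
  have hmem : (z - x).toNat ∈ {m : ℕ | 0 < m ∧ η (z - m) = true} := by
    refine ⟨by omega, ?_⟩
    rwa [show z - ((z - x).toNat : ℤ) = x by omega]
  have h1 := Nat.sInf_le hmem
  have h2 := Nat.sInf_mem ⟨_, hmem⟩
  have h3 := h2.1
  have e : gap η z = sInf {m : ℕ | 0 < m ∧ η (z - m) = true} := by rw [gap]; omega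
  rw [e]
  exact ⟨h2.1, by omega, h2.2⟩

lemma siteOfCoins_true {η : Config} {c : Coins} {x : ℤ} {n : ℕ} (hx : η x = true) (hn : 0 < n)
    (h : ∀ z, x < z → z < x + n → η z = false) : siteOfCoins η c (x + n, true) = c (x, n) := by
  simp [siteOfCoins, gap_eq hx hn h]

/-- Until the next particle, the site `x + n` reads the coin `(x, n)`, so the first failing coin or
the next particle ends the run in both descriptions. Resets exclude an infinite run, where `sInf ∅ =
0` would intervene. -/
lemma isLanding_of_coins {η : Config} {c : Coins} (hu : ManyResets (siteOfCoins η c)) {x : ℤ}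
    (hx : η x = true) :
    IsLanding η (siteOfCoins η c) x (landing η (fun y => coinNoise fun n => c (y, n)) x) := by
  set S := {n : ℕ | 0 < n ∧ (n = (coinNoise fun n => c (x, n)).2 ∨ η (x + n) = true)} with hS
  have hJ : ∀ n, 0 < n → c (x, n) = false → (coinNoise fun n => c (x, n)).2 ≤ n ∧
      0 < (coinNoise fun n => c (x, n)).2 := fun n hn hc => by
    have hmem : n ∈ {n | 0 < n ∧ c (x, n) = false} := ⟨hn, hc⟩
    exact ⟨Nat.sInf_le hmem, (Nat.sInf_mem ⟨n, hmem⟩).1⟩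
  -- A reset site beyond `x` shows a failing coin. It belongs to `x`, whose jump is then finite, or
  -- to a later particle, which blocks `x`.
  have hne : S.Nonempty := by
    obtain ⟨y, hy, -, hy2⟩ := (hu (x + 1)).2
    obtain ⟨h1, h2, h3⟩ := gap_spec hx (show x < y by omega)
    by_cases hyx : y - gap η y = x
    · refine ⟨_, (hJ (gap η y) h1 ?_).2, Or.inl rfl⟩
      simpa [siteOfCoins, hyx] using hy2
    · refine ⟨(y - gap η y - x).toNat, by omega, Or.inr ?_⟩
      rwa [show x + ((y - gap η y - x).toNat : ℤ) = y - gap η y by omega]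
  have hmem := Nat.sInf_mem hne
  have hmin : ∀ n, n < sInf S → n ∉ S := fun n hn h => absurd (Nat.sInf_le h) (by omega)
  have hfree : ∀ z, x < z → z < x + (sInf S : ℕ) → η z = false := fun z h1 h2 => by
    by_contra hz
    refine hmin (z - x).toNat (by omega) ⟨by omega, Or.inr ?_⟩
    rw [show x + ((z - x).toNat : ℤ) = z by omega]
    simpa using hz
  change IsLanding η _ x (x + (sInf S : ℕ))
  refine ⟨by have := hmem.1; omega, ?_, fun z h1 h2 => ⟨hfree z h1 h2, ?_⟩⟩
  · rcases hmem.2 with h | h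
    · right
      rw [siteOfCoins_true hx hmem.1 hfree]
      -- If no coin fails, the jump length takes the default value `0`, but the landing distance is
      -- positive.
      have hn : {n | 0 < n ∧ c (x, n) = false}.Nonempty := by
        by_contra hemp
        have h0 : (coinNoise fun n => c (x, n)).2 = 0 := by
          simp only [coinNoise]
          rw [Set.not_nonempty_iff_eq_empty.1 hemp, Nat.sInf_empty]
        have := hmem.1
        omega
      rw [h]
      exact (Nat.sInf_mem hn).2
    · exact Or.inl h
  · obtain ⟨n, rfl⟩ : ∃ n : ℕ, z = x + n := ⟨(z - x).toNat, by omega⟩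
    rw [siteOfCoins_true hx (by omega) fun z h1 h3 => hfree z h1 (by omega)]
    by_contra hc
    obtain ⟨h3, h4⟩ := hJ n (by omega) (by simpa using hc)
    exact hmin _ (by omega) ⟨h4, Or.inl rfl⟩

lemma shift_step_coins {η : Config} {c : Coins} (hu : ManyResets (siteOfCoins η c)) :
    shift 1 (step η fun y => coinNoise fun n => c (y, n)) = siteStep η (siteOfCoins η c) := by
  funext x
  exact step_eq_out (fun x hx => isLanding_of_coins hu hx)
    (fun x => by simp [coinNoise, siteOfCoins]) (x + 1)

end Coins

/-! ### Equality of the two evolutions, and the Markov property. -/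

section StationaryLaws

variable {b₁ b₂ : I}

lemma measurable_coinNoise : Measurable coinNoise := by
  have h0 : ∀ (n : ℕ) (b : Bool), MeasurableSet {c : ℕ → Bool | c n = b} := fun n b =>
    measurableSet_apply_eq (measurable_pi_apply n) b
  refine Measurable.prodMk ((measurable_of_countable (fun b : Bool => !b)).comp
    (measurable_pi_apply 0)) ?_
  refine measurable_of_Iio fun k => ?_
  have : (fun c : ℕ → Bool => sInf {n | 0 < n ∧ c n = false}) ⁻¹' Set.Iio k =
      {c | (∃ n, n < k ∧ 0 < n ∧ c n = false) ∨ (0 < k ∧ ∀ n, 0 < n → ¬ c n = false)} := by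
    ext c
    simp only [Set.mem_preimage, Set.mem_Iio, Set.mem_ofPred_eq]
    constructor
    · intro h
      by_cases hne : {n | 0 < n ∧ c n = false}.Nonempty
      · exact Or.inl ⟨_, h, Nat.sInf_mem hne⟩
      · exact Or.inr ⟨by omega, fun n hn hc => hne ⟨n, hn, hc⟩⟩
    · rintro (⟨n, hn, h⟩ | ⟨hk, h⟩)
      · exact (Nat.sInf_le h).trans_lt hn
      · rwa [show {n | 0 < n ∧ c n = false} = ∅ from
          Set.eq_empty_of_forall_notMem fun n hn => h n hn.1 hn.2, Nat.sInf_empty]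
  rw [this]
  have h1 : MeasurableSet {c : ℕ → Bool | ∃ n, n < k ∧ 0 < n ∧ c n = false} := by
    simp only [Set.ofPred_exists]
    exact .iUnion fun n => (MeasurableSet.const _).inter ((MeasurableSet.const _).inter (h0 n _))
  have h2 : MeasurableSet {c : ℕ → Bool | 0 < k ∧ ∀ n, 0 < n → ¬ c n = false} := by
    have : {c : ℕ → Bool | 0 < k ∧ ∀ n, 0 < n → ¬ c n = false} =
        {_c | 0 < k} ∩ ⋂ n, ⋂ _ : 0 < n, {c | c n = false}ᶜ := by ext c; simp
    rw [this]
    exact (MeasurableSet.const _).inter (.iInter fun n => .iInter fun _ => (h0 n _).compl)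
  exact h1.union h2

lemma coinNoise_eq_iff {c : ℕ → Bool} {b : Bool} {n : ℕ} : coinNoise c = (b, n + 1) ↔
    ∀ i ∈ Finset.range (n + 2), c i = if i = 0 then !b else decide (i ≠ n + 1) := by
  have hJ : sInf {m | 0 < m ∧ c m = false} = n + 1 ↔
      c (n + 1) = false ∧ ∀ m, 0 < m → m < n + 1 → c m = true := by
    constructor
    · intro h
      have hne : {m | 0 < m ∧ c m = false}.Nonempty := by
        by_contra hemp
        rw [Set.not_nonempty_iff_eq_empty.1 hemp, Nat.sInf_empty] at h
        omega
      have h1 := Nat.sInf_mem hne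
      rw [h] at h1
      refine ⟨h1.2, fun m hm hmn => ?_⟩
      by_contra hc
      have hmem : m ∈ {m | 0 < m ∧ c m = false} := ⟨hm, by simpa using hc⟩
      have := Nat.sInf_le hmem
      omega
    · rintro ⟨h1, h2⟩
      have hmem : n + 1 ∈ {m | 0 < m ∧ c m = false} := ⟨n.succ_pos, h1⟩
      refine le_antisymm (Nat.sInf_le hmem) ?_
      by_contra hlt
      obtain ⟨h3, h4⟩ := Nat.sInf_mem ⟨_, hmem⟩
      have := h2 _ h3 (by omega)
      rw [h4] at this
      simp at this
  rw [coinNoise, Prod.mk.injEq, hJ]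
  constructor
  · rintro ⟨rfl, h1, h2⟩ i hi
    rw [Finset.mem_range] at hi
    split_ifs with h0
    · simp [h0]
    · by_cases hin : i = n + 1
      · simp [hin, h1]
      · simp [hin, h2 i (by omega) (by omega)]
  · intro h
    refine ⟨by simp [h 0 (by simp)], by simpa using h (n + 1) (by simp), fun m hm hmn => ?_⟩
    rw [h m (Finset.mem_range.2 (by omega)), if_neg (by omega)]
    simp; omega

lemma jumpLaw_singleton_succ (h₂ : b₂ < 1) (n : ℕ) :
    jumpLaw b₂ {n + 1} = ENNReal.ofReal ((b₂ : ℝ) ^ n * (1 - b₂)) := by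
  have hσ : σ b₂ ≠ 0 := fun h => h₂.ne (by rw [← unitInterval.symm_symm b₂, h, unitInterval.symm_zero])
  rw [jumpLaw, Measure.map_apply (by fun_prop) (measurableSet_singleton _)]
  have : (fun n : ℕ => n + 1) ⁻¹' {n + 1} = {n} := by ext m; simp
  rw [this, geometricMeasure_singleton hσ]
  simp

lemma jumpLaw_singleton_zero : jumpLaw b₂ {0} = 0 := by
  rw [jumpLaw, Measure.map_apply (by fun_prop) (measurableSet_singleton _)]
  have : (fun n : ℕ => n + 1) ⁻¹' {0} = ∅ := by ext m; simp
  rw [this, measure_empty]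

lemma infinitePi_coinLaw_box (b : Bool) (n : ℕ) :
    Measure.infinitePi (coinLaw b₁ b₂) {c | coinNoise c = (b, n + 1)} =
      bernoulliMeasure true false b₁ {b} * ENNReal.ofReal ((b₂ : ℝ) ^ n * (1 - b₂)) := by
  have h := Measure.infinitePi_pi (s := Finset.range (n + 2))
    (t := fun i => {if i = 0 then !b else decide (i ≠ n + 1)}) (coinLaw b₁ b₂)
    (fun _ _ => measurableSet_singleton _)
  have e : {c | coinNoise c = (b, n + 1)} = Set.pi (Finset.range (n + 2))
      (fun i => ({if i = 0 then !b else decide (i ≠ n + 1)} : Set Bool)) := by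
    ext c
    simp only [Set.mem_ofPred_eq, coinNoise_eq_iff]
    rfl
  rw [e, h, Finset.prod_range_succ, Finset.prod_range_succ']
  have h1 : ∀ i ∈ Finset.range n, coinLaw b₁ b₂ (i + 1)
      {if i + 1 = 0 then !b else decide (i + 1 ≠ n + 1)} = ENNReal.ofReal b₂ := fun i hi => by
    have : i ≠ n := (Finset.mem_range.1 hi).ne
    simpa [coinLaw, this] using bernoulliMeasure_singleton_true b₂
  rw [Finset.prod_congr rfl h1, Finset.prod_const, Finset.card_range, mul_right_comm, mul_comm,
    ENNReal.ofReal_mul (pow_nonneg b₂.2.1 _), ENNReal.ofReal_pow b₂.2.1]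
  congr 1
  · cases b <;> simp [coinLaw]
  · simpa [coinLaw] using congrArg _ (bernoulliMeasure_singleton_false b₂)

/-- Domination on singletons suffices, because both measures have mass one. The default value for
coins that never fail needs no computation: `jumpLaw` has no mass at `0`. -/
lemma map_coinNoise (h₂ : b₂ < 1) : (Measure.infinitePi (coinLaw b₁ b₂)).map coinNoise =
    (bernoulliMeasure true false b₁).prod (jumpLaw b₂) := by
  have : IsProbabilityMeasure ((Measure.infinitePi (coinLaw b₁ b₂)).map coinNoise) :=
    Measure.isProbabilityMeasure_map measurable_coinNoise.aemeasurable
  refine (Measure.eq_of_le_of_measure_univ_eq (Measure.le_iff.2 fun s hs => ?_) (by simp)).symm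
  rw [← Measure.tsum_indicator_apply_singleton _ s hs, ← Measure.tsum_indicator_apply_singleton _ s hs]
  refine ENNReal.tsum_le_tsum fun p => Set.indicator_le_indicator ?_
  obtain ⟨b, n⟩ := p
  rw [← Set.singleton_prod_singleton, Measure.prod_prod, Set.singleton_prod_singleton]
  cases n with
  | zero => simp [jumpLaw_singleton_zero]
  | succ n =>
    rw [jumpLaw_singleton_succ h₂, Measure.map_apply measurable_coinNoise (measurableSet_singleton _)]
    exact (infinitePi_coinLaw_box b n).ge

lemma measurable_stepNoise : Measurable fun (c : Coins) (x : ℤ) => coinNoise fun n => c (x, n) :=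
  measurable_pi_lambda _ fun x => measurable_coinNoise.comp
    (measurable_pi_lambda _ fun n => measurable_pi_apply (x, n))

lemma coinsLaw_map_stepNoise (h₂ : b₂ < 1) :
    (coinsLaw b₁ b₂).map (fun c x => coinNoise fun n => c (x, n)) = stepNoiseLaw b₁ b₂ := by
  have h := Measure.infinitePi_map_curry (X := Bool) (ι := ℤ) (κ := ℕ)
    (fun _ n => coinLaw b₁ b₂ n)
  have h' : (coinsLaw b₁ b₂).map (fun c x n => c (x, n)) = Measure.infinitePi fun _ : ℤ =>
    Measure.infinitePi (coinLaw b₁ b₂) := h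
  have h2 := Measure.infinitePi_map_pi (μ := fun _ : ℤ => Measure.infinitePi (coinLaw b₁ b₂))
    (f := fun _ => coinNoise) (fun _ => measurable_coinNoise)
  rw [stepNoiseLaw, ← map_coinNoise h₂, ← h2, ← h', Measure.map_map]
  · rfl
  · exact measurable_pi_lambda _ fun x => measurable_coinNoise.comp (measurable_pi_apply x)
  · fun_prop

lemma measurable_siteOfCoins (η : Config) : Measurable (siteOfCoins η) :=
  measurable_pi_lambda _ fun _ => measurable_pi_apply _

/-- For fixed `η` different sites read different coins: the coin `(x - gap η x, gap η x)` determines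
`x` as the sum of its indices, and the wake-up coins have second index `0`. So this is an injective
selection from independent coins. -/
lemma coinsLaw_map_siteOfCoins (η : Config) :
    (coinsLaw b₁ b₂).map (siteOfCoins η) = siteNoiseLaw b₁ b₂ := by
  have hpos : ∀ x, gap η x ≠ 0 := fun x => by rw [gap]; omega
  have hinj : Function.Injective fun p : ℤ × Bool =>
      ((p.1 - (bif p.2 then gap η p.1 else 0 : ℕ), bif p.2 then gap η p.1 else 0) : ℤ × ℕ) := by
    rintro ⟨x, b⟩ ⟨y, b'⟩ h
    simp only [Prod.mk.injEq] at h
    obtain ⟨h1, h2⟩ := h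
    have hxy : x = y := by rw [h2] at h1; omega
    subst hxy
    have := hpos x
    have hb : b = b' := by
      cases b <;> cases b'
      exacts [rfl, absurd h2.symm this, absurd h2 this, rfl]
    rw [hb]
  have h := Measure.map_infinitePi_infinitePi_of_inj
    (P := fun p : ℤ × ℕ => coinLaw b₁ b₂ p.2) hinj
  refine h.trans ?_
  rw [siteNoiseLaw]
  congr 1
  funext ⟨x, b⟩
  cases b <;> simp [coinLaw, hpos]

/-- The two updates agree in law, for every initial configuration. -/
lemma map_shift_step (h₁ : b₁ < 1) (h₂ : b₂ < 1) (η : Config) :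
    (stepNoiseLaw b₁ b₂).map (fun w => shift 1 (step η w)) =
      (siteNoiseLaw b₁ b₂).map fun u => siteStep η u := by
  have hm1 : Measurable fun w => shift 1 (step η w) :=
    (measurable_shift 1).comp (measurable_step.comp (measurable_const.prodMk measurable_id))
  have hm2 : Measurable fun u => siteStep η u :=
    measurable_siteStep.comp (measurable_const.prodMk measurable_id)
  rw [← coinsLaw_map_stepNoise h₂, ← coinsLaw_map_siteOfCoins η,
    Measure.map_map hm1 measurable_stepNoise, Measure.map_map hm2 (measurable_siteOfCoins η)]
  refine Measure.map_congr ?_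
  have h := ae_manyResets h₁ h₂
  rw [← coinsLaw_map_siteOfCoins η] at h
  filter_upwards [ae_of_ae_map (measurable_siteOfCoins η).aemeasurable h] with c hc
  exact shift_step_coins hc

lemma evolve_congr {X U V : Type*} [MeasurableSpace X] [MeasurableSpace U] [MeasurableSpace V]
    {N : Measure U} [IsProbabilityMeasure N] {N' : Measure V} [IsProbabilityMeasure N']
    {Φ : X → U → X} {Ψ : X → V → X} (hΦ : Measurable fun p : X × U => Φ p.1 p.2)
    (hΨ : Measurable fun p : X × V => Ψ p.1 p.2) (h : ∀ x, N.map (Φ x) = N'.map (Ψ x))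
    (μ : Measure X) [SFinite μ] : evolve N Φ μ = evolve N' Ψ μ := by
  ext s hs
  rw [evolve, evolve, Measure.map_apply hΦ hs, Measure.map_apply hΨ hs,
    Measure.prod_apply (hΦ hs), Measure.prod_apply (hΨ hs)]
  refine lintegral_congr fun x => ?_
  have : N.map (Φ x) s = N'.map (Ψ x) s := by rw [h]
  have hΦx : Measurable (Φ x) := hΦ.comp (measurable_const.prodMk measurable_id)
  have hΨx : Measurable (Ψ x) := hΨ.comp (measurable_const.prodMk measurable_id)
  rwa [Measure.map_apply hΦx hs, Measure.map_apply hΨx hs] at this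

lemma map_shift_evolve_step (h₁ : b₁ < 1) (h₂ : b₂ < 1) (μ : Measure Config) [SFinite μ] :
    (evolve (stepNoiseLaw b₁ b₂) step μ).map (shift 1) = siteEvolve b₁ b₂ μ := by
  have hm : Measurable fun p : Config × StepNoise => shift 1 (step p.1 p.2) :=
    (measurable_shift 1).comp measurable_step
  rw [siteEvolve, ← evolve_congr hm measurable_siteStep (map_shift_step h₁ h₂), evolve, evolve,
    Measure.map_map (measurable_shift 1) measurable_step]
  rfl

lemma process_update (η : Config) (ω : ℕ → StepNoise) (w : StepNoise) {t s : ℕ} (h : t ≤ s) :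
    process η (Function.update ω s w) t = process η ω t := by
  induction t with
  | zero => rfl
  | succ t ih =>
    rw [process, process, ih (by omega), Function.update_of_ne (by omega)]

lemma measurable_process (t : ℕ) :
    Measurable fun p : Config × (ℕ → StepNoise) => process p.1 p.2 t := by
  induction t with
  | zero => exact measurable_fst
  | succ t ih => exact measurable_step.comp (ih.prodMk ((measurable_pi_apply t).comp measurable_snd))

/-- The Markov property of the occupation process. -/
lemma map_process (μ : Measure Config) [IsProbabilityMeasure μ] (t : ℕ) :
    (μ.prod (noiseLaw b₁ b₂)).map (fun p => process p.1 p.2 t) =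
      (evolve (stepNoiseLaw b₁ b₂) step)^[t] μ := by
  induction t with
  | zero => exact (Measure.map_fst_prod).trans (by simp)
  | succ t ih =>
    have hupd : Measurable fun p : (ℕ → StepNoise) × StepNoise => Function.update p.1 t p.2 :=
      measurable_pi_lambda _ fun j => by
        by_cases h : j = t
        · subst h; simpa using measurable_snd
        · simpa [Function.update_of_ne h] using measurable_fst.eval
    -- Resample the noise at time `t`. The configuration at time `t` does not use it, so the fresh
    -- copy provides the independence of one more step.
    have hnoise : ((noiseLaw b₁ b₂).prod (stepNoiseLaw b₁ b₂)).map
        (fun p => Function.update p.1 t p.2) = noiseLaw b₁ b₂ :=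
      infinitePi_map_update (fun _ : ℕ => stepNoiseLaw b₁ b₂) t
    have hupd' : Measurable fun q : (Config × (ℕ → StepNoise)) × StepNoise =>
        (q.1.1, Function.update q.1.2 t q.2) :=
      (measurable_id.prodMap hupd).comp MeasurableEquiv.prodAssoc.measurable
    have hL : ((μ.prod (noiseLaw b₁ b₂)).prod (stepNoiseLaw b₁ b₂)).map
        (fun q => (q.1.1, Function.update q.1.2 t q.2)) = μ.prod (noiseLaw b₁ b₂) := by
      conv_rhs => rw [← hnoise, ← Measure.map_id (μ := μ), Measure.map_prod_map _ _ measurable_id hupd,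
        ← Measure.prodAssoc_prod, Measure.map_map (measurable_id.prodMap hupd)
          MeasurableEquiv.prodAssoc.measurable]
      rfl
    have hR : ((μ.prod (noiseLaw b₁ b₂)).map fun p => process p.1 p.2 t).prod (stepNoiseLaw b₁ b₂) =
        ((μ.prod (noiseLaw b₁ b₂)).prod (stepNoiseLaw b₁ b₂)).map
          (Prod.map (fun p => process p.1 p.2 t) id) := by
      rw [← Measure.map_prod_map _ _ (measurable_process t) measurable_id, Measure.map_id]
    rw [Function.iterate_succ_apply', ← ih, evolve, hR, ← hL,
      Measure.map_map (measurable_process _) hupd',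
      Measure.map_map measurable_step ((measurable_process t).prodMap measurable_id), hL]
    refine congrArg (fun f => Measure.map f _) (funext fun q => ?_)
    simp [process, process_update]

lemma evolve_step_iterate_shift (h₁ : b₁ < 1) (h₂ : b₂ < 1) (μ : Measure Config)
    [IsProbabilityMeasure μ] (t : ℕ) :
    ((evolve (stepNoiseLaw b₁ b₂) step)^[t] μ).map (shift t) = (siteEvolve b₁ b₂)^[t] μ := by
  induction t with
  | zero =>
    have : shift (0 : ℕ) = id := by funext η x; simp [shift]
    rw [this, Measure.map_id]; rfl
  | succ t ih =>
    have hp := isProbabilityMeasure_evolve_iterate (N := stepNoiseLaw b₁ b₂) measurable_step μ t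
    have e : shift ((t + 1 : ℕ) : ℤ) = shift t ∘ shift 1 := by
      funext η x; simp only [shift, Function.comp]; congr 1; push_cast; ring
    rw [Function.iterate_succ_apply', Function.iterate_succ_apply', ← ih, e,
      ← Measure.map_map (measurable_shift _) (measurable_shift _), map_shift_evolve_step h₁ h₂]
    exact (evolve_map measurable_siteStep measurable_siteStep (measurable_shift t)
      (measurePreserving_shiftNoise b₁ b₂ t) (siteStep_shift t · · |>.symm) _).symm

lemma shiftedLaw_eq (h₁ : b₁ < 1) (h₂ : b₂ < 1) (μ : Measure Config) [IsProbabilityMeasure μ]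
    (t : ℕ) : shiftedLaw b₁ b₂ μ t = (siteEvolve b₁ b₂)^[t] μ := by
  rw [← evolve_step_iterate_shift h₁ h₂, ← map_process,
    Measure.map_map (measurable_shift _) (measurable_process t)]
  rfl

theorem stationary_eq (h₁ : b₁ < 1) (h₂ : b₂ < 1) : stationary b₁ b₂ = invariantLaws b₁ b₂ := by
  ext μ
  constructor
  · rintro ⟨hμ, h⟩
    exact ⟨hμ, (shiftedLaw_eq h₁ h₂ μ 1).symm.trans (h 1)⟩
  · rintro ⟨hμ, h⟩
    exact ⟨hμ, fun t => (shiftedLaw_eq h₁ h₂ μ t).trans (Function.iterate_fixed h t)⟩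

end StationaryLaws

end S6V

end

theorem mainTheorem2 (b₁ b₂ : unitInterval) (hb₁ : 0 < b₁) (hb₁' : b₁ < 1)
    (hb₂ : 0 < b₂) (hb₂' : b₂ < 1) (hq : S6V.ratio b₁ b₂ ≠ 1) :
    S6V.extremal (S6V.stationary b₁ b₂) =
      Set.range S6V.bernoulliProduct ∪ Set.range (S6V.blockingMeasure b₁ b₂) := by
  rw [S6V.stationary_eq hb₁' hb₂']
  ext ν
  constructor
  · intro hν
    rcases S6V.invariant_or_isStep hb₁ hb₁' hb₂ hb₂' hν with h | ⟨e, he⟩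
    · exact Or.inl (S6V.mem_range_bernoulliProduct hb₁ hb₁' hb₂ hb₂' hν h)
    · exact Or.inr (S6V.mem_range_blockingMeasure hb₁ hb₁' hb₂ hb₂' hq hν he)
  · rintro (⟨ρ, rfl⟩ | ⟨n, rfl⟩)
    · exact S6V.bernoulliProduct_mem_extremal hb₁ hb₁' hb₂ hb₂' ρ
    · exact S6V.blockingMeasure_mem hb₁ hb₁' hb₂ hb₂' hq n
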